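/- An election consists of $m$ parties $P_1,\dots,P_m$ and a list of $n$ votes, each a strict ranking of all parties. Given a threshold $\tau\in\mathbb{N}$, the support $\sigma(P)$ of a party $P$ is the number of votes ranking $P$ first if this number is at least $\tau$, and $0$ otherwise. A divisor sequence method $\mathcal{R}$ is given by real numbers $1\le d_1<d_2<\cdots$ that are polynomially bounded in $i$ and such that $d_i$ can be computed exactly in time polynomial in $i$. That is, either all $d_i$ are rational and a numerator and a denominator of $d_i$ (in binary) can be computed in time polynomial in $i$, or, more generally, for $i,j\ge 1$ and $x,y\in\mathbb{N}$ it can be decided in time polynomial in $i,j,x,y$ whether $x\,d_i\le y\,d_j$. To distribute $\kappa$ seats, form the fraction list $\sigma(P)/d_1,\dots,\sigma(P)/d_\kappa$ of each party $P$; each party receives one seat for each of its entries among the $\kappa$ highest entries of all lists, ties being broken in favor of the party with the lower index. If no party reaches the threshold, the seat allocation is undefined. (D'Hondt is $1,2,3,\dots$; Sainte-Laguë is $1,3,5,\dots$.) The problem $\mathcal{R}$-Apportionment-Bribery ($\mathcal{R}$-AB) is the following. Given an election with $n$ votes, a threshold $\tau$, a number of seats $\kappa\le n$, a distinguished party $P^*$,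 a desired number of seats $\ell$ with $1\le\ell\le\kappa$, and a budget $K$ with $0\le K\le n$, is it possible to change at most $K$ votes arbitrarily so that the seat allocation of the resulting election under $\mathcal{R}$ is defined and gives $P^*$ at least $\ell$ seats? In the input, the $n$ votes are listed one by one, and all numbers are written in binary. Theorem. For each divisor sequence method $\mathcal{R}$, the problem $\mathcal{R}$-AB is in $\mathrm{P}$ (the language of all words that encode a yes-instance is decided by a deterministic Turing machine in time polynomial in the length of the word). -/

import Mathlib

noncomputable section

open Computability Turing

open scoped Classical

namespace Apportionment

/-! ### Elections, support and divisor sequence methods -/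

/-- An election with the parties `0, …, m - 1` and a list of `n` votes, each of them a strict
ranking of all parties: `E v r` is the party that vote `v` ranks at position `r`, and position `0`
is the most preferred one. -/
abbrev Election (m n : ℕ) : Type := Fin n → Equiv.Perm (Fin m)

variable {m n : ℕ}

/-- The number of votes whose top choice is `P`. -/
def topChoices (E : Election m n) (P : Fin m) : ℕ :=
  (Finset.univ.filter fun v : Fin n => ((E v).symm P : ℕ) = 0).card

/-- The support allocation in the top-choice mode: the number of top choices of a party that
reaches the threshold `τ`, and `0` for any other party. -/
def support (E : Election m n) (τ : ℕ) (P : Fin m) : ℕ :=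
  if τ ≤ topChoices E P then topChoices E P else 0

/-- Entry number `x.2` (counted from `0`) in the fraction list of party `x.1`. The divisors are
`d 0, d 1, …`, that is, `d i` is the divisor usually written with the index `i + 1`. -/
def fraction (d : ℕ → ℝ) (σ : Fin m → ℕ) {κ : ℕ} (x : Fin m × Fin κ) : ℝ :=
  (σ x.1 : ℝ) / d (x.2 : ℕ)

/-- The entry `x` of the fraction lists is served before the entry `y`: it has the higher value, or
they tie and `x` belongs to the party with the lower index (or, within one list, comes earlier). -/
def Precedes (d : ℕ → ℝ) (σ : Fin m → ℕ) {κ : ℕ} (x y : Fin m × Fin κ) : Prop :=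
  fraction d σ y < fraction d σ x ∨
    (fraction d σ x = fraction d σ y ∧ (x.1 < y.1 ∨ (x.1 = y.1 ∧ x.2 < y.2)))

/-- The number of seats of `P`: the number of entries in its fraction list that are among the
`κ` first ones of all fraction lists, that is, that are preceded by fewer than `κ` entries. -/
def seats (d : ℕ → ℝ) (σ : Fin m → ℕ) (κ : ℕ) (P : Fin m) : ℕ :=
  (Finset.univ.filter fun j : Fin κ =>
    (Finset.univ.filter fun x : Fin m × Fin κ => Precedes d σ x (P, j)).card < κ).card

/-- The seat allocation of the divisor sequence method with divisors `d`; it is undefined (`none`)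
if no party reaches the threshold. -/
def seatAllocation (d : ℕ → ℝ) (E : Election m n) (τ κ : ℕ) : Option (Fin m → ℕ) :=
  if ∃ P : Fin m, τ ≤ topChoices E P then some (seats d (support E τ) κ) else none

/-! ### Apportionment bribery -/

/-- An instance of apportionment bribery. -/
structure Instance where
  /-- number of parties -/
  m : ℕ
  /-- number of votes -/
  n : ℕ
  /-- the election -/
  E : Election m n
  /-- threshold -/
  τ : ℕ
  /-- number of seats -/
  κ : ℕ
  /-- distinguished party -/
  pstar : Fin m
  /-- desired number of seats -/
  ℓ : ℕ
  /-- budget -/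
  K : ℕ
  one_le_ℓ : 1 ≤ ℓ
  ℓ_le_κ : ℓ ≤ κ
  κ_le_n : κ ≤ n
  K_le_n : K ≤ n

/-- It is possible to change at most `K` votes (arbitrarily) in such a way that the distinguished
party receives at least `ℓ` seats. -/
def Instance.Successful (d : ℕ → ℝ) (I : Instance) : Prop :=
  ∃ E' : Election I.m I.n,
    (Finset.univ.filter fun v : Fin I.n => E' v ≠ I.E v).card ≤ I.K ∧
      ∃ α ∈ seatAllocation d E' I.τ I.κ, I.ℓ ≤ α I.pstar

/-! ### Encodings and polynomial time -/

/-- A natural number in binary (least significant bit first, no superfluous zeros), followed by the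
separator `none`. -/
def encodeNumber (a : ℕ) : List (Option Bool) := a.bits.map some ++ [none]

/-- A list of natural numbers in binary, each of them followed by the separator. -/
def encodeNumbers (l : List ℕ) : List (Option Bool) := l.flatMap encodeNumber

/-- The word for an instance: the six numbers in binary, then all votes, one after the other, each
of them written as the list of its `m` parties from the most to the least preferred one. -/
def Instance.encode (I : Instance) : List (Option Bool) :=
  encodeNumbers ([I.m, I.τ, I.κ, (I.pstar : ℕ), I.ℓ, I.K] ++
    (List.ofFn fun v : Fin I.n => List.ofFn fun r : Fin I.m => (I.E v r : ℕ)).flatten)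

/-- The decision problem apportionment bribery for the divisor sequence method with divisors `d`:
the language of all words that encode an instance with a successful campaign. -/
def AB (d : ℕ → ℝ) : Language (Option Bool) :=
  {w | ∃ I : Instance, I.encode = w ∧ I.Successful d}

/-- The complexity class P: the characteristic function of `L` is computed, on all words, by a
(multi-stack) Turing machine in a number of steps that is polynomial in the length of the word. -/
def InP {Γ : Type} (L : Language Γ) : Prop :=
  Nonempty (TM2ComputableInPolyTime (id : List Γ → List Γ) encodeBool fun w => decide (w ∈ L))

/-- The values `d i` are rational, and a numerator and a denominator of `d i` (in binary) can be
computed in time polynomial in `i`. -/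
def PolyTimeRational (d : ℕ → ℝ) : Prop :=
  ∃ a b : ℕ → ℕ, (∀ i, d i = (a i : ℝ) / (b i : ℝ)) ∧
    Nonempty (TM2ComputableInPolyTime unaryEncodeNat encodeNumbers fun i => [a i, b i])

/-- Four natural numbers in unary, each of them followed by `false`. -/
def encodeUnaryQuadruple (q : ℕ × ℕ × ℕ × ℕ) : List Bool :=
  [q.1, q.2.1, q.2.2.1, q.2.2.2].flatMap fun k => unaryEncodeNat k ++ [false]

/-- Exact computability for divisors that need not be rational (`√2, √6, √12, …`, say): whether
`x * d i ≤ y * d j` can be decided in time polynomial in the natural numbers `i, j, x, y`.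
Approximations of the values would not do, since they do not reveal ties between fractions. -/
def PolyTimeComparable (d : ℕ → ℝ) : Prop :=
  Nonempty (TM2ComputableInPolyTime encodeUnaryQuadruple encodeBool
    fun q : ℕ × ℕ × ℕ × ℕ => decide ((q.2.2.1 : ℝ) * d q.1 ≤ (q.2.2.2 : ℝ) * d q.2.1))

/-- The sequence `d` is given exactly and in polynomial time: by rational values, or, more
generally, by values that can be compared up to natural multiples. -/
def PolyTimeComputable (d : ℕ → ℝ) : Prop :=
  PolyTimeRational d ∨ PolyTimeComparable d

/-- `d i` is at most polynomial in `i`. -/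
def PolyBounded (d : ℕ → ℝ) : Prop :=
  ∃ p : Polynomial ℕ, ∀ i, d i ≤ (p.eval i : ℕ)

end Apportionment

end

/-! ### A stack language with an oracle, and its compilation to Turing machines -/

namespace StackLang

open Turing Function StateTransition

/-! Combinatorics. The distinguished party `p` wins at least `ℓ` seats exactly when fewer than `κ`
entries precede entry `ℓ - 1` (counted from `0`) of its fraction list (`le_seats_iff`). Of these, `ℓ
- 1` are its own, so at most `κ - ℓ` entries of rivals may precede it (`card_precedes`,
`exists_seatAllocation_iff`). More votes for `p` and fewer for a rival never hurt (`numAhead_mono`).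
Hence every changed vote may be given to `p`, which can be assumed to end with `t = min (N p + K) n`
votes, where `N` counts the original top choices. Once `t` is fixed, the number of entries of a
rival `P` that stay ahead depends only on the number `y P` of votes taken from `P`. It remains to
minimize a sum of separate costs subject to `∑ y P ≤ K`. This is a knapsack problem whose capacity
is at most the number of votes, and dynamic programming solves it in polynomial time
(`knapsack_le_iff`, `successful_iff`).

Arithmetic. Cross-multiplication turns each comparison of fractions into a question whether `x * d i
≤ y * d j` (`divisorLe`). For comparable divisors the given machine answers it. For rational
divisors the given machine writes numerators and denominators in binary; the products are compared
digit by digit with carries and are never written out (`digitSum_le_iff`, `digitSum_convolve`). All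
other numbers are held in unary. This is harmless because the parser cuts them off at the length of
the input plus one: only the threshold can be affected, and a threshold above the number of votes is
unreachable before and after the cut.

Machines. Programs over finitely many stacks, with calls to one Turing machine as a subroutine,
compile to machines that take no more steps than the semantics counts (`Run.stepsTo`). The class
`PT` of functions computed in polynomial time by such programs is closed under composition, pairing,
case distinction and primitive recursion with polynomially bounded intermediate results
(`PT.natRec`). The whole decision procedure is assembled from these closure properties. -/

/-- The alphabet of all stacks of the language. -/
abbrev Sym : Type := Option Bool

/-- Stack contents. -/
abbrev Word : Type := List Sym

/-- A store assigns a stack to every address. -/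
abbrev Store : Type := ℕ → Word

/-- A Turing machine that can be called as a subroutine. -/
structure Oracle where
  /-- the machine -/
  M : FinTM2
  /-- conversion of symbols to the input alphabet -/
  cin : Sym → M.Γ M.k₀
  /-- conversion of symbols from the output alphabet -/
  cout : M.Γ M.k₁ → Sym

/-- Programs acting on stores. -/
inductive Prog : Type
  | skip : Prog
  | push (k : ℕ) (a : Sym) : Prog
  | seq (p q : Prog) : Prog
  | cas (k : ℕ) (p : Option Sym → Prog) : Prog
  | loop (k : ℕ) (p : Sym → Prog) : Prog
  | call (i o : ℕ) : Prog

variable (O : Oracle)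

/-- Big-step semantics: `Run O p s s' t` says that `p` takes the store `s` to `s'` in `t` steps.
A call expects its input in reverse order and delivers its output in reverse order. -/
inductive Run : Prog → Store → Store → ℕ → Prop
  | skip (s : Store) : Run .skip s s 1
  | push (k : ℕ) (a : Sym) (s : Store) : Run (.push k a) s (update s k (a :: s k)) 1
  | seq {p q : Prog} {s s₁ s₂ : Store} {t₁ t₂ : ℕ} :
      Run p s s₁ t₁ → Run q s₁ s₂ t₂ → Run (.seq p q) s s₂ (t₁ + t₂)
  | cas {k : ℕ} {p : Option Sym → Prog} {s s' : Store} {t : ℕ} :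
      Run (p (s k).head?) (update s k (s k).tail) s' t → Run (.cas k p) s s' (1 + t)
  | loop_nil {k : ℕ} {p : Sym → Prog} {s : Store} : s k = [] → Run (.loop k p) s s 1
  | loop_cons {k : ℕ} {p : Sym → Prog} {s s₁ s₂ : Store} {t₁ t₂ : ℕ} {a : Sym} {w : Word} :
      s k = a :: w → Run (p a) (update s k w) s₁ t₁ → Run (.loop k p) s₁ s₂ t₂ →
      Run (.loop k p) s s₂ (1 + (t₁ + t₂))
  | call {i o : ℕ} {s : Store} {y : List (O.M.Γ O.M.k₁)} {t : ℕ} :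
      (flip bind O.M.step)^[t] (some (initList O.M ((s i).reverse.map O.cin))) =
        some (haltList O.M y) →
      Run (.call i o) s (update (update s i []) o ((y.map O.cout).reverse ++ update s i [] o))
        (((s i).length + 1) + (t + (y.length + 1)))

/-- A strict upper bound of the addresses that occur in a program. -/
def Prog.bound : Prog → ℕ
  | .skip => 0
  | .push k _ => k + 1
  | .seq p q => max p.bound q.bound
  | .cas k p => max (k + 1) (Finset.univ.sup fun a => (p a).bound)
  | .loop k p => max (k + 1) (Finset.univ.sup fun a => (p a).bound)
  | .call i o => max (i + 1) (o + 1)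

/-- The control points of a program. -/
inductive Prog.Label : Prog → Type
  | skip : Label .skip
  | push {k : ℕ} {a : Sym} : Label (.push k a)
  | left {p q : Prog} (l : Label p) : Label (.seq p q)
  | right {p q : Prog} (l : Label q) : Label (.seq p q)
  | cas {k : ℕ} {p : Option Sym → Prog} : Label (.cas k p)
  | branch {k : ℕ} {p : Option Sym → Prog} (a : Option Sym) (l : Label (p a)) : Label (.cas k p)
  | loop {k : ℕ} {p : Sym → Prog} : Label (.loop k p)
  | body {k : ℕ} {p : Sym → Prog} (a : Sym) (l : Label (p a)) : Label (.loop k p)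
  | feed {i o : ℕ} : Label (.call i o)
  | inner {i o : ℕ} (l : O.M.Λ) : Label (.call i o)
  | fetch {i o : ℕ} : Label (.call i o)

/-- Programs have finitely many control points. -/
instance Prog.finite_label (p : Prog) : Finite (p.Label O) := by
  induction p with
  | skip => exact @Finite.of_surjective Unit _ _ (fun _ => .skip) (by rintro ⟨⟩; exact ⟨(), rfl⟩)
  | push k a => exact @Finite.of_surjective Unit _ _ (fun _ => .push) (by rintro ⟨⟩; exact ⟨(), rfl⟩)
  | seq p q ihp ihq =>
    refine Finite.of_surjective (Sum.elim Label.left Label.right) ?_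
    rintro (_ | _)
    exacts [⟨.inl _, rfl⟩, ⟨.inr _, rfl⟩]
  | cas k p ih =>
    refine @Finite.of_surjective (Option ((a : Option Sym) × (p a).Label O)) _ _
      (fun x => x.elim .cas fun x => .branch x.1 x.2) ?_
    rintro (_ | _)
    exacts [⟨none, rfl⟩, ⟨some ⟨_, _⟩, rfl⟩]
  | loop k p ih =>
    refine @Finite.of_surjective (Option ((a : Sym) × (p a).Label O)) _ _
      (fun x => x.elim .loop fun x => .body x.1 x.2) ?_
    rintro (_ | _)
    exacts [⟨none, rfl⟩, ⟨some ⟨_, _⟩, rfl⟩]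
  | call i o =>
    have : Finite O.M.Λ := @Finite.of_fintype _ O.M.ΛFin
    refine @Finite.of_surjective (Option (Option O.M.Λ)) _ _
      (fun x => x.elim .feed fun x => x.elim .fetch .inner) ?_
    rintro (_ | _)
    exacts [⟨none, rfl⟩, ⟨some (some _), rfl⟩, ⟨some none, rfl⟩]

/-- The control point where a program starts. -/
def Prog.entry : (p : Prog) → p.Label O
  | .skip => .skip
  | .push _ _ => .push
  | .seq p _ => .left p.entry
  | .cas _ _ => .cas
  | .loop _ _ => .loop
  | .call _ _ => .feed

/-- The stacks of the compiled machine: the stacks of the language, those of the oracle, and one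
for the result. -/
abbrev Stk (N : ℕ) : Type := Fin N ⊕ (O.M.K ⊕ Unit)

/-- The alphabets of the compiled machine. -/
@[reducible] def Alph (N : ℕ) : Stk O N → Type
  | .inl _ => Sym
  | .inr (.inl k) => O.M.Γ k
  | .inr (.inr _) => Bool

/-- The finite memory of the compiled machine: a register and the memory of the oracle. -/
abbrev Mem : Type := Option Sym × O.M.σ

/-- The stacks of the compiled machine that represent a store. -/
def merge {N : ℕ} (s : Store) (S : ∀ k, List (O.M.Γ k)) (u : List Bool) :
    ∀ k, List (Alph O N k)
  | .inl k => s k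
  | .inr (.inl k) => S k
  | .inr (.inr _) => u

variable {O}

theorem update_merge_inl {N : ℕ} (s : Store) (S : ∀ k, List (O.M.Γ k)) (u : List Bool)
    (k : Fin N) (w : Word) :
    update (merge O (N := N) s S u) (.inl k) w = merge O (update s k w) S u := by
  funext j
  rcases j with j | j | j
  · by_cases h : j = k
    · subst h; simp [merge]
    · have h' : (j : ℕ) ≠ k := fun h' => h (Fin.ext h')
      rw [update_of_ne (by simpa using h)]
      simp [merge, h']
  · rw [update_of_ne (by simp)]; rfl
  · rw [update_of_ne (by simp)]; rfl

theorem update_merge_inr {N : ℕ} (s : Store) (S : ∀ k, List (O.M.Γ k)) (u : List Bool)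
    (k : O.M.K) (w : List (O.M.Γ k)) :
    update (merge O (N := N) s S u) (.inr (.inl k)) w = merge O s (update S k w) u := by
  funext j
  rcases j with j | j | j
  · rw [update_of_ne (by simp)]; rfl
  · by_cases h : j = k
    · subst h; simp [merge]
    · rw [update_of_ne (by simpa using h)]
      simp [merge, h]
  · rw [update_of_ne (by simp)]; rfl

theorem update_merge_out {N : ℕ} (s : Store) (S : ∀ k, List (O.M.Γ k)) (u w : List Bool) :
    update (merge O (N := N) s S u) (.inr (.inr ())) w = merge O s S w := by
  funext j
  rcases j with j | j | j
  · rw [update_of_ne (by simp)]; rfl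
  · rw [update_of_ne (by simp)]; rfl
  · simp [merge]

/-! ### Translation of oracle statements and control points into machine code. -/

section Translation

variable {N : ℕ} {L : Type}

/-- The statements of the oracle as statements of the compiled machine. -/
def lift (f : O.M.Λ → L) (e : L) :
    TM2.Stmt O.M.Γ O.M.Λ O.M.σ → TM2.Stmt (Alph O N) L (Mem O)
  | .push k g q => .push (.inr (.inl k)) (fun v => g v.2) (lift f e q)
  | .peek k g q => .peek (.inr (.inl k)) (fun v x => (v.1, g v.2 x)) (lift f e q)
  | .pop k g q => .pop (.inr (.inl k)) (fun v x => (v.1, g v.2 x)) (lift f e q)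
  | .load g q => .load (fun v => (v.1, g v.2)) (lift f e q)
  | .branch g q₁ q₂ => .branch (fun v => g v.2) (lift f e q₁) (lift f e q₂)
  | .goto g => .goto fun v => f (g v.2)
  | .halt => .goto fun _ => e

/-- A translated statement touches only the stacks and the memory of the oracle, so translating
commutes with executing. Where the oracle would halt, the host jumps to `e`; this accounts for `getD
e`. -/
theorem stepAux_lift (f : O.M.Λ → L) (e : L) (q : TM2.Stmt O.M.Γ O.M.Λ O.M.σ) (r : Option Sym)
    (s : Store) (u : List Bool) (v : O.M.σ) (S : ∀ k, List (O.M.Γ k)) :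
    TM2.stepAux (lift (N := N) f e q) (r, v) (merge O s S u) =
      ⟨some (((TM2.stepAux q v S).l.map f).getD e), (r, (TM2.stepAux q v S).var),
        merge O s (TM2.stepAux q v S).stk u⟩ := by
  induction q generalizing v S with
  | push k g q ih => 
    simp only [lift, TM2.stepAux, ← ih, ← update_merge_inr]; rfl
  | peek k g q ih => simp only [lift, TM2.stepAux, ← ih]; rfl
  | pop k g q ih => simp only [lift, TM2.stepAux, ← ih, ← update_merge_inr]; rfl
  | load g q ih => simp only [lift, TM2.stepAux, ← ih]
  | branch g q₁ q₂ ih₁ ih₂ =>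
    simp only [lift, TM2.stepAux]
    cases g v
    · exact ih₂ v S
    · exact ih₁ v S
  | goto g => rfl
  | halt => rfl

/-- The statement at a control point. -/
def Prog.code [NeZero N] : (p : Prog) → (p.Label O → L) → L → p.Label O →
    TM2.Stmt (Alph O N) L (Mem O)
  | .skip, _, e, _ => .goto fun _ => e
  | .push k a, _, e, _ => .push (.inl (Fin.ofNat N k)) (fun _ => a) (.goto fun _ => e)
  | .seq p q, f, _, .left l => p.code (fun l => f (.left l)) (f (.right (q.entry O))) l
  | .seq _ q, f, e, .right l => q.code (fun l => f (.right l)) e l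
  | .cas k p, f, _, .cas =>
    .pop (.inl (Fin.ofNat N k)) (fun v x => (x, v.2))
      (.goto fun v => f (.branch v.1 ((p v.1).entry O)))
  | .cas _ p, f, e, .branch a l => (p a).code (fun l => f (.branch a l)) e l
  | .loop k p, f, e, .loop =>
    .pop (.inl (Fin.ofNat N k)) (fun v x => (x, v.2))
      (.goto fun v => v.1.elim e fun a => f (.body a ((p a).entry O)))
  | .loop _ p, f, _, .body a l => (p a).code (fun l => f (.body a l)) (f .loop) l
  | .call i _, f, _, .feed =>
    .pop (.inl (Fin.ofNat N i)) (fun v x => (x, v.2))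
      (.branch (fun v => v.1.isSome)
        (.push (.inr (.inl O.M.k₀)) (fun v => O.cin (v.1.getD none)) (.goto fun _ => f .feed))
        (.goto fun _ => f (.inner O.M.main)))
  | .call _ _, f, _, .inner l => lift (fun l => f (.inner l)) (f .fetch) (O.M.m l)
  | .call _ o, f, e, .fetch =>
    .pop (.inr (.inl O.M.k₁)) (fun v x => (x.map O.cout, v.2))
      (.branch (fun v => v.1.isSome)
        (.push (.inl (Fin.ofNat N o)) (fun v => v.1.getD none) (.goto fun _ => f .fetch))
        (.goto fun _ => e))

end Translation

/-- `StepsTo f n a b` says that `n` steps of `f` lead from `a` to `b`. -/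
def StepsTo {σ : Type*} (f : σ → Option σ) (n : ℕ) (a b : σ) : Prop :=
  (flip bind f)^[n] (some a) = some b

theorem StepsTo.single {σ : Type*} {f : σ → Option σ} {a b : σ} (h : f a = some b) :
    StepsTo f 1 a b := h

theorem StepsTo.trans {σ : Type*} {f : σ → Option σ} {n₁ n₂ : ℕ} {a b c : σ}
    (h₁ : StepsTo f n₁ a b) (h₂ : StepsTo f n₂ b c) : StepsTo f (n₁ + n₂) a c := by
  unfold StepsTo at *
  rw [Nat.add_comm, Function.iterate_add_apply, h₁, h₂]

theorem iterate_bind_none {σ : Type*} (f : σ → Option σ) (n : ℕ) :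
    (flip bind f)^[n] none = none := by
  induction n with
  | zero => rfl
  | succ n ih => rw [Function.iterate_succ_apply]; exact ih

/-! ### Simulation of the big-step semantics by the compiled machine. -/

section Compile

variable {N : ℕ} [NeZero N] {L : Type}

theorem ofNat_val {k : ℕ} (hk : k < N) : ((Fin.ofNat N k : Fin N) : ℕ) = k :=
  Nat.mod_eq_of_lt hk

omit [NeZero N] in
/-- The oracle machine can be simulated. -/
theorem stepsTo_lift (m : L → TM2.Stmt (Alph O N) L (Mem O)) (f : O.M.Λ → L) (e : L)
    (hm : ∀ l, m (f l) = lift f e (O.M.m l)) (s : Store) (u : List Bool) (r : Option Sym)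
    (n : ℕ) (l : O.M.Λ) (v : O.M.σ) (S : ∀ k, List (O.M.Γ k)) (v' : O.M.σ)
    (S' : ∀ k, List (O.M.Γ k))
    (h : (flip bind O.M.step)^[n] (some (⟨some l, v, S⟩ : O.M.Cfg)) =
      some (⟨none, v', S'⟩ : O.M.Cfg)) :
    ∃ n' ≤ n, StepsTo (TM2.step m) n' ⟨some (f l), (r, v), merge O s S u⟩
      ⟨some e, (r, v'), merge O s S' u⟩ := by
  induction n generalizing l v S with
  | zero => cases h
  | succ n ih =>
    rw [Function.iterate_succ_apply] at h
    change (flip bind O.M.step)^[n] (some (TM2.stepAux (O.M.m l) v S)) = _ at h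
    have hs := stepAux_lift (N := N) f e (O.M.m l) r s u v S
    rcases hc : TM2.stepAux (O.M.m l) v S with ⟨l', v₁, S₁⟩
    rw [hc] at h hs
    have h1 : StepsTo (TM2.step m) 1 ⟨some (f l), (r, v), merge O s S u⟩
        ⟨some ((l'.map f).getD e), (r, v₁), merge O s S₁ u⟩ :=
      StepsTo.single (by simp only [TM2.step, hm, hs])
    cases l' with
    | some l' =>
      obtain ⟨n', hn', h2⟩ := ih l' v₁ S₁ h
      exact ⟨1 + n', by omega, h1.trans h2⟩
    | none =>
      -- A halted configuration has no successor, so it can only be the last one of the given run.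
      have : (⟨none, v₁, S₁⟩ : O.M.Cfg) = ⟨none, v', S'⟩ := by
        cases n with
        | zero => exact Option.some.inj h
        | succ n =>
          rw [Function.iterate_succ_apply] at h
          change (flip bind O.M.step)^[n] none = _ at h
          rw [iterate_bind_none] at h
          cases h
      cases this
      exact ⟨1, by omega, h1⟩

theorem initList_eq (M : FinTM2) (x : List (M.Γ M.k₀)) :
    initList M x = ⟨some M.main, M.initialState, update (fun _ => []) M.k₀ x⟩ := by
  unfold initList
  congr 1
  funext k
  by_cases h : k = M.k₀
  · subst h; simp
  · simp [h]

/-- By the halting convention all stacks but the output are empty and the memory is the initial one.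
This makes an oracle reusable: once its output has been fetched, it is ready for the next call
without any cleaning. -/
theorem haltList_eq (M : FinTM2) (x : List (M.Γ M.k₁)) :
    haltList M x = ⟨none, M.initialState, update (fun _ => []) M.k₁ x⟩ := by
  unfold haltList
  congr 1
  funext k
  by_cases h : k = M.k₁
  · subst h; simp
  · simp [h]

/-- The compiled code does what the semantics says, in at most as many steps. -/
theorem Run.stepsTo {p : Prog} {s s' : Store} {t : ℕ} (h : Run O p s s' t)
    (m : L → TM2.Stmt (Alph O N) L (Mem O)) (u : List Bool) :
    ∀ (f : p.Label O → L) (e : L), p.bound ≤ N → (∀ l, m (f l) = p.code f e l) →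
      ∀ r : Option Sym, ∃ t' ≤ t, ∃ r' : Option Sym, StepsTo (TM2.step m) t'
        ⟨some (f (p.entry O)), (r, O.M.initialState), merge O s (fun _ => []) u⟩
        ⟨some e, (r', O.M.initialState), merge O s' (fun _ => []) u⟩ := by
  -- The embedding `f` of control points and the exit `e` stay universally quantified: a subprogram
  -- occupies part of the labels and exits to whatever follows it, which for the body of a loop is
  -- the loop head.
  induction h with
  | skip s =>
    intro f e hN hm r
    exact ⟨1, le_rfl, r, StepsTo.single (by simp [TM2.step, hm, Prog.code])⟩
  | push k a s =>
    intro f e hN hm r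
    refine ⟨1, le_rfl, r, StepsTo.single ?_⟩
    simp only [TM2.step, hm, Prog.code, TM2.stepAux]
    rw [update_merge_inl, ofNat_val hN]
    simp only [merge, ofNat_val hN]
  | @seq p q s s₁ s₂ t₁ t₂ _ _ ih₁ ih₂ =>
    intro f e hN hm r
    obtain ⟨n₁, h₁, r₁, c₁⟩ := ih₁ (fun l => f (.left l)) (f (.right (q.entry O)))
      ((le_max_left _ _).trans hN) (fun l => hm (.left l)) r
    obtain ⟨n₂, h₂, r₂, c₂⟩ := ih₂ (fun l => f (.right l)) e
      ((le_max_right _ _).trans hN) (fun l => hm (.right l)) r₁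
    exact ⟨n₁ + n₂, by omega, r₂, c₁.trans c₂⟩
  | @cas k p s s' t _ ih =>
    intro f e hN hm r
    have hk : k < N := (le_max_left _ _).trans hN
    obtain ⟨n, hn, r', c⟩ := ih (fun l => f (.branch _ l)) e
      (((Finset.le_sup (f := fun a => (p a).bound) (Finset.mem_univ _)).trans
        (le_max_right _ _)).trans hN) (fun l => hm (.branch _ l)) (s k).head?
    refine ⟨1 + n, by omega, r', (StepsTo.single ?_).trans c⟩
    simp only [TM2.step, hm, Prog.code, TM2.stepAux, Prog.entry]
    rw [update_merge_inl, ofNat_val hk]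
    simp only [merge, ofNat_val hk]
    rw [ofNat_val hk]
  | @loop_nil k p s h =>
    intro f e hN hm r
    have hk : k < N := (le_max_left _ _).trans hN
    refine ⟨1, le_rfl, none, StepsTo.single ?_⟩
    simp only [TM2.step, hm, Prog.code, TM2.stepAux, Prog.entry]
    rw [update_merge_inl, ofNat_val hk]
    simp only [merge, ofNat_val hk, h, List.head?_nil, List.tail_nil]
    rw [← h, update_eq_self]
    rfl
  | @loop_cons k p s s₁ s₂ t₁ t₂ a w h _ _ ih₁ ih₂ =>
    intro f e hN hm r
    have hk : k < N := (le_max_left _ _).trans hN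
    obtain ⟨n₁, h₁, r₁, c₁⟩ := ih₁ (fun l => f (.body _ l)) (f .loop)
      (((Finset.le_sup (f := fun a => (p a).bound) (Finset.mem_univ _)).trans
        (le_max_right _ _)).trans hN) (fun l => hm (.body _ l)) (some a)
    obtain ⟨n₂, h₂, r₂, c₂⟩ := ih₂ f e hN hm r₁
    refine ⟨1 + (n₁ + n₂), by omega, r₂, (StepsTo.single ?_).trans (c₁.trans c₂)⟩
    simp only [TM2.step, hm, Prog.code, TM2.stepAux, Prog.entry]
    rw [update_merge_inl, ofNat_val hk]
    simp only [merge, ofNat_val hk, h, List.head?_cons, List.tail_cons]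
    rfl
  | @call i o s y t h =>
    intro f e hN hm r
    have hi : i < N := (le_max_left _ _).trans hN
    have ho : o < N := (le_max_right _ _).trans hN
    -- Here `x` is what the oracle has already received. Moving symbol by symbol reverses the word,
    -- which is why a call expects its input in reverse order; `fetch` below does the same to the
    -- output.
    have feed : ∀ (w : Word) (s : Store) (r : Option Sym) (x : List (O.M.Γ O.M.k₀)), s i = w →
        ∃ r', StepsTo (TM2.step m) (w.length + 1)
          ⟨some (f .feed), (r, O.M.initialState),
            merge O s (update (fun _ => []) O.M.k₀ x) u⟩
          ⟨some (f (.inner O.M.main)), (r', O.M.initialState),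
            merge O (update s i [])
              (update (fun _ => []) O.M.k₀ (w.reverse.map O.cin ++ x)) u⟩ := by
      intro w
      induction w with
      | nil =>
        intro s r x hs
        refine ⟨none, StepsTo.single ?_⟩
        simp only [TM2.step, hm, Prog.code, TM2.stepAux]
        rw [update_merge_inl, ofNat_val hi]
        simp only [merge, ofNat_val hi, hs]
        simp
      | cons a w ih =>
        intro s r x hs
        obtain ⟨r', h'⟩ := ih (update s i w) (some a) (O.cin a :: x) (by simp)
        refine ⟨r', ?_⟩
        rw [List.length_cons, Nat.add_comm w.length 1, Nat.add_assoc]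
        rw [update_idem] at h'
        rw [List.reverse_cons, List.map_append, List.append_assoc]
        refine (StepsTo.single ?_).trans h'
        · simp only [TM2.step, hm, Prog.code, TM2.stepAux]
          rw [update_merge_inl, ofNat_val hi]
          simp only [merge, ofNat_val hi, hs, List.head?_cons, List.tail_cons, Option.isSome_some,
            cond_true, update_self, Option.getD_some]
          rw [update_merge_inr, update_idem]
    have fetch : ∀ (y : List (O.M.Γ O.M.k₁)) (s : Store) (r : Option Sym),
        ∃ r', StepsTo (TM2.step m) (y.length + 1)
          ⟨some (f .fetch), (r, O.M.initialState),
            merge O s (update (fun _ => []) O.M.k₁ y) u⟩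
          ⟨some e, (r', O.M.initialState),
            merge O (update s o ((y.map O.cout).reverse ++ s o)) (fun _ => []) u⟩ := by
      intro y
      induction y with
      | nil =>
        intro s r
        refine ⟨none, StepsTo.single ?_⟩
        simp only [TM2.step, hm, Prog.code, TM2.stepAux]
        rw [update_merge_inr]
        simp [merge]
      | cons a y ih =>
        intro s r
        obtain ⟨r', h'⟩ := ih (update s o (O.cout a :: s o)) (some (O.cout a))
        refine ⟨r', ?_⟩
        rw [List.length_cons, Nat.add_comm y.length 1, Nat.add_assoc]
        rw [update_idem, update_self] at h'
        rw [List.map_cons, List.reverse_cons, List.append_assoc]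
        refine (StepsTo.single ?_).trans h'
        · simp only [TM2.step, hm, Prog.code, TM2.stepAux]
          rw [update_merge_inr, update_idem]
          simp only [merge, update_self, List.head?_cons, List.tail_cons, Option.map_some,
            Option.isSome_some, cond_true, Option.getD_some]
          rw [update_merge_inl, ofNat_val ho]
    obtain ⟨r₁, c₁⟩ := feed (s i) s r [] rfl
    rw [initList_eq, haltList_eq] at h
    obtain ⟨n, hn, c₂⟩ := stepsTo_lift m (fun l => f (.inner l)) (f .fetch)
      (fun l => hm (.inner l)) (update s i []) u r₁ t _ _ _ _ _ h
    obtain ⟨r₃, c₃⟩ := fetch y (update s i []) r₁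
    refine ⟨((s i).length + 1) + (n + (y.length + 1)), by omega, r₃, ?_⟩
    rw [List.append_nil, List.map_reverse] at c₁
    rw [List.map_reverse] at c₂
    rw [show update (fun _ => []) O.M.k₀ [] = (fun _ => [] : ∀ k, List (O.M.Γ k)) from
      update_eq_self _ _] at c₁
    exact c₁.trans (c₂.trans c₃)

end Compile

/-- Delivers the result from the address `1`. -/
def finish (O : Oracle) (N : ℕ) [NeZero N] {L : Type} : TM2.Stmt (Alph O N) L (Mem O) :=
  .pop (.inl (Fin.ofNat N 1)) (fun v x => (x, v.2))
    (.push (.inr (.inr ())) (fun v => v.1.isSome)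
      (.load (fun v => (none, v.2)) .halt))

/-- `true` is stored as one symbol and `false` as the empty stack, so the answer is whether a symbol
could be popped. The register is reset because the halting convention demands the initial memory. -/
theorem stepAux_finish {N : ℕ} [NeZero N] (hN : 1 < N) {L : Type} (r : Option Sym) (v : O.M.σ)
    (b : Bool) :
    TM2.stepAux (finish O N (L := L)) (r, v) (merge O
      (update (fun _ => []) 1 (bif b then [some true] else [])) (fun _ => []) []) =
    ⟨none, (none, v), merge O (fun _ => []) (fun _ => []) [b]⟩ := by
  simp only [finish, TM2.stepAux]
  rw [update_merge_inl, update_merge_out, ofNat_val hN]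
  simp only [merge, ofNat_val hN]
  cases b <;> simp

/-- The machine that runs a program whose input and output are at the addresses `0` and `1`. -/
noncomputable def machine (O : Oracle) (N : ℕ) [NeZero N] (p : Prog) : FinTM2 where
  K := Stk O N
  kFin :=
    letI := O.M.kFin
    inferInstanceAs (Fintype (Fin N ⊕ (O.M.K ⊕ Unit)))
  k₀ := .inl (Fin.ofNat N 0)
  k₁ := .inr (.inr ())
  Γ := Alph O N
  Λ := Option (p.Label O)
  main := some (p.entry O)
  ΛFin := Fintype.ofFinite _
  σ := Mem O
  initialState := (none, O.M.initialState)
  σFin :=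
    letI := O.M.σFin
    inferInstanceAs (Fintype (Option Sym × O.M.σ))
  Γk₀Fin := inferInstanceAs (Fintype (Option Bool))
  m
    | some l => p.code some none l
    | none => finish O N

theorem initList_machine (N : ℕ) [NeZero N] (p : Prog) (w : Word) :
    initList (machine O N p) w = ⟨some (some (p.entry O)), (none, O.M.initialState),
      merge O (update (fun _ => []) 0 w) (fun _ => []) []⟩ := by
  have h : (fun _ => []) = merge O (N := N) (fun _ => []) (fun _ => []) [] := by
    funext k; rcases k with k | k | k <;> rfl
  have h' := update_merge_inl (O := O) (N := N) (fun _ => []) (fun _ => []) [] (Fin.ofNat N 0) w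
  rw [ofNat_val (Nat.pos_of_neZero N), ← h] at h'
  rw [← h']
  exact initList_eq _ _

theorem haltList_machine (N : ℕ) [NeZero N] (p : Prog) (u : List Bool) :
    haltList (machine O N p) u = ⟨none, (none, O.M.initialState),
      merge O (fun _ => []) (fun _ => []) u⟩ := by
  have h : (fun _ => []) = merge O (N := N) (fun _ => []) (fun _ => []) [] := by
    funext k; rcases k with k | k | k <;> rfl
  have h' := update_merge_out (O := O) (N := N) (fun _ => []) (fun _ => []) [] u
  rw [← h] at h'
  rw [← h']
  exact haltList_eq _ _

/-- A program that decides a language in polynomial time yields a Turing machine that does so. -/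
theorem nonempty_tm2ComputableInPolyTime (O : Oracle) (p : Prog) (F : Word → Bool)
    (T : Polynomial ℕ)
    (h : ∀ w, ∃ t ≤ T.eval w.length, Run O p (update (fun _ => []) 0 w)
      (update (fun _ => []) 1 (bif F w then [some true] else [])) t) :
    Nonempty (TM2ComputableInPolyTime (id : List (Option Bool) → List (Option Bool))
      Computability.encodeBool F) := by
  -- With at least two stacks the addresses `0` and `1` are distinct, and with at least `p.bound` of
  -- them `Fin.ofNat` never wraps an address around. The time bound `T + 1` below includes the step
  -- of `finish`.
  set N := max 2 p.bound with hN
  have h1 : 1 < N := by omega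
  have : NeZero N := ⟨by omega⟩
  refine ⟨⟨⟨machine O N p, Equiv.refl _, Equiv.refl _⟩, T + 1, fun w => ?_⟩⟩
  refine Classical.choice ?_
  obtain ⟨t, ht, hr⟩ := h w
  obtain ⟨t', ht', r, hs⟩ := hr.stepsTo (machine O N p).m [] some none (le_max_right _ _)
    (fun l => rfl) none
  have hlast : TM2.step (machine O N p).m ⟨some none, (r, O.M.initialState),
      merge O (update (fun _ => []) 1 (bif F w then [some true] else [])) (fun _ => []) []⟩ =
      some (haltList (machine O N p) [F w]) := by
    refine Eq.trans ?_ (congrArg some (haltList_machine N p [F w]).symm)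
    exact congrArg some (stepAux_finish h1 r _ _)
  refine ⟨⟨⟨t' + 1, ?_⟩, ?_⟩⟩
  · exact (congrArg (fun c => (flip bind (TM2.step (machine O N p).m))^[t' + 1] (some c))
      ((congrArg (initList (machine O N p)) (List.map_id w)).trans
        (initList_machine N p w))).trans (hs.trans (StepsTo.single hlast))
  · simp only [Polynomial.eval_add, Polynomial.eval_one, id]
    omega

end StackLang

/-! ### Polynomial-time functions between represented types -/

namespace StackLang

open Turing Function StateTransition

variable {O : Oracle}

/-- The program `p` leads from `s` to `s'` in at most `T` steps. -/
def RunLe (O : Oracle) (p : Prog) (s s' : Store) (T : ℕ) : Prop :=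
  ∃ t ≤ T, Run O p s s' t

theorem RunLe.seq {p q : Prog} {s₁ s₂ s₃ : Store} {T₁ T₂ : ℕ} (h₁ : RunLe O p s₁ s₂ T₁)
    (h₂ : RunLe O q s₂ s₃ T₂) : RunLe O (.seq p q) s₁ s₃ (T₁ + T₂) := by
  obtain ⟨t₁, l₁, r₁⟩ := h₁
  obtain ⟨t₂, l₂, r₂⟩ := h₂
  exact ⟨t₁ + t₂, Nat.add_le_add l₁ l₂, .seq r₁ r₂⟩

theorem RunLe.mono {p : Prog} {s₁ s₂ : Store} {T₁ T₂ : ℕ} (h : RunLe O p s₁ s₂ T₁)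
    (hT : T₁ ≤ T₂) : RunLe O p s₁ s₂ T₂ := by
  obtain ⟨t, l, r⟩ := h
  exact ⟨t, l.trans hT, r⟩

theorem RunLe.skip (s : Store) : RunLe O .skip s s 1 := ⟨1, le_rfl, .skip s⟩

theorem RunLe.push (k : ℕ) (a : Sym) (s : Store) :
    RunLe O (.push k a) s (update s k (a :: s k)) 1 := ⟨1, le_rfl, .push k a s⟩

/-! #### Moving, copying and clearing -/

/-- Pushes the symbols of stack `i` to stack `j`, applying `φ`. -/
def transfer (φ : Sym → Sym) (i j : ℕ) : Prog := .loop i fun a => .push j (φ a)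

theorem transfer_run (φ : Sym → Sym) {i j : ℕ} (hij : i ≠ j) (s : Store) :
    RunLe O (transfer φ i j) s
      (update (update s i []) j (((s i).map φ).reverse ++ s j)) (2 * (s i).length + 1) := by
  generalize hw : s i = w
  induction w generalizing s with
  | nil =>
    refine ⟨1, le_rfl, ?_⟩
    have : update (update s i []) j ((([] : Word).map φ).reverse ++ s j) = s := by
      rw [← hw, update_eq_self, hw]; simp
    rw [this]
    exact .loop_nil hw
  | cons a w ih =>
    obtain ⟨t, ht, hr⟩ := ih (update (update s i w) j (φ a :: s j)) (by simp [hij])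
    refine ⟨1 + (1 + t), by simp only [List.length_cons]; omega, .loop_cons hw (.push _ _ _) ?_⟩
    rw [update_of_ne hij.symm]
    have e : update (update s i []) j (((a :: w).map φ).reverse ++ s j) =
        update (update (update (update s i w) j (φ a :: s j)) i []) j
          ((w.map φ).reverse ++ update (update s i w) j (φ a :: s j) j) := by
      funext k
      by_cases hj : k = j
      · subst hj; simp
      · by_cases hi : k = i
        · subst hi; simp [hj]
        · simp [hi, hj]
    rw [e]
    exact hr

/-- Empties a stack. -/
def clear (k : ℕ) : Prog := .loop k fun _ => .skip

theorem clear_run (k : ℕ) (s : Store) :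
    RunLe O (clear k) s (update s k []) (2 * (s k).length + 1) := by
  generalize hw : s k = w
  induction w generalizing s with
  | nil =>
    refine ⟨1, le_rfl, ?_⟩
    rw [← hw, update_eq_self]
    exact .loop_nil hw
  | cons a w ih =>
    obtain ⟨t, ht, hr⟩ := ih (update s k w) (by simp)
    refine ⟨1 + (1 + t), by simp only [List.length_cons]; omega, .loop_cons hw (.skip _) ?_⟩
    rwa [update_idem] at hr

/-- Copies stack `i` to stack `j`, applying `φ`, with stack `t` as an auxiliary stack. -/
def copy (φ : Sym → Sym) (i j t : ℕ) : Prog :=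
  .seq (transfer id i t) (.loop t fun a => .seq (.push i a) (.push j (φ a)))

/-- Two reversals cancel: the transfer to `t` reverses the word, and unloading `t` onto both `i` and
`j` reverses it again. The first pass costs two steps per symbol and the second one three. -/
theorem copy_run (φ : Sym → Sym) {i j t : ℕ} (hij : i ≠ j) (hit : i ≠ t) (hjt : j ≠ t)
    (s : Store) (ht : s t = []) (hj : s j = []) :
    RunLe O (copy φ i j t) s (update s j ((s i).map φ)) (5 * (s i).length + 2) := by
  have key : ∀ (w : Word) (s : Store), s t = w →
      RunLe O (.loop t fun a => .seq (.push i a) (.push j (φ a))) s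
        (update (update (update s t []) i (w.reverse ++ s i)) j ((w.map φ).reverse ++ s j))
        (3 * w.length + 1) := by
    intro w
    induction w with
    | nil =>
      intro s hw
      refine ⟨1, le_rfl, ?_⟩
      have : update (update (update s t []) i (([] : Word).reverse ++ s i)) j
          ((([] : Word).map φ).reverse ++ s j) = s := by
        rw [← hw, update_eq_self, hw]; simp
      rw [this]
      exact .loop_nil hw
    | cons a w ih =>
      intro s hw
      obtain ⟨n, hn, hr⟩ := ih (update (update (update s t w) i (a :: s i)) j (φ a :: s j))
        (by simp [hit.symm, hjt.symm])
      refine ⟨1 + (1 + 1 + n), by simp only [List.length_cons]; omega,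
        .loop_cons hw (.seq (.push _ _ _) (.push _ _ _)) ?_⟩
      rw [update_of_ne hit, update_of_ne hij.symm, update_of_ne hjt]
      have e : update (update (update s t []) i ((a :: w).reverse ++ s i)) j
            (((a :: w).map φ).reverse ++ s j) =
          update (update (update (update (update (update s t w) i (a :: s i)) j (φ a :: s j)) t [])
            i (w.reverse ++ update (update (update s t w) i (a :: s i)) j (φ a :: s j) i)) j
            ((w.map φ).reverse ++ update (update (update s t w) i (a :: s i)) j (φ a :: s j) j) := by
        funext k
        by_cases hj : k = j
        · subst hj; simp
        · by_cases hi : k = i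
          · subst hi; simp [hj]
          · by_cases ht : k = t
            · subst ht; simp [hj, hi]
            · simp [hi, hj, ht]
      rw [e]
      exact hr
  have h₁ := transfer_run (O := O) id hit s
  have h₂ := key (s i).reverse (update (update s i []) t (((s i).map id).reverse ++ s t))
    (by simp [ht])
  have h := h₁.seq h₂
  have e : update (update (update (update (update s i []) t (((s i).map id).reverse ++ s t)) t [])
        i ((s i).reverse.reverse ++ update (update s i []) t (((s i).map id).reverse ++ s t) i)) j
        (((s i).reverse.map φ).reverse ++
          update (update s i []) t (((s i).map id).reverse ++ s t) j) =
      update s j ((s i).map φ) := by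
    funext k
    by_cases hk : k = j
    · subst hk; simp [hj, hjt, hij.symm]
    · by_cases hi : k = i
      · subst hi; simp [hk, hit]
      · by_cases hk' : k = t
        · subst hk'; simp [hk, hi, ht]
        · simp [hi, hk, hk']
  rw [e] at h
  exact h.mono (by simp; omega)

/-- Writes a block of `w` stacks at the address `o`. -/
def write (s : Store) (o w : ℕ) (r : ℕ → Word) : Store :=
  fun j => if o ≤ j ∧ j < o + w then r (j - o) else s j

theorem write_zero (s : Store) (o : ℕ) (r : ℕ → Word) : write s o 0 r = s := by
  funext j; simp only [write]; rw [if_neg (by omega)]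

theorem write_succ (s : Store) (o w : ℕ) (r : ℕ → Word) :
    write s o (w + 1) r = update (write s o w r) (o + w) (r w) := by
  funext j
  by_cases h : j = o + w
  · subst h; simp [write]
  · simp only [write, update_of_ne h]
    congr 1
    simp only [eq_iff_iff]; omega

theorem write_one (s : Store) (o : ℕ) (r : ℕ → Word) : write s o 1 r = update s o (r 0) := by
  rw [write_succ, write_zero, Nat.add_zero]

theorem write_of_lt {s : Store} {o w : ℕ} {r : ℕ → Word} {j : ℕ} (h : j < o) :
    write s o w r j = s j := if_neg (by omega)

theorem write_of_ge {s : Store} {o w : ℕ} {r : ℕ → Word} {j : ℕ} (h : o + w ≤ j) :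
    write s o w r j = s j := if_neg (by omega)

theorem write_add {s : Store} {o w : ℕ} {r : ℕ → Word} {k : ℕ} (h : k < w) :
    write s o w r (o + k) = r k := by
  simp only [write]; rw [if_pos (by omega), Nat.add_sub_cancel_left]

/-- The number of symbols in the first `w` stacks of `r`. -/
def total (w : ℕ) (r : ℕ → Word) : ℕ := ∑ k ∈ Finset.range w, (r k).length

theorem total_succ (w : ℕ) (r : ℕ → Word) : total (w + 1) r = total w r + (r w).length :=
  Finset.sum_range_succ _ _

theorem total_congr {w : ℕ} {r r' : ℕ → Word} (h : ∀ k < w, r k = r' k) : total w r = total w r' :=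
  Finset.sum_congr rfl fun k hk => by rw [h k (Finset.mem_range.1 hk)]

/-- Empties `w` stacks from the address `o` on. -/
def clearBlock (o : ℕ) : ℕ → Prog
  | 0 => .skip
  | w + 1 => .seq (clearBlock o w) (clear (o + w))

theorem clearBlock_run (o w : ℕ) (s : Store) :
    RunLe O (clearBlock o w) s (write s o w fun _ => [])
      (2 * total w (fun k => s (o + k)) + w + 1) := by
  induction w with
  | zero => rw [write_zero]; exact (RunLe.skip s).mono (by omega)
  | succ w ih =>
    rw [write_succ]
    refine (ih.seq (clear_run _ _)).mono ?_
    rw [write_of_ge le_rfl, total_succ]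
    omega

/-- Copies the `w` stacks with the addresses `ι k` to the addresses from `o` on. -/
def copyBlock (ι : ℕ → ℕ) (o t : ℕ) : ℕ → Prog
  | 0 => .skip
  | w + 1 => .seq (copyBlock ι o t w) (copy id (ι w) (o + w) t)

theorem copyBlock_run {ι : ℕ → ℕ} {o t w : ℕ} (s : Store) (r : ℕ → Word)
    (hr : ∀ k < w, s (ι k) = r k) (hι : ∀ k < w, ι k ≠ t ∧ ¬(o ≤ ι k ∧ ι k < o + w))
    (ho : ∀ k < w, o + k ≠ t ∧ s (o + k) = []) (ht : s t = []) :
    RunLe O (copyBlock ι o t w) s (write s o w r) (5 * total w r + 2 * w + 1) := by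
  induction w with
  | zero => rw [write_zero]; exact (RunLe.skip s).mono (by omega)
  | succ w ih =>
    have ih := ih (fun k hk => hr k (by omega))
      (fun k hk => ⟨(hι k (by omega)).1, fun h => (hι k (by omega)).2 ⟨h.1, by omega⟩⟩)
      (fun k hk => ho k (by omega))
    have hw := hι w (by omega)
    have e : write s o w r (ι w) = r w := by
      rw [← hr w (by omega)]
      exact if_neg fun h => hw.2 ⟨h.1, by omega⟩
    have e' : write s o w r t = [] := by
      rw [← ht]
      refine if_neg fun h => ?_
      have := (ho (t - o) (by omega)).1
      omega
    have h := copy_run (O := O) id (i := ι w) (j := o + w) (t := t) (fun h => hw.2 (by omega)) hw.1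
      (ho w (by omega)).1 (write s o w r) e' (by rw [write_of_ge le_rfl]; exact (ho w (by omega)).2)
    rw [write_succ]
    rw [e, List.map_id] at h
    refine (ih.seq h).mono ?_
    rw [total_succ]
    omega

end StackLang

namespace StackLang

open Turing Function StateTransition

/-! #### Represented types -/

/-- A representation of the elements of a type by a fixed number of stacks. -/
class Layout (α : Type) where
  /-- the number of stacks -/
  width (α) : ℕ
  /-- the contents of the stacks -/
  rep : α → ℕ → Word

open Layout (width rep)

instance : Layout Bool := ⟨1, fun b _ => bif b then [some true] else []⟩

/-- The representation is unary, so polynomial in `size` means polynomial in the value, and numbers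
can serve directly as loop counters. -/
instance : Layout ℕ := ⟨1, fun n _ => List.replicate n (some true)⟩

instance : Layout Word := ⟨1, fun w _ => w⟩

instance : Layout (List ℕ) :=
  ⟨1, fun l _ => l.flatMap fun n => List.replicate n (some true) ++ [some false]⟩

instance {α β : Type} [Layout α] [Layout β] : Layout (α × β) :=
  ⟨width α + width β,
    fun x k => if k < width α then rep x.1 k else rep x.2 (k - width α)⟩

variable {O : Oracle} {α β γ δ : Type} [Layout α] [Layout β] [Layout γ] [Layout δ]

/-- The number of symbols that represent an element. -/
def size (a : α) : ℕ := total (width α) (rep a)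

theorem total_add (m n : ℕ) (r : ℕ → Word) :
    total (m + n) r = total m r + total n fun k => r (m + k) :=
  Finset.sum_range_add _ _ _

theorem total_one (r : ℕ → Word) : total 1 r = (r 0).length := by simp [total]

theorem total_nil (n : ℕ) : total n (fun _ => []) = 0 := by simp [total]

@[simp] theorem size_prod (x : α × β) : size x = size x.1 + size x.2 := by
  unfold size
  change total (width α + width β) _ = _
  rw [total_add]
  congr 1
  · exact total_congr fun k hk => if_pos hk
  · refine total_congr fun k hk => ?_
    change (if width α + k < width α then _ else _) = _
    rw [if_neg (by omega), Nat.add_sub_cancel_left]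

@[simp] theorem size_nat (n : ℕ) : size n = n := by
  unfold size
  change total 1 _ = _
  rw [total_one]
  exact List.length_replicate

theorem size_bool_le (b : Bool) : size b ≤ 1 := by
  unfold size
  change total 1 _ ≤ _
  rw [total_one]
  cases b <;> simp [rep]

@[simp] theorem size_word (w : Word) : size w = w.length := by
  unfold size
  change total 1 _ = _
  rw [total_one]
  rfl

theorem size_natList (l : List ℕ) : size l = (l.map (· + 1)).sum := by
  unfold size
  change total 1 _ = _
  rw [total_one]
  change (l.flatMap _).length = _
  simp [List.length_flatMap]

/-- The stacks with the addresses `ι k` represent `a`. -/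
def Holds (s : Store) (ι : ℕ → ℕ) (a : α) : Prop := ∀ k < width α, s (ι k) = rep a k

/-- The function `f` can be computed in polynomial time, with the help of an oracle. The program
finds its input at arbitrary addresses below `b`, leaves everything there unchanged, and writes its
output at the address `b`, provided that the stacks from `b` on are empty in the beginning. -/
@[fun_prop]
def PT (O : Oracle) (f : α → β) : Prop :=
  ∃ P : Polynomial ℕ, (∀ a, size (f a) ≤ P.eval (size a)) ∧
    ∀ (ι : ℕ → ℕ) (b : ℕ), (∀ k < width α, ι k < b) → ∃ p : Prog, ∀ (s : Store) (a : α),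
      Holds s ι a → (∀ k, b ≤ k → s k = []) →
        RunLe O p s (write s b (width β) (rep (f a))) (P.eval (size a))

theorem monotone_eval (P : Polynomial ℕ) : Monotone fun n => P.eval n := by
  intro m n h
  simp only [Polynomial.eval_eq_sum_range]
  exact Finset.sum_le_sum fun i _ => Nat.mul_le_mul_left _ (Nat.pow_le_pow_left h i)

theorem Holds.write {s : Store} {ι : ℕ → ℕ} {a : α} (h : Holds s ι a) {b o w : ℕ}
    {r : ℕ → Word} (hι : ∀ k < width α, ι k < b) (hb : b ≤ o) : Holds (write s o w r) ι a := by
  intro k hk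
  rw [write_of_lt ((hι k hk).trans_le hb), h k hk]

theorem holds_write (s : Store) (o : ℕ) (a : α) :
    Holds (StackLang.write s o (width α) (rep a)) (fun k => o + k) a :=
  fun _ hk => write_add hk

/-- Copies a result from the address `c` to the address `b` and clears the `n` stacks
above it. -/
theorem emit_run {s s' : Store} {b w c n : ℕ} {r : ℕ → Word} (hs : ∀ k, b ≤ k → s k = [])
    (hc : b + w ≤ c) (hn : c + w ≤ b + w + n) (hr : ∀ k < w, s' (c + k) = r k)
    (hs' : ∀ k, ¬(b + w ≤ k ∧ k < b + w + n) → s' k = s k) :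
    RunLe O (.seq (copyBlock (fun k => c + k) b (b + w + n) w) (clearBlock (b + w) n)) s'
      (write s b w r) ((5 * total w r + 2 * w + 1) +
        (2 * total n (fun k => s' (b + w + k)) + n + 1)) := by
  have h₁ := copyBlock_run (O := O) (ι := fun k => c + k) (o := b) (t := b + w + n) (w := w) s' r hr
    (fun k hk => ⟨by omega, by omega⟩)
    (fun k hk => ⟨by omega, by rw [hs' _ (by omega), hs _ (by omega)]⟩)
    (by rw [hs' _ (by omega), hs _ (by omega)])
  have h₂ := clearBlock_run (O := O) (b + w) n (StackLang.write s' b w r)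
  have e : StackLang.write (StackLang.write s' b w r) (b + w) n (fun _ => []) =
      StackLang.write s b w r := by
    funext k
    simp only [StackLang.write]
    split_ifs with h h' h'
    · omega
    · exact (hs k (by omega)).symm
    · rfl
    · exact hs' k h
  rw [e] at h₂
  have e' : total n (fun k => StackLang.write s' b w r (b + w + k)) =
      total n (fun k => s' (b + w + k)) := total_congr fun k _ => write_of_ge (by omega)
  rw [e'] at h₂
  exact h₁.seq h₂

namespace PT

/-- Two functions whose values are represented in the same way. -/
theorem congr_rep {f : α → β} {g : α → γ} (hf : PT O f) (hw : width γ = width β)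
    (h : ∀ a, ∀ k < width β, rep (g a) k = rep (f a) k) : PT O g := by
  obtain ⟨P, hP, H⟩ := hf
  refine ⟨P, fun a => ?_, fun ι b hι => ?_⟩
  · refine le_trans (le_of_eq ?_) (hP a)
    unfold size
    rw [hw]
    exact total_congr (h a)
  · obtain ⟨p, hp⟩ := H ι b hι
    refine ⟨p, fun s a hs hb => ?_⟩
    have e : StackLang.write s b (width γ) (rep (g a)) =
        StackLang.write s b (width β) (rep (f a)) := by
      funext k
      simp only [StackLang.write, hw]
      split_ifs with hk
      · exact h a _ (by omega)
      · rfl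
    rw [e]
    exact hp s a hs hb

/-- Selecting a block of the input. -/
theorem select (f : α → β) (n : ℕ) (hn : n + width β ≤ width α)
    (h : ∀ a, ∀ k < width β, rep (f a) k = rep a (n + k)) : PT O f := by
  have hsize : ∀ a, size (f a) ≤ size a := by
    intro a
    unfold size
    rw [total_congr (h a)]
    obtain ⟨m, hm⟩ := Nat.exists_eq_add_of_le hn
    rw [hm, total_add, total_add]
    omega
  refine ⟨5 * .X + .C (2 * width β + 1), fun a => ?_, fun ι b hι => ?_⟩
  · simp only [Polynomial.eval_add, Polynomial.eval_mul, Polynomial.eval_X, Polynomial.eval_C,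
      Polynomial.eval_ofNat]
    have := hsize a
    omega
  · refine ⟨copyBlock (fun k => ι (n + k)) b (b + width β) (width β), fun s a hs hb => ?_⟩
    refine (copyBlock_run s (rep (f a)) (fun k hk => ?_) (fun k hk => ?_) (fun k hk => ?_)
      (hb _ (by omega))).mono ?_
    · rw [h a k hk, hs _ (by omega)]
    · have := hι (n + k) (by omega)
      constructor <;> omega
    · exact ⟨by omega, hb _ (by omega)⟩
    · simp only [Polynomial.eval_add, Polynomial.eval_mul, Polynomial.eval_X, Polynomial.eval_C,
        Polynomial.eval_ofNat]
      have h1 : total (width β) (rep (f a)) ≤ size a := hsize a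
      omega

@[fun_prop]
theorem id' : PT O (fun a : α => a) :=
  select _ 0 (by omega) fun a k _ => by rw [Nat.zero_add]

theorem fst' : PT O (fun x : α × β => x.1) := by
  refine select _ 0 (show 0 + width α ≤ width α + width β by omega) fun a k hk => ?_
  rw [Nat.zero_add]
  exact (if_pos hk).symm

theorem snd' : PT O (fun x : α × β => x.2) := by
  refine select _ (width α) (show width α + width β ≤ width α + width β by omega) fun a k hk => ?_
  change _ = if width α + k < width α then _ else _
  rw [if_neg (by omega), Nat.add_sub_cancel_left]

@[fun_prop]
theorem const (c : β) : PT O (fun _ : α => c) := by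
  have word : ∀ (k : ℕ) (w : Word), ∃ p : Prog, ∀ s : Store, s k = [] →
      RunLe O p s (update s k w) (w.length + 1) := by
    intro k w
    induction w with
    | nil =>
      refine ⟨.skip, fun s hs => ?_⟩
      rw [← hs, update_eq_self]
      exact (RunLe.skip s).mono (by simp)
    | cons a w ih =>
      obtain ⟨p, hp⟩ := ih
      refine ⟨.seq p (.push k a), fun s hs => ?_⟩
      have h := (hp s hs).seq (RunLe.push (O := O) k a _)
      rw [update_idem, update_self] at h
      exact h
  have block : ∀ w : ℕ, ∃ T : ℕ, ∀ b, ∃ p : Prog, ∀ s : Store, (∀ k, b ≤ k → s k = []) →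
      RunLe O p s (StackLang.write s b w (rep c)) T := by
    intro w
    induction w with
    | zero => exact ⟨1, fun b => ⟨.skip, fun s _ => by rw [write_zero]; exact RunLe.skip s⟩⟩
    | succ w ih =>
      obtain ⟨T, ih⟩ := ih
      refine ⟨T + ((rep c w).length + 1), fun b => ?_⟩
      obtain ⟨p, hp⟩ := ih b
      obtain ⟨q, hq⟩ := word (b + w) (rep c w)
      refine ⟨.seq p q, fun s hs => ?_⟩
      rw [write_succ]
      exact (hp s hs).seq (hq _ (by rw [write_of_ge le_rfl]; exact hs _ (by omega)))
  obtain ⟨T, hT⟩ := block (width β)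
  refine ⟨.C (size c + T), fun a => by simp, fun ι b _ => ?_⟩
  obtain ⟨p, hp⟩ := hT b
  exact ⟨p, fun s a _ hb => (hp s hb).mono (by simp)⟩

-- The block of `width γ` stacks at `b` is left free for the output. The value of `f` goes above it
-- and the value of `g` above that; then `emit_run` copies the latter down and clears the work
-- space. The size bound in `PT` enters the bound for the time that `g` takes.
@[fun_prop]
theorem comp {g : β → γ} {f : α → β} (hg : PT O g) (hf : PT O f) : PT O (fun a => g (f a)) := by
  obtain ⟨P, hP, F⟩ := hf
  obtain ⟨Q, hQ, G⟩ := hg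
  refine ⟨P + Q.comp P + (5 * Q.comp P + .C (2 * width γ + 1) +
    (2 * (P + Q.comp P) + .C (width β + width γ + 1))), fun a => ?_, fun ι b hι => ?_⟩
  · have h := (hQ (f a)).trans (monotone_eval Q (hP a))
    simp only [Polynomial.eval_add, Polynomial.eval_comp]
    simp only at h
    omega
  · obtain ⟨p, hp⟩ := F ι (b + width γ) fun k hk => (hι k hk).trans_le (by omega)
    obtain ⟨q, hq⟩ := G (fun k => b + width γ + k) (b + width γ + width β) fun k hk => by omega
    refine ⟨.seq (.seq p q) (.seq (copyBlock (fun k => b + width γ + width β + k) b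
      (b + width γ + (width β + width γ)) (width γ))
      (clearBlock (b + width γ) (width β + width γ))), fun s a hs hb => ?_⟩
    have h₁ := hp s a hs fun k hk => hb k (by omega)
    have h₂ := hq _ (f a) (holds_write s _ (f a)) fun k hk => by
      rw [write_of_ge hk]; exact hb k (by omega)
    have h₃ := emit_run (O := O) (s := s) (w := width γ) (c := b + width γ + width β)
      (n := width β + width γ) (r := rep (g (f a))) hb (by omega) (by omega)
      (fun k hk => write_add (s := StackLang.write s (b + width γ) (width β) (rep (f a))) hk)
      (fun k hk => by
        simp only [StackLang.write]
        rw [if_neg (by omega), if_neg (by omega)])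
    refine ((h₁.seq h₂).seq h₃).mono ?_
    have e : total (width β + width γ) (fun k => StackLang.write
        (StackLang.write s (b + width γ) (width β) (rep (f a))) (b + width γ + width β) (width γ)
        (rep (g (f a))) (b + width γ + k)) = size (f a) + size (g (f a)) := by
      rw [total_add]
      congr 1
      · refine total_congr fun k hk => ?_
        rw [write_of_lt (by omega), write_add hk]
      · refine total_congr fun k hk => ?_
        rw [← Nat.add_assoc, write_add hk]
    rw [e]
    have e₁ := hP a
    have e₂ := (hQ (f a)).trans (monotone_eval Q (hP a))
    have e₃ := monotone_eval Q (hP a)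
    simp only [Polynomial.eval_add, Polynomial.eval_comp, Polynomial.eval_mul, Polynomial.eval_C,
      Polynomial.eval_ofNat]
    simp only at e₂ e₃
    have e₄ : total (width γ) (rep (g (f a))) = size (g (f a)) := rfl
    omega

@[fun_prop]
theorem fst {f : α → β × γ} (hf : PT O f) : PT O (fun a => (f a).1) := fst'.comp hf

@[fun_prop]
theorem snd {f : α → β × γ} (hf : PT O f) : PT O (fun a => (f a).2) := snd'.comp hf

-- The two outputs are written next to each other, and this already is the layout of the pair. Since
-- the stacks of the input are arbitrary and stay unchanged, the second program can read them again.
@[fun_prop]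
theorem pair {f : α → β} {g : α → γ} (hf : PT O f) (hg : PT O g) :
    PT O (fun a => (f a, g a)) := by
  obtain ⟨P, hP, F⟩ := hf
  obtain ⟨Q, hQ, G⟩ := hg
  refine ⟨P + Q, fun a => ?_, fun ι b hι => ?_⟩
  · simp only [size_prod, Polynomial.eval_add]
    exact Nat.add_le_add (hP a) (hQ a)
  · obtain ⟨p, hp⟩ := F ι b hι
    obtain ⟨q, hq⟩ := G ι (b + width β) fun k hk => (hι k hk).trans_le (by omega)
    refine ⟨.seq p q, fun s a hs hb => ?_⟩
    have h₁ := hp s a hs hb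
    have h₂ := hq _ a (hs.write (o := b) (w := width β) (r := rep (f a)) hι le_rfl)
      fun k hk => (write_of_ge hk).trans (hb k (by omega))
    have e : StackLang.write s b (width (β × γ)) (rep (f a, g a)) =
        StackLang.write (StackLang.write s b (width β) (rep (f a))) (b + width β) (width γ)
          (rep (g a)) := by
      funext k
      change (if b ≤ k ∧ k < b + (width β + width γ) then
        (if k - b < width β then rep (f a) (k - b) else rep (g a) (k - b - width β)) else s k) = _
      simp only [StackLang.write]
      split_ifs <;> first | rfl | omega | skip
      rw [Nat.sub_sub]
    rw [e, Polynomial.eval_add]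
    exact h₁.seq h₂

@[fun_prop]
theorem cond {c : α → Bool} {f g : α → β} (hc : PT O c) (hf : PT O f) (hg : PT O g) :
    PT O (fun a => bif c a then f a else g a) := by
  obtain ⟨R, hR, C⟩ := hc
  obtain ⟨P, hP, F⟩ := hf
  obtain ⟨Q, hQ, G⟩ := hg
  refine ⟨R + 1 + (P + Q), fun a => ?_, fun ι b hι => ?_⟩
  · have h₁ := hP a
    have h₂ := hQ a
    simp only [Polynomial.eval_add]
    cases c a <;> simp only [cond_true, cond_false] <;> omega
  · obtain ⟨r, hr⟩ := C ι b hι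
    obtain ⟨p, hp⟩ := F ι b hι
    obtain ⟨q, hq⟩ := G ι b hι
    -- The Boolean takes up at most one symbol, so the pop in `cas` leaves stack `b` empty in both
    -- cases and either branch can write its output there.
    refine ⟨.seq r (.cas b fun x => x.elim q fun _ => p), fun s a hs hb => ?_⟩
    have h₁ := hr s a hs hb
    have e : StackLang.write s b (width Bool) (rep (c a)) =
        update s b (bif c a then [some true] else []) := write_one _ _ _
    rw [e] at h₁
    have key : ∀ {x : Bool} {p' : Prog} {s' : Store} {T : ℕ}, c a = x →
        p' = (bif x then p else q) → RunLe O p' s s' T →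
        RunLe O (.cas b fun x => x.elim q fun _ => p) (update s b (bif x then [some true] else []))
          s' (1 + T) := by
      rintro x p' s' T hx hp' ⟨t, ht, h⟩
      refine ⟨1 + t, by omega, .cas ?_⟩
      rw [update_self, update_idem]
      have e : update s b (bif x then [some true] else [] : Word).tail = s := by
        rw [show (bif x then [some true] else [] : Word).tail = s b by
          rw [hb b le_rfl]; cases x <;> rfl, update_eq_self]
      rw [e]
      cases x <;> (subst hp'; exact h)
    have h₂ : RunLe O (.cas b fun x => x.elim q fun _ => p)
        (update s b (bif c a then [some true] else []))
        (StackLang.write s b (width β) (rep (bif c a then f a else g a)))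
        (1 + (P.eval (size a) + Q.eval (size a))) := by
      cases hx : c a
      · exact key hx rfl ((hq s a hs hb).mono (by omega))
      · exact key hx rfl ((hp s a hs hb).mono (by omega))
    refine (h₁.seq h₂).mono ?_
    simp only [Polynomial.eval_add, Polynomial.eval_one]
    omega

end PT

end StackLang

/-! ### Operations on single stacks, oracle calls and primitive recursion. -/

namespace StackLang

open Turing Function StateTransition

open Layout (width rep)

variable {O : Oracle} {α β γ δ : Type} [Layout α] [Layout β] [Layout γ] [Layout δ]

theorem size_of_width_one (h : width α = 1) (a : α) : size a = (rep a 0).length := by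
  unfold size
  rw [h, total_one]

namespace PT

theorem map_symbols (φ : Sym → Sym) (f : α → β) (hα : width α = 1) (hβ : width β = 1)
    (h : ∀ a, rep (f a) 0 = (rep a 0).map φ) : PT O f := by
  refine ⟨5 * .X + 2, fun a => ?_, fun ι b hι => ⟨copy φ (ι 0) b (b + 1), fun s a hs hb => ?_⟩⟩
  · simp only [size_of_width_one hα, size_of_width_one hβ, h, List.length_map,
      Polynomial.eval_add, Polynomial.eval_mul, Polynomial.eval_X, Polynomial.eval_ofNat]
    omega
  · have hlt := hι 0 (by omega)
    have hc := copy_run (O := O) φ (i := ι 0) (j := b) (t := b + 1) (by omega) (by omega) (by omega)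
      s (hb _ (by omega)) (hb _ le_rfl)
    rw [hs 0 (by omega)] at hc
    rw [hβ, write_one, h]
    refine hc.mono ?_
    simp only [size_of_width_one hα, Polynomial.eval_add, Polynomial.eval_mul, Polynomial.eval_X,
      Polynomial.eval_ofNat]
    omega

theorem push_symbol (x : Sym) (f : α → β) (hα : width α = 1) (hβ : width β = 1)
    (h : ∀ a, rep (f a) 0 = x :: rep a 0) : PT O f := by
  refine ⟨5 * .X + 3, fun a => ?_,
    fun ι b hι => ⟨.seq (copy id (ι 0) b (b + 1)) (.push b x), fun s a hs hb => ?_⟩⟩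
  · simp only [size_of_width_one hα, size_of_width_one hβ, h, List.length_cons,
      Polynomial.eval_add, Polynomial.eval_mul, Polynomial.eval_X, Polynomial.eval_ofNat]
    omega
  · have hlt := hι 0 (by omega)
    have hc := copy_run (O := O) id (i := ι 0) (j := b) (t := b + 1) (by omega) (by omega)
      (by omega) s (hb _ (by omega)) (hb _ le_rfl)
    rw [hs 0 (by omega), List.map_id] at hc
    have hc' := hc.seq (RunLe.push b x _)
    rw [update_idem, update_self] at hc'
    rw [hβ, write_one, h]
    refine hc'.mono ?_
    simp only [size_of_width_one hα, Polynomial.eval_add, Polynomial.eval_mul, Polynomial.eval_X,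
      Polynomial.eval_ofNat]
    omega

theorem pop_symbol (f : α → β) (hα : width α = 1) (hβ : width β = 1)
    (h : ∀ a, rep (f a) 0 = (rep a 0).tail) : PT O f := by
  refine ⟨5 * .X + 4, fun a => ?_,
    fun ι b hι => ⟨.seq (copy id (ι 0) b (b + 1)) (.cas b fun _ => .skip), fun s a hs hb => ?_⟩⟩
  · simp only [size_of_width_one hα, size_of_width_one hβ, h, List.length_tail,
      Polynomial.eval_add, Polynomial.eval_mul, Polynomial.eval_X, Polynomial.eval_ofNat]
    omega
  · have hlt := hι 0 (by omega)
    have hc := copy_run (O := O) id (i := ι 0) (j := b) (t := b + 1) (by omega) (by omega)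
      (by omega) s (hb _ (by omega)) (hb _ le_rfl)
    rw [hs 0 (by omega), List.map_id] at hc
    have hp : RunLe O (.cas b fun _ => .skip) (update s b (rep a 0)) (update s b (rep a 0).tail)
        2 := by
      refine ⟨1 + 1, le_rfl, .cas ?_⟩
      rw [update_self, update_idem]
      exact .skip _
    rw [hβ, write_one, h]
    refine (hc.seq hp).mono ?_
    simp only [size_of_width_one hα, Polynomial.eval_add, Polynomial.eval_mul, Polynomial.eval_X,
      Polynomial.eval_ofNat]
    omega

theorem test_symbol (φ : Option Sym → Bool) (f : α → Bool) (hα : width α = 1)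
    (h : ∀ a, f a = φ (rep a 0).head?) : PT O f := by
  refine ⟨7 * .X + 8, fun a => ?_, fun ι b hι => ⟨.seq (copy id (ι 0) b (b + 1)) (.cas b fun x =>
    .seq (clear b) (bif φ x then .push b (some true) else .skip)), fun s a hs hb => ?_⟩⟩
  · refine (size_bool_le _).trans ?_
    simp only [Polynomial.eval_add, Polynomial.eval_mul, Polynomial.eval_X, Polynomial.eval_ofNat]
    omega
  · have hlt := hι 0 (by omega)
    have hc := copy_run (O := O) id (i := ι 0) (j := b) (t := b + 1) (by omega) (by omega)
      (by omega) s (hb _ (by omega)) (hb _ le_rfl)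
    rw [hs 0 (by omega), List.map_id] at hc
    have hq : RunLe O (bif φ (rep a 0).head? then .push b (some true) else .skip)
        (update s b []) (update s b (rep (f a) 0)) 1 := by
      rw [h a]
      cases φ (rep a 0).head?
      · exact RunLe.skip _
      · have := RunLe.push (O := O) b (some true) (update s b [])
        rwa [update_idem, update_self] at this
    have hd := clear_run (O := O) b (update s b (rep a 0).tail)
    rw [update_idem, update_self, List.length_tail] at hd
    have hp : RunLe O (.cas b fun x =>
        .seq (clear b) (bif φ x then .push b (some true) else .skip))
        (update s b (rep a 0)) (update s b (rep (f a) 0)) (1 + (2 * (rep a 0).length + 2)) := by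
      obtain ⟨t, ht, hr⟩ := hd.seq hq
      refine ⟨1 + t, by omega, .cas ?_⟩
      rw [update_self, update_idem]
      exact hr
    rw [show width Bool = 1 from rfl, write_one]
    refine (hc.seq hp).mono ?_
    simp only [size_of_width_one hα, Polynomial.eval_add, Polynomial.eval_mul, Polynomial.eval_X,
      Polynomial.eval_ofNat]
    omega

/-- A function that is computed by the oracle machine. -/
theorem oracle {ea : α → List (O.M.Γ O.M.k₀)} {eb : α → List (O.M.Γ O.M.k₁)} {f : α → β}
    (T : Polynomial ℕ)
    (hM : ∀ a, Nonempty (TM2OutputsInTime O.M (ea a) (some (eb a)) (T.eval (ea a).length)))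
    (hα : width α = 1) (hβ : width β = 1) (ha : ∀ a, (rep a 0).map O.cin = ea a)
    (hb : ∀ a, (eb a).map O.cout = rep (f a) 0) (B : Polynomial ℕ)
    (hB : ∀ a, size (f a) ≤ B.eval (size a)) : PT O f := by
  -- A call consumes a reversed input and delivers a reversed output; the two transfers around it
  -- restore the order.
  refine ⟨B + (5 * .X + 2) + (2 * .X + 1) + (.X + 1 + (T + (B + 1))) + (2 * B + 1), fun a => ?_,
    fun ι b hι => ⟨.seq (.seq (.seq (copy id (ι 0) b (b + 1)) (transfer id b (b + 1)))
      (.call (b + 1) (b + 1))) (transfer id (b + 1) b), fun s a hs hs' => ?_⟩⟩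
  · refine (hB a).trans ?_
    simp only [Polynomial.eval_add]
    omega
  · have hlt := hι 0 (by omega)
    have h₁ := copy_run (O := O) id (i := ι 0) (j := b) (t := b + 1) (by omega) (by omega)
      (by omega) s (hs' _ (by omega)) (hs' _ le_rfl)
    rw [hs 0 (by omega), List.map_id] at h₁
    have h₂ := transfer_run (O := O) id (i := b) (j := b + 1) (by omega) (update s b (rep a 0))
    rw [update_self, update_idem, List.map_id, update_of_ne (by omega), hs' (b + 1) (by omega),
      List.append_nil] at h₂
    have e₂ : update s b [] = s := by rw [← hs' b le_rfl, update_eq_self]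
    rw [e₂] at h₂
    obtain ⟨⟨⟨t, ht⟩, ht'⟩⟩ := hM a
    have hlen : (ea a).length = size a := by
      rw [← ha a, List.length_map, size_of_width_one hα]
    have hlen' : (eb a).length = size (f a) := by
      rw [size_of_width_one hβ, ← hb, List.length_map]
    have h₃ : RunLe O (.call (b + 1) (b + 1)) (update s (b + 1) (rep a 0).reverse)
        (update s (b + 1) (rep (f a) 0).reverse)
        ((size a + 1) + (T.eval (size a) + (size (f a) + 1))) := by
      have hc := Run.call (O := O) (i := b + 1) (o := b + 1)
        (s := update s (b + 1) (rep a 0).reverse) (y := eb a) (t := t)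
        (by rw [update_self, List.reverse_reverse, ha]; exact ht)
      rw [update_self, update_idem, update_self, update_idem, hb, List.append_nil,
        List.length_reverse, ← size_of_width_one hα, hlen'] at hc
      refine ⟨_, ?_, hc⟩
      rw [hlen] at ht'
      simp only at ht'
      omega
    have h₄ := transfer_run (O := O) id (i := b + 1) (j := b) (by omega)
      (update s (b + 1) (rep (f a) 0).reverse)
    have e₄ : update s (b + 1) [] = s := by
      rw [← hs' (b + 1) (by omega), update_eq_self]
    rw [update_self, update_idem, List.map_id, List.reverse_reverse, update_of_ne (by omega),
      hs' b le_rfl, List.append_nil, e₄] at h₄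
    rw [hβ, write_one]
    refine (((h₁.seq h₂).seq h₃).seq h₄).mono ?_
    have := hB a
    simp only [Polynomial.eval_add, Polynomial.eval_mul, Polynomial.eval_X,
      Polynomial.eval_ofNat, Polynomial.eval_one, List.length_reverse,
      ← size_of_width_one hα, ← size_of_width_one hβ]
    omega

/-- Primitive recursion, provided that the size of all intermediate results is bounded by a
polynomial. -/
theorem natRec {f : α → ℕ} {g : α → β} {h : α → ℕ → β → β} (hf : PT O f) (hg : PT O g)
    (hh : PT O fun x : α × ℕ × β => h x.1 x.2.1 x.2.2) (B : Polynomial ℕ)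
    (hB : ∀ a, ∀ n ≤ f a, size (Nat.rec (g a) (h a) n : β) ≤ B.eval (size a)) :
    PT O fun a => (Nat.rec (g a) (h a) (f a) : β) := by
  obtain ⟨P, hP, F⟩ := hf
  obtain ⟨Q, hQ, G⟩ := hg
  obtain ⟨R, hR, H⟩ := hh
  set w := width β with hw
  -- The cost of one round: one evaluation of `h` on an argument of size at most `X + P + B`, then
  -- clearing the old value, copying the new one and clearing the copy (`2 + 5 + 2 = 9` steps per
  -- symbol), and fixed costs for the `w` stacks and the final push.
  let D : Polynomial ℕ := R.comp (.X + (P + B)) + (9 * B + .C (4 * w + 4))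
  refine ⟨P + Q + (P * (D + 1) + 1) + (5 * B + .C (2 * w + 1) +
    (2 * (P + B) + .C (2 + (w + w) + 1))), fun a => ?_, fun ι b hι => ?_⟩
  · have := hB a (f a) le_rfl
    simp only [Polynomial.eval_add, Polynomial.eval_mul, Polynomial.eval_ofNat]
    omega
  obtain ⟨pf, hpf⟩ := F ι (b + w) fun k hk => (hι k hk).trans_le (by omega)
  obtain ⟨pg, hpg⟩ := G ι (b + w + 2) fun k hk => (hι k hk).trans_le (by omega)
  -- The argument of `h` is scattered: the input stays where it is, the index is at `b + w + 1`, and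
  -- the current value is in the block from `b + w + 2` on. Permitting arbitrary address maps in
  -- `PT` is what makes this possible.
  let ι' : ℕ → ℕ := fun k => if k < width α then ι k else
    if k - width α < 1 then b + w + 1 else b + w + 2 + (k - width α - 1)
  obtain ⟨ph, hph⟩ := H ι' (b + w + 2 + w) fun k hk => by
    have hk' : k < width α + (1 + w) := hk
    by_cases h1 : k < width α
    · have := hι k h1
      simp only [ι', if_pos h1]; omega
    · simp only [ι', if_neg h1]
      split_ifs <;> omega
  let body : Prog := .seq ph (.seq (clearBlock (b + w + 2) w) (.seq
    (copyBlock (fun k => b + w + 2 + w + k) (b + w + 2) (b + w + 2 + w + w) w) (.seq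
    (clearBlock (b + w + 2 + w) w) (.push (b + w + 1) (some true)))))
  refine ⟨.seq (.seq (.seq pf pg) (.loop (b + w) fun _ => body))
    (.seq (copyBlock (fun k => b + w + 2 + k) b (b + w + (2 + (w + w))) w)
      (clearBlock (b + w) (2 + (w + w)))), fun s a hs hb => ?_⟩
  let U : ℕ → Word := fun n => List.replicate n (some true)
  -- The loop invariant: `n` rounds are left, `j` are done, and the current value is `x`. The output
  -- block at `b` is still empty.
  let st : ℕ → ℕ → β → Store := fun n j x =>
    StackLang.write (update (update s (b + w) (U n)) (b + w + 1) (U j)) (b + w + 2) w (rep x)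
  let r : ℕ → β := fun n => Nat.rec (g a) (h a) n
  have h₁ := hpf s a hs fun k hk => hb k (by omega)
  rw [show width ℕ = 1 from rfl, write_one] at h₁
  have h₂ := hpg (update s (b + w) (rep (f a) 0)) a
    (fun k hk => by
      have := hι k hk
      rw [update_of_ne (by omega), hs k hk])
    (fun k hk => by rw [update_of_ne (by omega), hb k (by omega)])
  have e₂ : StackLang.write (update s (b + w) (rep (f a) 0)) (b + w + 2) w (rep (g a)) =
      st (f a) 0 (r 0) := by
    have : update (update s (b + w) (U (f a))) (b + w + 1) (U 0) =
        update s (b + w) (rep (f a) 0) := by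
      refine update_eq_self_iff.2 ?_
      rw [update_of_ne (by omega), hb _ (by omega)]
      rfl
    simp only [st, this]
    rfl
  rw [e₂] at h₂
  have step : ∀ n j, n + j < f a →
      RunLe O body (st n j (r j)) (st n (j + 1) (r (j + 1))) (D.eval (size a)) := by
    intro n j hj
    have hs' : Holds (st n j (r j)) ι' (a, j, r j) := by
      intro k hk
      have hk' : k < width α + (1 + w) := hk
      change _ = if k < width α then rep a k else
        if k - width α < 1 then rep j (k - width α) else rep (r j) (k - width α - 1)
      by_cases h1 : k < width α
      · have := hι k h1
        simp only [ι', st, if_pos h1]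
        rw [write_of_lt (by omega), update_of_ne (by omega), update_of_ne (by omega), hs k h1]
      · simp only [ι', st, if_neg h1]
        split_ifs with h2
        · rw [write_of_lt (by omega), update_self]; rfl
        · rw [write_add (by omega)]
    have k₁ := hph _ _ hs' fun k hk => by
      simp only [st]
      rw [write_of_ge (by omega), update_of_ne (by omega), update_of_ne (by omega), hb _ (by omega)]
    simp only at k₁
    set x' := h a j (r j) with hx'
    have k₂ := clearBlock_run (O := O) (b + w + 2) w
      (StackLang.write (st n j (r j)) (b + w + 2 + w) w (rep x'))
    have k₃ := copyBlock_run (O := O) (ι := fun k => b + w + 2 + w + k) (o := b + w + 2)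
      (t := b + w + 2 + w + w) (w := w) (StackLang.write (StackLang.write (st n j (r j))
        (b + w + 2 + w) w (rep x')) (b + w + 2) w fun _ => []) (rep x')
      (fun k hk => by rw [write_of_ge (by omega), write_add hk])
      (fun k hk => ⟨by omega, by omega⟩)
      (fun k hk => ⟨by omega, write_add hk⟩)
      (by
        rw [write_of_ge (by omega), write_of_ge (by omega)]
        simp only [st]
        rw [write_of_ge (by omega), update_of_ne (by omega), update_of_ne (by omega),
          hb _ (by omega)])
    have e₃ : StackLang.write (StackLang.write (StackLang.write (st n j (r j))
        (b + w + 2 + w) w (rep x')) (b + w + 2) w fun _ => []) (b + w + 2) w (rep x') =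
        StackLang.write (st n j x') (b + w + 2 + w) w (rep x') := by
      funext k
      simp only [StackLang.write, st]
      split_ifs <;> first | rfl | omega
    rw [e₃] at k₃
    have k₄ := clearBlock_run (O := O) (b + w + 2 + w) w
      (StackLang.write (st n j x') (b + w + 2 + w) w (rep x'))
    have e₄ : StackLang.write (StackLang.write (st n j x') (b + w + 2 + w) w (rep x'))
        (b + w + 2 + w) w (fun _ => []) = st n j x' := by
      funext k
      simp only [StackLang.write]
      split_ifs with h1
      · simp only [st]
        rw [write_of_ge (by omega), update_of_ne (by omega), update_of_ne (by omega),
          hb _ (by omega)]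
      · rfl
    rw [e₄] at k₄
    have k₅ := RunLe.push (O := O) (b + w + 1) (some true) (st n j x')
    have e₅ : update (st n j x') (b + w + 1) (some true :: st n j x' (b + w + 1)) =
        st n (j + 1) x' := by
      funext k
      simp only [StackLang.write, st, update_apply]
      split_ifs <;> first | rfl | omega
    rw [e₅] at k₅
    refine (k₁.seq (k₂.seq (k₃.seq (k₄.seq k₅)))).mono ?_
    have t₁ : size (r j) ≤ B.eval (size a) := hB a j (by omega)
    have t₂ : size x' ≤ B.eval (size a) := hB a (j + 1) (by omega)
    have t₃ : R.eval (size ((a, j, r j) : α × ℕ × β)) ≤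
        R.eval (size a + (P.eval (size a) + B.eval (size a))) := by
      refine monotone_eval R ?_
      have := hP a
      simp only [size_prod, size_nat] at this ⊢
      omega
    have t₄ : total w (fun k => StackLang.write (st n j (r j)) (b + w + 2 + w) w (rep x')
        (b + w + 2 + k)) = size (r j) := total_congr fun k hk => by
      rw [write_of_lt (by omega)]
      exact write_add hk
    have t₅ : total w (fun k => StackLang.write (st n j x') (b + w + 2 + w) w (rep x')
        (b + w + 2 + w + k)) = size x' := total_congr fun k hk => write_add hk
    have t₆ : total w (rep x') = size x' := rfl
    simp only [D, Polynomial.eval_add, Polynomial.eval_mul, Polynomial.eval_X,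
      Polynomial.eval_ofNat, Polynomial.eval_C, Polynomial.eval_comp]
    omega
  have loop : ∀ n j, n + j = f a → RunLe O (.loop (b + w) fun _ => body) (st n j (r j))
      (st 0 (f a) (r (f a))) (n * (D.eval (size a) + 1) + 1) := by
    intro n
    induction n with
    | zero =>
      intro j hj
      obtain rfl : j = f a := by omega
      refine ⟨1, by omega, .loop_nil ?_⟩
      simp only [st]
      rw [write_of_lt (by omega), update_of_ne (by omega), update_self]
      rfl
    | succ n ih =>
      intro j hj
      obtain ⟨t₁, l₁, r₁⟩ := step n j (by omega)
      obtain ⟨t₂, l₂, r₂⟩ := ih (j + 1) (by omega)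
      refine ⟨1 + (t₁ + t₂), ?_, .loop_cons (a := some true) (w := U n) ?_ ?_ r₂⟩
      · rw [Nat.succ_mul]; omega
      · simp only [st]
        rw [write_of_lt (by omega), update_of_ne (by omega), update_self]
        rfl
      · have e : update (st (n + 1) j (r j)) (b + w) (U n) = st n j (r j) := by
          funext k
          simp only [StackLang.write, st, update_apply]
          split_ifs <;> first | rfl | omega
        rw [e]
        exact r₁
  have h₃ := loop (f a) 0 rfl
  have h₄ := emit_run (O := O) (s := s) (s' := st 0 (f a) (r (f a))) (w := w) (c := b + w + 2)
    (n := 2 + (w + w)) (r := rep (r (f a))) hb (by omega) (by omega)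
    (fun k hk => write_add hk)
    (fun k hk => by
      simp only [st, StackLang.write]
      rw [if_neg (by omega), update_of_ne (by omega), update_of_ne (by omega)])
  refine (((h₁.seq h₂).seq h₃).seq h₄).mono ?_
  have t₁ := hP a
  have t₂ := hB a (f a) le_rfl
  have t₃ : total (2 + (w + w)) (fun k => st 0 (f a) (r (f a)) (b + w + k)) =
      f a + size (r (f a)) := by
    rw [total_add, total_add, show (2 : ℕ) = 1 + 1 from rfl, total_add, total_one, total_one]
    have e₁ : st 0 (f a) (r (f a)) (b + w + 0) = [] := by
      simp only [st]
      rw [write_of_lt (by omega), update_of_ne (by omega), Nat.add_zero, update_self]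
      rfl
    have e₂ : st 0 (f a) (r (f a)) (b + w + (1 + 0)) = U (f a) := by
      simp only [st]
      rw [write_of_lt (by omega), Nat.add_zero, update_self]
    have e₃ : total w (fun k => st 0 (f a) (r (f a)) (b + w + (1 + 1 + k))) = size (r (f a)) :=
      total_congr fun k hk => by
        rw [← Nat.add_assoc]
        exact write_add hk
    have e₄ : total w (fun k => st 0 (f a) (r (f a)) (b + w + (1 + 1 + (w + k)))) = 0 := by
      rw [← total_nil w]
      refine total_congr fun k hk => ?_
      simp only [st]
      rw [write_of_ge (by omega), update_of_ne (by omega), update_of_ne (by omega),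
        hb _ (by omega)]
    rw [e₁, e₂, e₃, e₄]
    simp [U]
  rw [t₃]
  have t₄ : total w (rep (r (f a))) = size (r (f a)) := rfl
  rw [t₄]
  have t₅ : f a * (D.eval (size a) + 1) ≤ P.eval (size a) * (D.eval (size a) + 1) :=
    Nat.mul_le_mul_right _ (by rw [← size_nat (f a)]; exact t₁)
  have t₆ : size (r (f a)) ≤ B.eval (size a) := t₂
  rw [size_nat] at t₁
  simp only [Polynomial.eval_add, Polynomial.eval_mul, Polynomial.eval_ofNat, Polynomial.eval_C,
    Polynomial.eval_one]
  omega

end PT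

end StackLang

/-! ### A library of polynomial-time functions -/

namespace StackLang

open Layout (width rep)

variable {O : Oracle} {α β γ δ : Type} [Layout α] [Layout β] [Layout γ] [Layout δ]

namespace PT

theorem exists_bound {f : α → β} (hf : PT O f) :
    ∃ P : Polynomial ℕ, ∀ a, size (f a) ≤ P.eval (size a) :=
  hf.imp fun _ h => h.1

/-! #### Booleans -/

@[fun_prop]
theorem not {f : α → Bool} (hf : PT O f) : PT O fun a => !f a := by
  have : (fun a => !f a) = fun a => bif f a then false else true := by
    funext a; cases f a <;> rfl
  rw [this]; fun_prop

@[fun_prop]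
theorem and {f g : α → Bool} (hf : PT O f) (hg : PT O g) : PT O fun a => f a && g a := by
  have : (fun a => f a && g a) = fun a => bif f a then g a else false := by
    funext a; cases f a <;> rfl
  rw [this]; fun_prop

@[fun_prop]
theorem or {f g : α → Bool} (hf : PT O f) (hg : PT O g) : PT O fun a => f a || g a := by
  have : (fun a => f a || g a) = fun a => bif f a then true else g a := by
    funext a; cases f a <;> rfl
  rw [this]; fun_prop

/-! #### Natural numbers -/

@[fun_prop]
theorem succ {f : α → ℕ} (hf : PT O f) : PT O fun a => f a + 1 :=
  comp (g := fun n : ℕ => n + 1) (push_symbol (some true) _ rfl rfl fun _ => rfl) hf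

theorem pred {f : α → ℕ} (hf : PT O f) : PT O fun a => f a - 1 :=
  comp (g := fun n : ℕ => n - 1) (pop_symbol _ rfl rfl fun n => by cases n <;> rfl) hf

@[fun_prop]
theorem add {f g : α → ℕ} (hf : PT O f) (hg : PT O g) : PT O fun a => f a + g a := by
  have key : PT O fun x : ℕ × ℕ => (Nat.rec x.1 (fun _ n => n + 1) x.2 : ℕ) := by
    refine natRec (h := fun _ _ n => n + 1) (by fun_prop) (by fun_prop) (by fun_prop) .X ?_
    intro a n hn
    have : (Nat.rec a.1 (fun _ n => n + 1) n : ℕ) = a.1 + n := by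
      clear hn
      induction n with
      | zero => rfl
      | succ n ih => simp only [ih]; rfl
    simp only [this, size_prod, size_nat, Polynomial.eval_X]
    omega
  have e : ∀ x : ℕ × ℕ, (Nat.rec x.1 (fun _ n => n + 1) x.2 : ℕ) = x.1 + x.2 := by
    intro x
    induction x.2 with
    | zero => rfl
    | succ n ih => simp only [ih]; rfl
  simp only [e] at key
  exact key.comp (hf.pair hg)

@[fun_prop]
theorem sub {f g : α → ℕ} (hf : PT O f) (hg : PT O g) : PT O fun a => f a - g a := by
  have e : ∀ (x : ℕ × ℕ) (n : ℕ), (Nat.rec x.1 (fun _ n => n - 1) n : ℕ) = x.1 - n := by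
    intro x n
    induction n with
    | zero => rfl
    | succ n ih => simp only [ih]; rfl
  have key : PT O fun x : ℕ × ℕ => (Nat.rec x.1 (fun _ n => n - 1) x.2 : ℕ) := by
    refine natRec (h := fun _ _ n => n - 1) (by fun_prop) (by fun_prop)
      (pred (by fun_prop)) .X ?_
    intro a n hn
    simp only [e, size_prod, size_nat, Polynomial.eval_X]
    omega
  simp only [e] at key
  exact key.comp (hf.pair hg)

@[fun_prop]
theorem mul {f g : α → ℕ} (hf : PT O f) (hg : PT O g) : PT O fun a => f a * g a := by
  have e : ∀ (x : ℕ × ℕ) (n : ℕ), (Nat.rec 0 (fun _ n => n + x.1) n : ℕ) = x.1 * n := by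
    intro x n
    induction n with
    | zero => rfl
    | succ n ih => simp only [ih]; rfl
  have key : PT O fun x : ℕ × ℕ => (Nat.rec 0 (fun _ n => n + x.1) x.2 : ℕ) := by
    refine natRec (h := fun (x : ℕ × ℕ) _ n => n + x.1) (by fun_prop) (by fun_prop) (by fun_prop)
      (.X * .X) ?_
    intro a n hn
    simp only [e, size_prod, size_nat, Polynomial.eval_X, Polynomial.eval_mul]
    exact Nat.mul_le_mul (by omega) (by omega)
  simp only [e] at key
  exact key.comp (hf.pair hg)

theorem isZero : PT O fun n : ℕ => Nat.beq n 0 :=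
  test_symbol (fun x => x.isNone) _ rfl fun n => by cases n <;> rfl

@[fun_prop]
theorem ble {f g : α → ℕ} (hf : PT O f) (hg : PT O g) : PT O fun a => Nat.ble (f a) (g a) := by
  have : (fun a => Nat.ble (f a) (g a)) = fun a => Nat.beq (f a - g a) 0 := by
    funext a
    rw [Bool.eq_iff_iff, Nat.ble_eq, Nat.beq_eq]
    omega
  rw [this]
  exact isZero.comp (hf.sub hg)

@[fun_prop]
theorem beq {f g : α → ℕ} (hf : PT O f) (hg : PT O g) : PT O fun a => Nat.beq (f a) (g a) := by
  have : (fun a => Nat.beq (f a) (g a)) =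
      fun a => Nat.ble (f a) (g a) && Nat.ble (g a) (f a) := by
    funext a
    rw [Bool.eq_iff_iff, Bool.and_eq_true, Nat.ble_eq, Nat.ble_eq, Nat.beq_eq]
    omega
  rw [this]
  fun_prop

@[fun_prop]
theorem min {f g : α → ℕ} (hf : PT O f) (hg : PT O g) : PT O fun a => Min.min (f a) (g a) := by
  have : (fun a => Min.min (f a) (g a)) = fun a => f a - (f a - g a) := by
    funext a; omega
  rw [this]
  fun_prop

/-- Sums. -/
theorem sum_range {f : α → ℕ} {g : α → ℕ → ℕ} (hf : PT O f)
    (hg : PT O fun x : α × ℕ => g x.1 x.2) :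
    PT O fun a => ∑ i ∈ Finset.range (f a), g a i := by
  have e : ∀ (a : α) (n : ℕ), (Nat.rec 0 (fun i n => n + g a i) n : ℕ) =
      ∑ i ∈ Finset.range n, g a i := by
    intro a n
    induction n with
    | zero => rfl
    | succ n ih => rw [Finset.sum_range_succ, ← ih]
  obtain ⟨P, hP⟩ := hf.exists_bound
  obtain ⟨Q, hQ⟩ := hg.exists_bound
  have key : PT O fun a => (Nat.rec 0 (fun i n => n + g a i) (f a) : ℕ) := by
    refine natRec (h := fun a i n => n + g a i) (by fun_prop) (by fun_prop) (by fun_prop)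
      (P * Q.comp (.X + P)) ?_
    intro a n hn
    have h1 := hP a
    simp only [size_nat] at h1
    simp only [e, size_nat, Polynomial.eval_mul, Polynomial.eval_comp, Polynomial.eval_add,
      Polynomial.eval_X]
    refine le_trans (Finset.sum_le_card_nsmul _ _ (Q.eval (size a + P.eval (size a))) ?_) ?_
    · intro i hi
      have := (hQ (a, i)).trans (monotone_eval Q (show _ ≤ size a + P.eval (size a) by
        have := Finset.mem_range.1 hi
        simp only [size_prod, size_nat]
        omega))
      simpa using this
    · rw [Finset.card_range, smul_eq_mul]
      exact Nat.mul_le_mul_right _ (by omega)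
  simpa only [e] using key

end PT

end StackLang

/-! ### Words, minima and lists of numbers. -/

namespace StackLang

open Layout (width rep)

variable {O : Oracle} {α β γ δ : Type} [Layout α] [Layout β] [Layout γ] [Layout δ]

/-- Whether a word starts with a given symbol. -/
def headIs (x : Sym) (w : Word) : Bool := w.head? == some x

/-- The minimum of `g 0, …, g n`. -/
def minUpTo (g : ℕ → ℕ) (n : ℕ) : ℕ := Nat.rec (g 0) (fun i x => min x (g (i + 1))) n

theorem minUpTo_succ (g : ℕ → ℕ) (n : ℕ) :
    minUpTo g (n + 1) = min (minUpTo g n) (g (n + 1)) := rfl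

theorem minUpTo_le_iff (g : ℕ → ℕ) (n s : ℕ) : minUpTo g n ≤ s ↔ ∃ i ≤ n, g i ≤ s := by
  induction n with
  | zero => simp [minUpTo]
  | succ n ih =>
    rw [minUpTo_succ, min_le_iff, ih]
    constructor
    · rintro (⟨i, hi, h⟩ | h)
      exacts [⟨i, by omega, h⟩, ⟨n + 1, le_rfl, h⟩]
    · rintro ⟨i, hi, h⟩
      rcases Nat.lt_or_ge n i with h' | h'
      · obtain rfl : i = n + 1 := by omega
        exact Or.inr h
      · exact Or.inl ⟨i, h', h⟩

/-- Splits off the leading symbols `some true`, and counts them. -/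
def scan (w : Word) : ℕ × Word :=
  Nat.rec (0, w) (fun _ x => bif headIs (some true) x.2 then (x.1 + 1, x.2.tail) else x) w.length

/-- The word that represents a list of natural numbers. -/
def listWord (l : List ℕ) : Word :=
  l.flatMap fun n => List.replicate n (some true) ++ [some false]

/-- Once the leading block is used up, further rounds change nothing, so as many rounds as there are
symbols suffice. -/
theorem scan_replicate (n : ℕ) (w : Word) (hw : headIs (some true) w = false) :
    scan (List.replicate n (some true) ++ w) = (n, w) := by
  have key : ∀ k, (Nat.rec (0, List.replicate n (some true) ++ w)
      (fun _ x => bif headIs (some true) x.2 then (x.1 + 1, x.2.tail) else x) k : ℕ × Word) =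
      (min k n, List.replicate (n - k) (some true) ++ w) := by
    intro k
    induction k with
    | zero => simp
    | succ k ih =>
      simp only [ih]
      rcases Nat.lt_or_ge k n with h | h
      · obtain ⟨m, hm⟩ : ∃ m, n - k = m + 1 := ⟨n - k - 1, by omega⟩
        have e1 : min k n + 1 = min (k + 1) n := by omega
        have e2 : n - (k + 1) = m := by omega
        rw [hm, e1, e2]
        rfl
      · have e1 : min k n = min (k + 1) n := by omega
        have e2 : n - (k + 1) = 0 := by omega
        have e3 : n - k = 0 := by omega
        rw [e1, e2, e3]
        simp [hw]
  have := key (List.replicate n (some true) ++ w).length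
  unfold scan
  rw [this]
  simp

theorem scan_listWord (l : List ℕ) :
    scan (listWord l) = (l.headD 0, match l with | [] => [] | _ :: t => some false :: listWord t) := by
  cases l with
  | nil => rfl
  | cons n t =>
    have : listWord (n :: t) = List.replicate n (some true) ++ (some false :: listWord t) := by
      simp [listWord]
    rw [this, scan_replicate _ _ rfl]
    rfl

namespace PT

/-! #### Words -/

@[fun_prop]
theorem headIs (x : Sym) {f : α → Word} (hf : PT O f) : PT O fun a => headIs x (f a) :=
  comp (g := StackLang.headIs x) (test_symbol (fun y => y == some x) _ rfl fun _ => rfl) hf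

@[fun_prop]
theorem tail {f : α → Word} (hf : PT O f) : PT O fun a => (f a).tail :=
  comp (g := fun w : Word => w.tail) (pop_symbol _ rfl rfl fun _ => rfl) hf

@[fun_prop]
theorem cons (x : Sym) {f : α → Word} (hf : PT O f) : PT O fun a => x :: f a :=
  comp (g := fun w : Word => x :: w) (push_symbol x _ rfl rfl fun _ => rfl) hf

@[fun_prop]
theorem length {f : α → Word} (hf : PT O f) : PT O fun a => (f a).length :=
  comp (g := fun w : Word => w.length) (map_symbols (fun _ => some true) _ rfl rfl fun _ =>
    List.map_const.symm) hf

@[fun_prop]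
theorem drop {f : α → ℕ} {g : α → Word} (hf : PT O f) (hg : PT O g) :
    PT O fun a => (g a).drop (f a) := by
  have e : ∀ (x : ℕ × Word) (n : ℕ), (Nat.rec x.2 (fun _ w => w.tail) n : Word) = x.2.drop n := by
    intro x n
    induction n with
    | zero => rfl
    | succ n ih => simp only [ih]; rw [List.tail_drop]
  have key : PT O fun x : ℕ × Word => (Nat.rec x.2 (fun _ w => w.tail) x.1 : Word) := by
    refine natRec (h := fun (_ : ℕ × Word) _ (w : Word) => w.tail) (by fun_prop) (by fun_prop)
      (by fun_prop) .X ?_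
    intro a n hn
    simp only [e, size_prod, size_nat, size_word, Polynomial.eval_X, List.length_drop]
    omega
  simp only [e] at key
  exact key.comp (hf.pair hg)

/-- Recursion on words. -/
theorem foldr {f : α → Word} {g : α → β} {h : α → Sym → β → β} (hf : PT O f) (hg : PT O g)
    (hh : ∀ x, PT O fun y : α × β => h y.1 x y.2) (B : Polynomial ℕ)
    (hB : ∀ a w, w <:+ f a → size (w.foldr (h a) (g a)) ≤ B.eval (size a)) :
    PT O fun a => (f a).foldr (h a) (g a) := by
  -- Folding from the right is primitive recursion in which round `i` finds its symbol by dropping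
  -- all but the last `i + 1` symbols. The alphabet has three symbols, so `h` is only needed for
  -- three constant ones. The intermediate results are the folds of suffixes, as in `hB`.
  let h' : α → ℕ → β → β := fun a i x =>
    bif StackLang.headIs none ((f a).drop ((f a).length - (i + 1))) then h a none x else
    bif StackLang.headIs (some true) ((f a).drop ((f a).length - (i + 1))) then h a (some true) x
    else h a (some false) x
  have e : ∀ a, ∀ n ≤ (f a).length, (Nat.rec (g a) (h' a) n : β) =
      ((f a).drop ((f a).length - n)).foldr (h a) (g a) := by
    intro a n
    induction n with
    | zero => intro _; simp
    | succ n ih =>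
      intro hn
      have hlt : (f a).length - (n + 1) < (f a).length := by omega
      simp only [ih (by omega)]
      rw [List.drop_eq_getElem_cons hlt,
        show (f a).length - (n + 1) + 1 = (f a).length - n by omega, List.foldr_cons]
      simp only [h']
      rw [List.drop_eq_getElem_cons hlt]
      simp only [StackLang.headIs, List.head?_cons]
      rcases (f a)[(f a).length - (n + 1)] with _ | _ | _ <;> rfl
  have h₁ := hh none
  have h₂ := hh (some true)
  have h₃ := hh (some false)
  have key : PT O fun a => (Nat.rec (g a) (h' a) (f a).length : β) := by
    refine natRec (by fun_prop) hg ?_ B ?_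
    · simp only [h']
      fun_prop
    · intro a n hn
      rw [e a n hn]
      exact hB a _ (List.drop_suffix _ _)
  have e' : (fun a => (Nat.rec (g a) (h' a) (f a).length : β)) =
      fun a => (f a).foldr (h a) (g a) := by
    funext a
    rw [e a _ le_rfl, Nat.sub_self, List.drop_zero]
  rwa [e'] at key

/-! #### Bounded quantifiers and minima -/

theorem all_range {f : α → ℕ} {p : α → ℕ → Bool} (hf : PT O f)
    (hp : PT O fun x : α × ℕ => p x.1 x.2) : PT O fun a => (List.range (f a)).all (p a) := by
  have e : ∀ (a : α) (n : ℕ), (Nat.rec true (fun i b => b && p a i) n : Bool) =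
      (List.range n).all (p a) := by
    intro a n
    induction n with
    | zero => rfl
    | succ n ih => simp only [ih]; rw [List.range_succ, List.all_append]; simp
  have key : PT O fun a => (Nat.rec true (fun i b => b && p a i) (f a) : Bool) :=
    natRec (h := fun a i b => b && p a i) (by fun_prop) (by fun_prop) (by fun_prop) 1
      fun a n _ => by simpa using size_bool_le _
  simpa only [e] using key

theorem minUpTo {f : α → ℕ} {g : α → ℕ → ℕ} (hf : PT O f)
    (hg : PT O fun x : α × ℕ => g x.1 x.2) : PT O fun a => minUpTo (g a) (f a) := by
  have hg0 : PT O fun a => g a 0 := hg.comp (f := fun a => (a, 0)) (by fun_prop)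
  obtain ⟨P, hP⟩ := hg0.exists_bound
  refine natRec (h := fun a i x => Min.min x (g a (i + 1))) hf hg0 (by fun_prop) P ?_
  intro a n _
  refine le_trans ?_ (hP a)
  simp only [size_nat]
  exact (minUpTo_le_iff (g a) n _).2 ⟨0, by omega, le_rfl⟩

/-! #### Lists of natural numbers -/

theorem listWord : PT O StackLang.listWord :=
  map_symbols id _ rfl rfl fun _ => (List.map_id _).symm

theorem scan : PT O StackLang.scan := by
  refine natRec (h := fun _ _ (x : ℕ × Word) => bif StackLang.headIs (some true) x.2 then
    (x.1 + 1, x.2.tail) else x) (by fun_prop) (by fun_prop) (by fun_prop) .X ?_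
  intro w n _
  simp only [size_prod, size_nat, size_word, Polynomial.eval_X]
  induction n with
  | zero => simp
  | succ n ih =>
    have ih := ih (by omega)
    simp only
    generalize (Nat.rec _ _ n : ℕ × Word) = x at ih
    rcases x with ⟨k, _ | ⟨y, v⟩⟩
    · simpa [StackLang.headIs] using ih
    · cases hy : StackLang.headIs (some true) (y :: v)
      · simpa using ih
      · simp only [List.length_cons, cond_true, List.tail_cons] at ih ⊢
        omega

@[fun_prop]
theorem listHead {f : α → List ℕ} (hf : PT O f) : PT O fun a => (f a).headD 0 := by
  have : (fun l : List ℕ => l.headD 0) = fun l => (StackLang.scan (StackLang.listWord l)).1 := by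
    funext l; rw [scan_listWord]
  refine comp (g := fun l : List ℕ => l.headD 0) ?_ hf
  rw [this]
  exact (scan.comp listWord).fst

@[fun_prop]
theorem listTail {f : α → List ℕ} (hf : PT O f) : PT O fun a => (f a).tail := by
  have : PT O fun l : List ℕ => (StackLang.scan (StackLang.listWord l)).2.tail :=
    tail (scan.comp listWord).snd
  refine comp (g := fun l : List ℕ => l.tail) (this.congr_rep rfl fun l k _ => ?_) hf
  rw [scan_listWord]
  cases l <;> rfl

@[fun_prop]
theorem listCons {f : α → ℕ} {g : α → List ℕ} (hf : PT O f) (hg : PT O g) :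
    PT O fun a => f a :: g a := by
  have e : ∀ (l : List ℕ) (n : ℕ), (Nat.rec (some false :: StackLang.listWord l)
      (fun _ w => some true :: w) n : Word) = StackLang.listWord (n :: l) := by
    intro l n
    induction n with
    | zero => rfl
    | succ n ih => simp only [ih]; rfl
  have key : PT O fun x : ℕ × List ℕ => (Nat.rec (some false :: StackLang.listWord x.2)
      (fun _ w => some true :: w) x.1 : Word) := by
    refine natRec (h := fun _ _ (w : Word) => some true :: w) (by fun_prop)
      (cons _ (listWord.comp (by fun_prop))) (by fun_prop) (.X + 1) ?_
    intro x n hn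
    have h : (StackLang.listWord x.2).length = size x.2 :=
      (size_of_width_one (α := List ℕ) rfl x.2).symm
    have e' : (StackLang.listWord (n :: x.2)).length = n + 1 + (StackLang.listWord x.2).length := by
      simp only [StackLang.listWord, List.flatMap_cons, List.length_append, List.length_replicate,
        List.length_singleton]
    simp only [e, size_word, size_prod, size_nat, Polynomial.eval_add, Polynomial.eval_X,
      Polynomial.eval_one]
    omega
  exact comp (g := fun x : ℕ × List ℕ => x.1 :: x.2)
    (key.congr_rep rfl fun x k _ => by rw [e]; rfl) (hf.pair hg)

@[fun_prop]
theorem listDrop {f : α → ℕ} {g : α → List ℕ} (hf : PT O f) (hg : PT O g) :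
    PT O fun a => (g a).drop (f a) := by
  have e : ∀ (l : List ℕ) (n : ℕ), (Nat.rec l (fun _ w => w.tail) n : List ℕ) = l.drop n := by
    intro l n
    induction n with
    | zero => rfl
    | succ n ih => simp only [ih]; rw [List.tail_drop]
  have key : PT O fun x : ℕ × List ℕ => (Nat.rec x.2 (fun _ w => w.tail) x.1 : List ℕ) := by
    refine natRec (h := fun (_ : ℕ × List ℕ) _ (w : List ℕ) => w.tail) (by fun_prop) (by fun_prop)
      (by fun_prop) .X ?_
    intro x n hn
    simp only [e, size_prod, size_nat, size_natList, Polynomial.eval_X]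
    refine le_add_left (List.Sublist.sum_le_sum ?_ fun _ _ => Nat.zero_le _)
    exact (List.drop_sublist _ _).map _
  simp only [e] at key
  exact key.comp (hf.pair hg)

@[fun_prop]
theorem getD {f : α → ℕ} {g : α → List ℕ} (hf : PT O f) (hg : PT O g) :
    PT O fun a => (g a).getD (f a) 0 := by
  have : (fun a => (g a).getD (f a) 0) = fun a => ((g a).drop (f a)).headD 0 := by
    funext a
    simp [List.headD_eq_head?_getD, List.head?_drop, List.getD_eq_getElem?_getD]
  rw [this]
  fun_prop

@[fun_prop]
theorem listLength {f : α → List ℕ} (hf : PT O f) : PT O fun a => (f a).length := by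
  -- Each number is closed by exactly one `some false`, so counting these symbols gives the length.
  let h : List ℕ → Sym → ℕ → ℕ := fun _ x n => bif x == some false then n + 1 else n
  have e : ∀ l₀ l : List ℕ, (StackLang.listWord l).foldr (h l₀) 0 = l.length := by
    intro l₀ l
    induction l with
    | nil => rfl
    | cons n l ih =>
      have : StackLang.listWord (n :: l) =
          List.replicate n (some true) ++ (some false :: StackLang.listWord l) := by
        simp [StackLang.listWord]
      rw [this, List.foldr_append, List.foldr_cons, ih]
      clear this ih
      change _ = l.length + 1
      induction n with
      | zero => rfl
      | succ n ih => rw [List.replicate_succ, List.foldr_cons, ih]; rfl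
  have key : PT O fun l : List ℕ => (StackLang.listWord l).foldr (h l) 0 := by
    refine foldr listWord (const 0) (fun x => ?_) .X ?_
    · rcases x with _ | _ | _ <;> simp only [h] <;> fun_prop
    · intro l w hw
      have h1 : w.length ≤ size l := by
        rw [size_of_width_one (α := List ℕ) rfl l]
        exact hw.length_le
      refine le_trans ?_ (h1.trans (by simp))
      rw [size_nat]
      clear hw h1
      induction w with
      | nil => simp
      | cons x w ih =>
        rw [List.foldr_cons, List.length_cons]
        simp only [h] at ih ⊢
        cases x == some false <;> simp <;> omega
  simp only [e] at key
  exact comp (g := fun l : List ℕ => l.length) key hf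

theorem size_map_range_le (g : ℕ → ℕ) (l : List ℕ) (B : ℕ) (h : ∀ i ∈ l, g i ≤ B) :
    size (l.map g) ≤ l.length * (B + 1) := by
  rw [size_natList]
  refine (List.sum_le_card_nsmul _ (B + 1) ?_).trans (by simp)
  intro x hx
  simp only [List.mem_map] at hx
  obtain ⟨y, ⟨i, hi, rfl⟩, rfl⟩ := hx
  have := h i hi
  omega

theorem map_range {f : α → ℕ} {g : α → ℕ → ℕ} (hf : PT O f)
    (hg : PT O fun x : α × ℕ => g x.1 x.2) : PT O fun a => (List.range (f a)).map (g a) := by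
  -- Elements are prepended, so the list is built from its last element backwards.
  let h : α → ℕ → List ℕ → List ℕ := fun a i l => g a (f a - 1 - i) :: l
  have e : ∀ a, ∀ n ≤ f a, (Nat.rec [] (h a) n : List ℕ) =
      (List.range' (f a - n) n).map (g a) := by
    intro a n
    induction n with
    | zero => intro _; rfl
    | succ n ih =>
      intro hn
      simp only [ih (by omega)]
      rw [List.range'_succ, List.map_cons, show f a - (n + 1) + 1 = f a - n by omega]
      simp only [h]
      rw [show f a - 1 - n = f a - (n + 1) by omega]
  obtain ⟨P, hP⟩ := hf.exists_bound
  obtain ⟨Q, hQ⟩ := hg.exists_bound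
  have key : PT O fun a => (Nat.rec [] (h a) (f a) : List ℕ) := by
    refine natRec hf (const _) ?_ (P * (Q.comp (.X + P) + 1)) ?_
    · simp only [h]
      have : PT O fun x : α × ℕ × List ℕ => f x.1 - 1 - x.2.1 := by fun_prop
      fun_prop
    · intro a n hn
      rw [e a n hn]
      have h1 := hP a
      simp only [size_nat] at h1
      refine (size_map_range_le _ _ (Q.eval (size a + P.eval (size a))) ?_).trans ?_
      · intro i hi
        have h2 : i < f a := by
          have := List.mem_range'_1.1 hi
          omega
        have := (hQ (a, i)).trans (monotone_eval Q (show _ ≤ size a + P.eval (size a) by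
          simp only [size_prod, size_nat]
          omega))
        simpa using this
      · simp only [List.length_range', Polynomial.eval_mul, Polynomial.eval_comp,
          Polynomial.eval_add, Polynomial.eval_X, Polynomial.eval_one]
        exact Nat.mul_le_mul_right _ (by omega)
  have e' : (fun a => (Nat.rec [] (h a) (f a) : List ℕ)) = fun a => (List.range (f a)).map (g a) := by
    funext a
    rw [e a _ le_rfl, Nat.sub_self, List.range_eq_range']
  rwa [e'] at key

end PT

end StackLang

/-! ### The length of the output of a machine. -/

namespace StackLang

open Turing Function StateTransition

open Layout (width rep)

section OutputLength

variable {K : Type*} {Γ : K → Type*} {Λ σ : Type*}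

/-- A bound of the number of symbols that a statement pushes. -/
def pushes : TM2.Stmt Γ Λ σ → ℕ
  | .push _ _ q => pushes q + 1
  | .peek _ _ q => pushes q
  | .pop _ _ q => pushes q
  | .load _ q => pushes q
  | .branch _ q₁ q₂ => max (pushes q₁) (pushes q₂)
  | .goto _ => 0
  | .halt => 0

theorem length_stepAux_le [DecidableEq K] (q : TM2.Stmt Γ Λ σ) (v : σ) (S : ∀ k, List (Γ k))
    (k : K) : ((TM2.stepAux q v S).stk k).length ≤ (S k).length + pushes q := by
  induction q generalizing v S with
  | push k' f q ih =>
    refine (ih _ _).trans ?_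
    by_cases h : k = k'
    · subst h; simp [pushes]; omega
    · simp [pushes, h]
  | peek k' f q ih => exact ih _ _
  | pop k' f q ih =>
    refine (ih _ _).trans ?_
    by_cases h : k = k'
    · subst h; simp [pushes]
    · simp [pushes, h]
  | load f q ih => exact ih _ _
  | branch f q₁ q₂ ih₁ ih₂ =>
    have h₁ := ih₁ v S
    have h₂ := ih₂ v S
    simp only [TM2.stepAux, pushes]
    cases f v <;> simp only [cond_true, cond_false] <;> omega
  | goto f => simp [TM2.stepAux]
  | halt => simp [TM2.stepAux]

end OutputLength

/-- There are finitely many statements, and each pushes a bounded number of symbols. Hence a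
polynomial time bound for an oracle also bounds the size of its output polynomially, as `PT`
requires. -/
theorem exists_output_bound (M : FinTM2) : ∃ c : ℕ, ∀ (x : List (M.Γ M.k₀))
    (y : List (M.Γ M.k₁)) (t : ℕ), Nonempty (TM2OutputsInTime M x (some y) t) →
      y.length ≤ x.length + c * t := by
  let := M.ΛFin
  refine ⟨Finset.univ.sup fun l => pushes (M.m l), ?_⟩
  set c := Finset.univ.sup fun l => pushes (M.m l) with hc
  have key : ∀ (n : ℕ) (a b : M.Cfg), (flip bind M.step)^[n] (some a) = some b →
      (b.stk M.k₁).length ≤ (a.stk M.k₁).length + c * n := by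
    intro n
    induction n with
    | zero => rintro a b h; cases h; simp
    | succ n ih =>
      rintro ⟨l, v, S⟩ b h
      rw [Function.iterate_succ_apply] at h
      cases l with
      | none =>
        change (flip bind M.step)^[n] none = _ at h
        rw [iterate_bind_none] at h
        cases h
      | some l =>
        have h₁ := ih _ b h
        have h₂ := length_stepAux_le (M.m l) v S M.k₁
        have h₃ : pushes (M.m l) ≤ c := Finset.le_sup (f := fun l => pushes (M.m l))
          (Finset.mem_univ l)
        rw [Nat.mul_succ]
        refine h₁.trans ?_
        simp only at h₂ ⊢
        omega
  rintro x y t ⟨⟨⟨n, hn⟩, hnt⟩⟩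
  have h := key n _ _ hn
  rw [initList_eq, haltList_eq] at h
  simp only [update_self] at h
  have h' : ∀ k, (update (fun _ => []) M.k₀ x k : List (M.Γ k)).length ≤ x.length := by
    intro k
    by_cases hk : k = M.k₀
    · subst hk; simp
    · simp [hk]
  have h₁ := h' M.k₁
  have h'' : c * n ≤ c * t := Nat.mul_le_mul_left _ hnt
  omega

theorem PT.oracle_of_outputs {O : Oracle} {α β : Type} [Layout α] [Layout β]
    {ea : α → List (O.M.Γ O.M.k₀)} {eb : α → List (O.M.Γ O.M.k₁)} {f : α → β}
    (T : Polynomial ℕ)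
    (hM : ∀ a, Nonempty (TM2OutputsInTime O.M (ea a) (some (eb a)) (T.eval (ea a).length)))
    (hα : width α = 1) (hβ : width β = 1) (ha : ∀ a, (rep a 0).map O.cin = ea a)
    (hb : ∀ a, (eb a).map O.cout = rep (f a) 0) : PT O f := by
  obtain ⟨c, hc⟩ := exists_output_bound O.M
  refine PT.oracle T hM hα hβ ha hb (.X + .C c * T) fun a => ?_
  have h := hc _ _ _ (hM a)
  have h₁ : (ea a).length = size a := by rw [← ha, List.length_map, size_of_width_one hα]
  have h₂ : (eb a).length = size (f a) := by
    rw [size_of_width_one hβ, ← hb, List.length_map]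
  rw [h₁, h₂] at h
  simpa using h

/-! ### Comparing divisors -/

open Computability Apportionment

/-- The comparison of two multiples of divisors. -/
noncomputable def divisorLe (d : ℕ → ℝ) (q : ℕ × ℕ × ℕ × ℕ) : Bool :=
  @decide ((q.2.2.1 : ℝ) * d q.1 ≤ (q.2.2.2 : ℝ) * d q.2.1) (Classical.propDecidable _)

/-- Four natural numbers, represented by a single stack. -/
structure Quadruple where
  /-- the components -/
  val : ℕ × ℕ × ℕ × ℕ

instance : Layout Quadruple :=
  ⟨1, fun q _ => listWord [q.val.1, q.val.2.1, q.val.2.2.1, q.val.2.2.2]⟩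

theorem unaryEncodeNat_eq (n : ℕ) : unaryEncodeNat n = List.replicate n true := by
  induction n with
  | zero => rfl
  | succ n ih => rw [unaryEncodeNat, ih, List.replicate_succ]

/-- The given machine decides the very comparison needed; only the formats have to be matched.
Without `some`, the layout of a `Quadruple` is `encodeUnaryQuadruple`; the symbol `none` does not
occur, so its conversion is arbitrary. The answer comes back as a word of one symbol, whereas the
layout of `false` is the empty word; `headIs` converts between the two. -/
theorem exists_oracle_of_comparable {d : ℕ → ℝ} (h : PolyTimeComparable d) :
    ∃ O, PT O (divisorLe d) := by
  obtain ⟨h⟩ := h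
  let O : Oracle := ⟨h.tm, fun x => h.inputAlphabet.symm (x.getD false),
    fun y => some (h.outputAlphabet y)⟩
  refine ⟨O, ?_⟩
  have h₁ : PT O fun q : Quadruple => ([some (divisorLe d q.val)] : Word) := by
    refine PT.oracle_of_outputs (O := O)
      (ea := fun q => (encodeUnaryQuadruple q.val).map h.inputAlphabet.symm)
      (eb := fun q => [h.outputAlphabet.symm (divisorLe d q.val)]) h.time
      (fun q => ⟨?_⟩) rfl rfl (fun q => ?_) (fun q => ?_)
    · have h' := h.outputsFun q.val
      have e : divisorLe d q.val =
          decide ((q.val.2.2.1 : ℝ) * d q.val.1 ≤ (q.val.2.2.2 : ℝ) * d q.val.2.1) := by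
        simp [divisorLe]
      rw [List.length_map, e]
      exact h'
    · simp [rep, listWord, encodeUnaryQuadruple, unaryEncodeNat_eq, O]
    · simp [rep, O]
  have h₂ : PT O fun q : ℕ × ℕ × ℕ × ℕ => (⟨q⟩ : Quadruple) := by
    refine PT.congr_rep (f := fun q : ℕ × ℕ × ℕ × ℕ => [q.1, q.2.1, q.2.2.1, q.2.2.2])
      (by fun_prop) rfl fun q k _ => rfl
  have h₃ : PT O fun q : ℕ × ℕ × ℕ × ℕ => headIs (some true) [some (divisorLe d q)] :=
    (h₁.comp h₂).headIs _
  have e : ∀ q, headIs (some true) [some (divisorLe d q)] = divisorLe d q := by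
    intro q; cases divisorLe d q <;> rfl
  simpa only [e] using h₃

/-! #### Rational divisors -/

/-- The value of a sequence of digits to the base two. The digits may be arbitrarily large. -/
def digitSum (x : ℕ → ℕ) (n : ℕ) : ℕ := ∑ i ∈ Finset.range n, x i * 2 ^ i

/-- The carries of the comparison of two sequences of digits. -/
def carries (x y : ℕ → ℕ) (n : ℕ) : ℕ × ℕ :=
  Nat.rec (0, 0) (fun i c => ((x i + c.1 - (y i + c.2) + 1) / 2, (y i + c.2 - (x i + c.1)) / 2)) n

/-- Remove the lowest digits together with their carries, `u` on the left and `v` on the right. Then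
`u + 2 * A ≤ v + 2 * B` is equivalent to `A + ⌈(u - v) / 2⌉ ≤ B` if `v ≤ u`, and to `A ≤ B + ⌊(v -
u) / 2⌋` otherwise. Truncated subtraction makes the other carry vanish in each case. -/
theorem digitSum_le_iff (x y : ℕ → ℕ) (n m : ℕ) :
    digitSum x (n + m) ≤ digitSum y (n + m) ↔
      digitSum (fun i => x (n + i)) m + (carries x y n).1 ≤
        digitSum (fun i => y (n + i)) m + (carries x y n).2 := by
  induction n generalizing m with
  | zero => simp [carries]
  | succ n ih =>
    rw [show n + 1 + m = n + (m + 1) by omega, ih (m + 1)]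
    have e : ∀ z : ℕ → ℕ, digitSum (fun i => z (n + i)) (m + 1) =
        z n + 2 * digitSum (fun i => z (n + 1 + i)) m := by
      intro z
      simp only [digitSum]
      rw [Finset.sum_range_succ', Finset.mul_sum, Nat.add_zero, pow_zero, mul_one, add_comm]
      congr 1
      refine Finset.sum_congr rfl fun i _ => ?_
      rw [show n + 1 + i = n + (i + 1) by omega, pow_succ]
      ring
    rw [e x, e y]
    have hc : carries x y (n + 1) = ((x n + (carries x y n).1 - (y n + (carries x y n).2) + 1) / 2,
      (y n + (carries x y n).2 - (x n + (carries x y n).1)) / 2) := rfl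
    rw [hc]
    simp only
    omega

/-- The carries are bounded by sums of digits without the powers of two, so they stay small enough
for unary arithmetic although the numbers compared may be exponentially large. -/
theorem carries_le (x y : ℕ → ℕ) (n : ℕ) :
    (carries x y n).1 ≤ ∑ i ∈ Finset.range n, x i ∧
    (carries x y n).2 ≤ ∑ i ∈ Finset.range n, y i := by
  induction n with
  | zero => simp [carries]
  | succ n ih =>
    rw [Finset.sum_range_succ, Finset.sum_range_succ]
    change (x n + (carries x y n).1 - (y n + (carries x y n).2) + 1) / 2 ≤ _ ∧
      (y n + (carries x y n).2 - (x n + (carries x y n).1)) / 2 ≤ _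
    omega

/-- The digits of a product. -/
def convolve (x y : ℕ → ℕ) (k : ℕ) : ℕ := ∑ i ∈ Finset.range (k + 1), x i * y (k - i)

/-- A digit sum is the value at `2` of the polynomial with these digits as coefficients, and
convolution is multiplication of polynomials. The product has degree below `n + n`, so no digit is
lost. -/
theorem digitSum_convolve {x y : ℕ → ℕ} {n : ℕ} (hx : ∀ i, n ≤ i → x i = 0)
    (hy : ∀ i, n ≤ i → y i = 0) :
    digitSum (convolve x y) (n + n) = digitSum x n * digitSum y n := by
  rcases Nat.eq_zero_or_pos n with rfl | hn
  · simp [digitSum]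
  let p : (ℕ → ℕ) → Polynomial ℕ := fun z => ∑ i ∈ Finset.range n, Polynomial.monomial i (z i)
  have hcoeff : ∀ z : ℕ → ℕ, (∀ i, n ≤ i → z i = 0) → ∀ k, (p z).coeff k = z k := by
    intro z hz k
    simp only [p, Polynomial.finsetSum_coeff, Polynomial.coeff_monomial]
    rw [Finset.sum_ite_eq' (Finset.range n) k z]
    split_ifs with h
    · rfl
    · exact (hz k (by simpa using h)).symm
  have heval : ∀ z : ℕ → ℕ, (p z).eval 2 = digitSum z n := by
    intro z
    simp [p, Polynomial.eval_finsetSum, digitSum]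
  rw [← heval x, ← heval y, ← Polynomial.eval_mul]
  rw [Polynomial.eval_eq_sum_range' (n := n + n)]
  · refine Finset.sum_congr rfl fun k _ => ?_
    rw [Polynomial.coeff_mul, Finset.Nat.sum_antidiagonal_eq_sum_range_succ_mk]
    simp only [hcoeff x hx, hcoeff y hy, convolve]
  · have hdeg : ∀ z, (p z).natDegree ≤ n - 1 := fun z =>
      Polynomial.natDegree_sum_le_of_forall_le _ _ fun i hi =>
        (Polynomial.natDegree_monomial_le _).trans (by have := Finset.mem_range.1 hi; omega)
    have h₁ := hdeg x
    have h₂ := hdeg y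
    have h₃ := Polynomial.natDegree_mul_le (p := p x) (q := p y)
    omega

theorem digitSum_mul_left (c : ℕ) (x : ℕ → ℕ) (n : ℕ) :
    digitSum (fun k => c * x k) n = c * digitSum x n := by
  simp only [digitSum, Finset.mul_sum, mul_assoc]

theorem digitSum_add {x : ℕ → ℕ} {n : ℕ} (hx : ∀ i, n ≤ i → x i = 0) (m : ℕ) :
    digitSum x (n + m) = digitSum x n := by
  simp only [digitSum]
  rw [Finset.sum_range_add]
  simp [hx]

/-- A digit of a binary number. -/
def digit (w : Word) (k : ℕ) : ℕ := bif headIs (some true) (w.drop k) then 1 else 0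

theorem digit_eq_zero {w : Word} {k : ℕ} (h : w.length ≤ k) : digit w k = 0 := by
  rw [digit, List.drop_eq_nil_of_le h]; rfl

theorem digitSum_digit_bits (a : ℕ) (w : Word) :
    digitSum (digit (a.bits.map some ++ none :: w)) a.bits.length = a := by
  induction a using Nat.binaryRec' with
  | zero => rfl
  | bit b n h ih =>
    rw [Nat.bits_append_bit n b h, List.map_cons, List.cons_append, List.length_cons]
    simp only [digitSum] at ih ⊢
    rw [Finset.sum_range_succ', Nat.bit_val]
    have e : ∀ k, digit (some b :: (n.bits.map some ++ none :: w)) (k + 1) * 2 ^ (k + 1) =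
        2 * (digit (n.bits.map some ++ none :: w) k * 2 ^ k) := by
      intro k
      simp only [digit, List.drop_succ_cons, pow_succ]
      ring
    simp only [e]
    rw [← Finset.mul_sum, ih]
    cases b <;> simp [digit, headIs]

/-- The position of the first separator. -/
def prefixLength (w : Word) : ℕ := w.foldr (fun x n => bif x.isNone then 0 else n + 1) 0

theorem prefixLength_le (w : Word) : prefixLength w ≤ w.length := by
  induction w with
  | nil => rfl
  | cons x w ih =>
    simp only [prefixLength, List.foldr_cons, List.length_cons] at ih ⊢
    cases x.isNone <;> simp <;> omega

theorem prefixLength_append (l : List Bool) (w : Word) :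
    prefixLength (l.map some ++ none :: w) = l.length := by
  induction l with
  | nil => rfl
  | cons x l ih =>
    simp only [prefixLength, List.foldr_cons, List.length_cons, List.map_cons,
      List.cons_append] at ih ⊢
    rw [ih]; rfl

/-- The digits of the first number in a word. -/
def firstDigit (w : Word) (k : ℕ) : ℕ := bif Nat.ble (k + 1) (prefixLength w) then digit w k else 0

/-- The digits of the second number in a word. -/
def secondDigit (w : Word) (k : ℕ) : ℕ := digit w (prefixLength w + 1 + k)

theorem firstDigit_eq_zero {w : Word} {k : ℕ} (h : w.length ≤ k) : firstDigit w k = 0 := by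
  rw [firstDigit, digit_eq_zero h]; simp

theorem secondDigit_eq_zero {w : Word} {k : ℕ} (h : w.length ≤ k) : secondDigit w k = 0 :=
  digit_eq_zero (by omega)

theorem digitSum_firstDigit (a b n : ℕ) (hn : (encodeNumbers [a, b]).length ≤ n) :
    digitSum (firstDigit (encodeNumbers [a, b])) n = a := by
  have e : encodeNumbers [a, b] = a.bits.map some ++ none :: (b.bits.map some ++ [none]) := by
    simp [encodeNumbers, encodeNumber]
  have hp : prefixLength (encodeNumbers [a, b]) = a.bits.length := by rw [e, prefixLength_append]
  have hle := prefixLength_le (encodeNumbers [a, b])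
  rw [hp] at hle
  obtain ⟨m, rfl⟩ := Nat.exists_eq_add_of_le (hle.trans hn)
  rw [digitSum_add]
  · conv_rhs => rw [← digitSum_digit_bits a (b.bits.map some ++ [none]), ← e]
    refine Finset.sum_congr rfl fun k hk => ?_
    rw [firstDigit, hp, Nat.ble_eq_true_of_le (by simpa using hk)]
    rfl
  · intro i hi
    rw [firstDigit, hp]
    have : Nat.ble (i + 1) a.bits.length = false := by
      rw [Bool.eq_false_iff, ne_eq, Nat.ble_eq]; omega
    rw [this]; rfl

theorem digitSum_secondDigit (a b n : ℕ) (hn : (encodeNumbers [a, b]).length ≤ n) :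
    digitSum (secondDigit (encodeNumbers [a, b])) n = b := by
  have e : encodeNumbers [a, b] = a.bits.map some ++ none :: (b.bits.map some ++ [none]) := by
    simp [encodeNumbers, encodeNumber]
  have hp : prefixLength (encodeNumbers [a, b]) = a.bits.length := by rw [e, prefixLength_append]
  have hlen : (encodeNumbers [a, b]).length = a.bits.length + 1 + (b.bits.length + 1) := by
    rw [e]; simp; omega
  obtain ⟨m, rfl⟩ := Nat.exists_eq_add_of_le (show b.bits.length ≤ n by omega)
  have hd : ∀ k, secondDigit (encodeNumbers [a, b]) k = digit (b.bits.map some ++ none :: []) k := by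
    intro k
    rw [secondDigit, hp, digit, e]
    rw [← List.drop_drop]
    have : (a.bits.map some ++ none :: (b.bits.map some ++ [none])).drop (a.bits.length + 1) =
        b.bits.map some ++ [none] := by
      rw [List.drop_append]
      simp
    rw [this]
    rfl
  rw [digitSum_add]
  · conv_rhs => rw [← digitSum_digit_bits b []]
    exact Finset.sum_congr rfl fun k _ => by rw [hd]
  · intro i hi
    rw [hd, digit]
    rw [List.drop_append, List.drop_eq_nil_of_le (by simpa using hi), List.nil_append]
    rcases i - (b.bits.map some).length with _ | k <;> simp [headIs]

namespace PT

variable {O : Oracle} {α : Type} [Layout α]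

-- Division by two satisfies `(n + 1) / 2 = n - n / 2`, which is a primitive recursion.
@[fun_prop]
theorem half {f : α → ℕ} (hf : PT O f) : PT O fun a => f a / 2 := by
  have e : ∀ n : ℕ, (Nat.rec 0 (fun i x => i - x) n : ℕ) = n / 2 := by
    intro n
    induction n with
    | zero => rfl
    | succ n ih => simp only [ih]; omega
  have key : PT O fun n : ℕ => (Nat.rec 0 (fun i x => i - x) n : ℕ) := by
    refine natRec (h := fun _ i x => i - x) (by fun_prop) (by fun_prop) (by fun_prop) .X ?_
    intro m n hn
    simp only [e, size_nat, Polynomial.eval_X]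
    omega
  simp only [e] at key
  exact comp (g := fun n : ℕ => n / 2) key hf

@[fun_prop]
theorem digit {f : α → Word} {g : α → ℕ} (hf : PT O f) (hg : PT O g) :
    PT O fun a => digit (f a) (g a) := by
  unfold StackLang.digit
  fun_prop

@[fun_prop]
theorem prefixLength {f : α → Word} (hf : PT O f) : PT O fun a => prefixLength (f a) := by
  refine comp (g := StackLang.prefixLength) ?_ hf
  refine foldr (h := fun _ x n => bif x.isNone then 0 else n + 1) (by fun_prop) (by fun_prop)
    (fun x => by cases x.isNone <;> simp only [cond_true, cond_false] <;> fun_prop) .X ?_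
  intro w v hv
  simp only [size_nat, size_word, Polynomial.eval_X]
  exact (prefixLength_le v).trans hv.length_le

@[fun_prop]
theorem firstDigit {f : α → Word} {g : α → ℕ} (hf : PT O f) (hg : PT O g) :
    PT O fun a => firstDigit (f a) (g a) := by
  unfold StackLang.firstDigit
  fun_prop

@[fun_prop]
theorem secondDigit {f : α → Word} {g : α → ℕ} (hf : PT O f) (hg : PT O g) :
    PT O fun a => secondDigit (f a) (g a) := by
  unfold StackLang.secondDigit
  fun_prop

theorem convolve {x y : α → ℕ → ℕ} {f : α → ℕ} (hx : PT O fun z : α × ℕ => x z.1 z.2)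
    (hy : PT O fun z : α × ℕ => y z.1 z.2) (hf : PT O f) :
    PT O fun a => convolve (x a) (y a) (f a) := by
  refine sum_range (g := fun a i => x a i * y a (f a - i)) (by fun_prop) ?_
  have : PT O fun z : α × ℕ => f z.1 - z.2 := by fun_prop
  fun_prop

theorem carries {x y : α → ℕ → ℕ} {f : α → ℕ} (hx : PT O fun z : α × ℕ => x z.1 z.2)
    (hy : PT O fun z : α × ℕ => y z.1 z.2) (hf : PT O f) :
    PT O fun a => carries (x a) (y a) (f a) := by
  obtain ⟨P, hP⟩ := (sum_range hf hx).exists_bound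
  obtain ⟨Q, hQ⟩ := (sum_range hf hy).exists_bound
  refine natRec (h := fun a i (c : ℕ × ℕ) => ((x a i + c.1 - (y a i + c.2) + 1) / 2,
    (y a i + c.2 - (x a i + c.1)) / 2)) hf (const (0, 0)) (by fun_prop) (P + Q) ?_
  intro a n hn
  have h := carries_le (x a) (y a) n
  have h₁ := hP a
  have h₂ := hQ a
  have h₃ : ∀ z : ℕ → ℕ, ∑ i ∈ Finset.range n, z i ≤ ∑ i ∈ Finset.range (f a), z i := fun z =>
    Finset.sum_le_sum_of_subset (Finset.range_mono hn)
  have h₄ := h₃ (x a)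
  have h₅ := h₃ (y a)
  change size (StackLang.carries (x a) (y a) n) ≤ _
  simp only [size_prod, size_nat, Polynomial.eval_add] at h₁ h₂ ⊢
  omega

end PT

/-- Clearing denominators, `x * d i ≤ y * d j` becomes `x * (a i * b j) ≤ y * (a j * b i)`. Both
sides are digit sums of convolutions, scaled digitwise by the unary numbers `x` and `y`, and are
compared through their carries. -/
theorem exists_oracle_of_rational {d : ℕ → ℝ} (hd : ∀ i, 0 < d i) (h : PolyTimeRational d) :
    ∃ O, PT O (divisorLe d) := by
  obtain ⟨a, b, hab, ⟨h⟩⟩ := h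
  have hb : ∀ i, 0 < b i := by
    intro i
    rcases Nat.eq_zero_or_pos (b i) with h0 | h0
    -- Division by zero gives zero, which contradicts `0 < d i`.
    · have := hd i
      rw [hab, h0] at this
      simp at this
    · exact h0
  let O : Oracle := ⟨h.tm, fun x => h.inputAlphabet.symm (x.getD false), h.outputAlphabet⟩
  refine ⟨O, ?_⟩
  let out : ℕ → Word := fun i => encodeNumbers [a i, b i]
  have hout : PT O out := by
    refine PT.oracle_of_outputs (O := O)
      (ea := fun n => (unaryEncodeNat n).map h.inputAlphabet.symm)
      (eb := fun n => (out n).map h.outputAlphabet.symm) h.time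
      (fun n => ⟨?_⟩) rfl rfl (fun n => ?_) (fun n => ?_)
    · have h' := h.outputsFun n
      rw [List.length_map]
      exact h'
    · simp [rep, unaryEncodeNat_eq, O]
    · simp [rep, O]
  have hout' : ∀ {f : ℕ × ℕ × ℕ × ℕ → ℕ}, PT O f → PT O fun q => out (f q) := fun hf =>
    hout.comp hf
  let N : ℕ × ℕ × ℕ × ℕ → ℕ := fun q => (out q.1).length + (out q.2.1).length
  let X : ℕ × ℕ × ℕ × ℕ → ℕ → ℕ := fun q k =>
    q.2.2.1 * convolve (firstDigit (out q.1)) (secondDigit (out q.2.1)) k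
  let Y : ℕ × ℕ × ℕ × ℕ → ℕ → ℕ := fun q k =>
    q.2.2.2 * convolve (firstDigit (out q.2.1)) (secondDigit (out q.1)) k
  have hX : PT O fun z : (ℕ × ℕ × ℕ × ℕ) × ℕ => X z.1 z.2 := by
    refine PT.mul (by fun_prop) (PT.convolve
      (x := fun z : (ℕ × ℕ × ℕ × ℕ) × ℕ => firstDigit (out z.1.1))
      (y := fun z : (ℕ × ℕ × ℕ × ℕ) × ℕ => secondDigit (out z.1.2.1)) ?_ ?_ (by fun_prop))
    · exact PT.firstDigit (hout.comp (by fun_prop)) (by fun_prop)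
    · exact PT.secondDigit (hout.comp (by fun_prop)) (by fun_prop)
  have hY : PT O fun z : (ℕ × ℕ × ℕ × ℕ) × ℕ => Y z.1 z.2 := by
    refine PT.mul (by fun_prop) (PT.convolve
      (x := fun z : (ℕ × ℕ × ℕ × ℕ) × ℕ => firstDigit (out z.1.2.1))
      (y := fun z : (ℕ × ℕ × ℕ × ℕ) × ℕ => secondDigit (out z.1.1)) ?_ ?_ (by fun_prop))
    · exact PT.firstDigit (hout.comp (by fun_prop)) (by fun_prop)
    · exact PT.secondDigit (hout.comp (by fun_prop)) (by fun_prop)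
  have hN : PT O fun q => N q + N q := by
    have : PT O N := PT.add (PT.length (hout.comp (by fun_prop)))
      (PT.length (hout.comp (by fun_prop)))
    fun_prop
  have hc := PT.carries hX hY hN
  have key : PT O fun q => Nat.ble (carries (X q) (Y q) (N q + N q)).1
      (carries (X q) (Y q) (N q + N q)).2 := hc.fst.ble hc.snd
  have e : ∀ q, Nat.ble (carries (X q) (Y q) (N q + N q)).1
      (carries (X q) (Y q) (N q + N q)).2 = divisorLe d q := by
    rintro ⟨i, j, x, y⟩
    have hX' : digitSum (X (i, j, x, y)) (N (i, j, x, y) + N (i, j, x, y)) = x * (a i * b j) := by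
      simp only [X]
      rw [digitSum_mul_left, digitSum_convolve, digitSum_firstDigit, digitSum_secondDigit]
      · simp [N, out]
      · simp [N, out]
      · exact fun k hk => firstDigit_eq_zero (by simp only [N] at hk; omega)
      · exact fun k hk => secondDigit_eq_zero (by simp only [N] at hk; omega)
    have hY' : digitSum (Y (i, j, x, y)) (N (i, j, x, y) + N (i, j, x, y)) = y * (a j * b i) := by
      simp only [Y]
      rw [digitSum_mul_left, digitSum_convolve, digitSum_firstDigit, digitSum_secondDigit]
      · simp [N, out]
      · simp [N, out]
      · exact fun k hk => firstDigit_eq_zero (by simp only [N] at hk; omega)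
      · exact fun k hk => secondDigit_eq_zero (by simp only [N] at hk; omega)
    -- After all `N + N` digits nothing is left but the carries, whose comparison is the answer.
    have h0 := digitSum_le_iff (X (i, j, x, y)) (Y (i, j, x, y))
      (N (i, j, x, y) + N (i, j, x, y)) 0
    rw [Nat.add_zero, hX', hY'] at h0
    simp only [digitSum, Finset.range_zero, Finset.sum_empty, Nat.zero_add] at h0
    rw [Bool.eq_iff_iff, Nat.ble_eq, ← h0, divisorLe, @decide_eq_true_iff]
    have hbi : (0 : ℝ) < b i := by exact_mod_cast hb i
    have hbj : (0 : ℝ) < b j := by exact_mod_cast hb j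
    simp only
    rw [hab i, hab j, ← mul_div_assoc, ← mul_div_assoc, div_le_div_iff₀ hbi hbj]
    rw [← Nat.cast_le (α := ℝ)]
    push_cast
    rw [mul_assoc, mul_assoc]
  simpa only [e] using key

end StackLang

/-! ### The combinatorial characterization of successful campaigns -/

namespace StackLang

open Apportionment Finset

/-- The least total cost of `c 0 (y 0) + … + c (i - 1) (y (i - 1))` for `y 0 + … + y (i - 1) ≤ x`,
by dynamic programming. -/
def knapsack (c : ℕ → ℕ → ℕ) : ℕ → ℕ → ℕ
  | 0, _ => 0
  | i + 1, x => minUpTo (fun y => knapsack c i (x - y) + c i y) x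

/-- A distribution over `i + 1` items consists of the amount `z` spent on the last one and a
distribution of at most `x - z` over the others. -/
theorem knapsack_le_iff (c : ℕ → ℕ → ℕ) (i x s : ℕ) : knapsack c i x ≤ s ↔
    ∃ y : ℕ → ℕ, ∑ j ∈ range i, y j ≤ x ∧ ∑ j ∈ range i, c j (y j) ≤ s := by
  induction i generalizing x s with
  | zero => simp [knapsack]
  | succ i ih =>
    rw [knapsack, minUpTo_le_iff]
    constructor
    · rintro ⟨z, hz, h⟩
      obtain ⟨y, hy, hs⟩ := (ih (x - z) (s - c i z)).1 (by omega)
      refine ⟨Function.update y i z, ?_, ?_⟩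
      · rw [sum_range_succ, Function.update_self]
        rw [sum_congr rfl fun j hj => Function.update_of_ne (mem_range.1 hj).ne _ _]
        omega
      · rw [sum_range_succ, Function.update_self]
        rw [sum_congr rfl fun j hj => by rw [Function.update_of_ne (mem_range.1 hj).ne]]
        omega
    · rintro ⟨y, hy, hs⟩
      rw [sum_range_succ] at hy hs
      refine ⟨y i, by omega, ?_⟩
      have := (ih (x - y i) (s - c i (y i))).2 ⟨y, by omega, by omega⟩
      omega

/-- Spending nothing is always allowed. This bounds the table entries of the dynamic program. -/
theorem knapsack_le_sum (c : ℕ → ℕ → ℕ) (i x : ℕ) :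
    knapsack c i x ≤ ∑ j ∈ range i, c j 0 :=
  (knapsack_le_iff c i x _).2 ⟨fun _ => 0, by simp, le_rfl⟩

/-- Whether entry `j` of the fraction list of a party `P` with `z` votes comes before the entry
`ℓ - 1` of the fraction list of the party `p` with `t` votes. -/
noncomputable def ahead (d : ℕ → ℝ) (p ℓ t P z j : ℕ) : Bool :=
  !divisorLe d (ℓ - 1, j, z, t) || (Nat.ble (P + 1) p && divisorLe d (j, ℓ - 1, t, z))

/-- The number of entries of the party `P` that come before the entry `ℓ - 1` of `p`, after the
removal of `y` of its `N P` votes. -/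
noncomputable def itemCost (d : ℕ → ℝ) (τ κ p ℓ t : ℕ) (N : ℕ → ℕ) (P y : ℕ) : ℕ :=
  bif Nat.beq P p then 0 else
    bif Nat.ble τ (N P - y) then
      ∑ j ∈ range κ, (bif ahead d p ℓ t P (N P - y) j then 1 else 0)
    else 0

/-! ### Seats and the entries that precede a given entry. -/

section Seats

open scoped Classical

variable {d : ℕ → ℝ} {m κ : ℕ}

theorem precedes_trans {σ : Fin m → ℕ} {x y z : Fin m × Fin κ} (h₁ : Precedes d σ x y)
    (h₂ : Precedes d σ y z) : Precedes d σ x z := by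
  rcases h₁ with h₁ | ⟨e₁, h₁⟩ <;> rcases h₂ with h₂ | ⟨e₂, h₂⟩
  · exact Or.inl (h₂.trans h₁)
  · exact Or.inl (e₂ ▸ h₁)
  · exact Or.inl (e₁ ▸ h₂)
  · refine Or.inr ⟨e₁.trans e₂, ?_⟩
    rcases h₁ with h₁ | ⟨f₁, h₁⟩ <;> rcases h₂ with h₂ | ⟨f₂, h₂⟩
    · exact Or.inl (h₁.trans h₂)
    · exact Or.inl (f₂ ▸ h₁)
    · exact Or.inl (f₁ ▸ h₂)
    · exact Or.inr ⟨f₁.trans f₂, h₁.trans h₂⟩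

/-- The values within a list decrease weakly; where they tie, as in a list of zeros, the position
decides. -/
theorem precedes_same_iff (hd : StrictMono d) (h0 : ∀ i, 0 < d i) (σ : Fin m → ℕ) (P : Fin m)
    (i j : Fin κ) : Precedes d σ (P, i) (P, j) ↔ i < j := by
  have hanti : ∀ {i j : Fin κ}, i ≤ j → fraction d σ (P, j) ≤ fraction d σ (P, i) := by
    intro i j hij
    exact div_le_div_of_nonneg_left (Nat.cast_nonneg _) (h0 _) (hd.monotone hij)
  constructor
  · rintro (h | ⟨-, h | ⟨-, h⟩⟩)
    · exact lt_of_not_ge fun hij => absurd h (not_lt.2 (hanti hij))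
    · exact absurd h (lt_irrefl _)
    · exact h
  · intro hij
    rcases (hanti hij.le).lt_or_eq with h | h
    · exact Or.inl h
    · exact Or.inr ⟨h.symm, Or.inr ⟨rfl, hij⟩⟩

/-- A party wins at least `ℓ` seats if and only if its entry `ℓ - 1` is served. -/
theorem le_seats_iff (hd : StrictMono d) (h0 : ∀ i, 0 < d i) (σ : Fin m → ℕ) (P : Fin m) {ℓ : ℕ}
    (h1 : 1 ≤ ℓ) (hℓ : ℓ ≤ κ) : ℓ ≤ seats d σ κ P ↔
      #{x : Fin m × Fin κ | Precedes d σ x (P, ⟨ℓ - 1, by omega⟩)} < κ := by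
  have hmono : ∀ i j : Fin κ, i ≤ j → #{x : Fin m × Fin κ | Precedes d σ x (P, i)} ≤
      #{x : Fin m × Fin κ | Precedes d σ x (P, j)} := by
    intro i j hij
    rcases hij.eq_or_lt with rfl | hij
    · exact le_rfl
    · refine card_le_card fun x hx => ?_
      simp only [mem_filter, mem_univ, true_and] at hx ⊢
      exact precedes_trans hx ((precedes_same_iff hd h0 σ P i j).2 hij)
  have hseats : seats d σ κ P =
      #{j : Fin κ | #{x : Fin m × Fin κ | Precedes d σ x (P, j)} < κ} := by
    unfold seats
    congr!
  rw [hseats]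
  constructor
  · intro h
    by_contra hcon
    have : #{j : Fin κ | #{x : Fin m × Fin κ | Precedes d σ x (P, j)} < κ} ≤ #(Iio (⟨ℓ - 1, by omega⟩ : Fin κ)) := by
      refine card_le_card fun j hj => ?_
      simp only [mem_filter, mem_univ, true_and] at hj
      rw [mem_Iio]
      refine lt_of_not_ge fun hle => hcon ((hmono _ _ hle).trans_lt hj)
    rw [Fin.card_Iio] at this
    simp only at this
    omega
  · intro h
    have : #(Iic (⟨ℓ - 1, by omega⟩ : Fin κ)) ≤ #{j : Fin κ | #{x : Fin m × Fin κ | Precedes d σ x (P, j)} < κ} := by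
      refine card_le_card fun j hj => ?_
      rw [mem_Iic] at hj
      simp only [mem_filter, mem_univ, true_and]
      exact (hmono _ _ hj).trans_lt h
    rw [Fin.card_Iic] at this
    simp only at this
    omega

/-- The number of entries of `P` with `y` votes that come before the entry `ℓ - 1` of `p` with
`t` votes. -/
noncomputable def numAhead (d : ℕ → ℝ) (κ p ℓ t P y : ℕ) : ℕ :=
  ∑ j ∈ range κ, (bif ahead d p ℓ t P y j then 1 else 0)

/-- Cross-multiplication by the positive divisors. A tie counts only for parties with a smaller
index than `p`. -/
theorem ahead_iff (h0 : ∀ i, 0 < d i) (p ℓ t P z j : ℕ) : ahead d p ℓ t P z j = true ↔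
    (t : ℝ) / d (ℓ - 1) < z / d j ∨ ((t : ℝ) / d (ℓ - 1) ≤ z / d j ∧ P < p) := by
  rw [div_lt_div_iff₀ (h0 _) (h0 _), div_le_div_iff₀ (h0 _) (h0 _)]
  simp only [ahead, divisorLe, Bool.or_eq_true, Bool.and_eq_true, Bool.not_eq_true',
    decide_eq_false_iff_not, decide_eq_true_iff, Nat.ble_eq, not_le]
  rw [and_comm, Nat.succ_le_iff]

/-- More votes raise every entry of the own list. This is the reason for giving all changed votes to
`p`. -/
theorem numAhead_mono (h0 : ∀ i, 0 < d i) {κ p ℓ t t' P y y' : ℕ} (ht : t' ≤ t) (hy : y ≤ y') :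
    numAhead d κ p ℓ t P y ≤ numAhead d κ p ℓ t' P y' := by
  refine sum_le_sum fun j _ => ?_
  have h : ahead d p ℓ t P y j = true → ahead d p ℓ t' P y' j = true := by
    rw [ahead_iff h0, ahead_iff h0]
    have h₁ : (t' : ℝ) / d (ℓ - 1) ≤ t / d (ℓ - 1) := by
      have := h0 (ℓ - 1)
      gcongr
    have h₂ : (y : ℝ) / d j ≤ y' / d j := by
      have := h0 j
      gcongr
    rintro (h | ⟨h, hP⟩)
    · exact Or.inl (h₁.trans_lt (h.trans_le h₂))
    · exact Or.inr ⟨h₁.trans (h.trans h₂), hP⟩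
  cases h' : ahead d p ℓ t P y j
  · simp
  · rw [h h']

/-- Every entry is zero and so lies strictly below the positive entry of `p`. A rival pushed below
the threshold, whose support is then zero, therefore costs nothing. -/
theorem numAhead_zero (h0 : ∀ i, 0 < d i) {κ p ℓ t P : ℕ} (ht : 1 ≤ t) :
    numAhead d κ p ℓ t P 0 = 0 := by
  refine sum_eq_zero fun j _ => ?_
  have : ahead d p ℓ t P 0 j = false := by
    rw [Bool.eq_false_iff, ne_eq, ahead_iff h0]
    have h : (0 : ℝ) < t / d (ℓ - 1) := div_pos (by exact_mod_cast ht) (h0 _)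
    rw [Nat.cast_zero, zero_div]
    rintro (h' | ⟨h', -⟩) <;> linarith
  rw [this]; rfl

/-- Count list by list: in its own list the entry is preceded by the `ℓ - 1` earlier ones, and in
the list of a rival by the entries that are `ahead`. -/
theorem card_precedes (hd : StrictMono d) (h0 : ∀ i, 0 < d i) (σ : Fin m → ℕ) (p : Fin m) {ℓ : ℕ}
    (h1 : 1 ≤ ℓ) (hℓ : ℓ ≤ κ) : 
    #{x : Fin m × Fin κ | Precedes d σ x (p, ⟨ℓ - 1, by omega⟩)} =
      (ℓ - 1) + ∑ P : Fin m, if P = p then 0 else numAhead d κ p ℓ (σ p) P (σ P) := by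
  have hsplit : #{x : Fin m × Fin κ | Precedes d σ x (p, ⟨ℓ - 1, by omega⟩)} =
      ∑ P : Fin m, #{j : Fin κ | Precedes d σ (P, j) (p, ⟨ℓ - 1, by omega⟩)} := by
    simp only [card_filter]
    rw [Fintype.sum_prod_type]
  have hp : #{j : Fin κ | Precedes d σ (p, j) (p, ⟨ℓ - 1, by omega⟩)} = ℓ - 1 := by
    have : ({j : Fin κ | Precedes d σ (p, j) (p, ⟨ℓ - 1, by omega⟩)} : Finset (Fin κ)) =
        Iio ⟨ℓ - 1, by omega⟩ := by
      ext j
      simp only [mem_filter, mem_univ, true_and, mem_Iio]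
      exact precedes_same_iff hd h0 σ p _ _
    rw [this, Fin.card_Iio]
  have hP : ∀ P : Fin m, P ≠ p →
      #{j : Fin κ | Precedes d σ (P, j) (p, ⟨ℓ - 1, by omega⟩)} =
        numAhead d κ p ℓ (σ p) P (σ P) := by
    intro P hne
    rw [card_filter, numAhead, sum_range]
    refine sum_congr rfl fun j _ => ?_
    have : Precedes d σ (P, j) (p, ⟨ℓ - 1, by omega⟩) ↔ ahead d p ℓ (σ p) P (σ P) j = true := by
      rw [ahead_iff h0]
      simp only [Precedes, fraction, hne, false_and, or_false]
      constructor
      · rintro (h | ⟨h, h'⟩)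
        exacts [Or.inl h, Or.inr ⟨h.ge, h'⟩]
      · rintro (h | ⟨h, h'⟩)
        · exact Or.inl h
        · rcases h.lt_or_eq with h | h
          exacts [Or.inl h, Or.inr ⟨h.symm, h'⟩]
    cases h : ahead d p ℓ (σ p) P (σ P) j
    · rw [if_neg (by rw [this, h]; simp)]; rfl
    · rw [if_pos (by rw [this, h])]; rfl
  rw [hsplit, ← sum_erase_add univ _ (mem_univ p), hp, add_comm]
  congr 1
  rw [← sum_erase_add univ (fun P => if P = p then 0 else _) (mem_univ p), if_pos rfl, add_zero]
  refine sum_congr rfl fun P hP' => ?_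
  rw [hP P (ne_of_mem_erase hP'), if_neg (ne_of_mem_erase hP')]

end Seats

end StackLang

/-! ### Successful campaigns and the knapsack problem -/

namespace StackLang

open Apportionment Finset

open scoped Classical

variable {d : ℕ → ℝ} {m n κ : ℕ}

theorem topChoices_eq (hm : 0 < m) (E : Election m n) (P : Fin m) :
    topChoices E P = #{v : Fin n | E v ⟨0, hm⟩ = P} := by
  unfold topChoices
  congr 1
  ext v
  simp only [mem_filter, mem_univ, true_and]
  rw [← Equiv.eq_symm_apply, eq_comm, Fin.ext_iff]

theorem topChoices_le (E : Election m n) (P : Fin m) : topChoices E P ≤ n :=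
  (card_filter_le _ _).trans (by simp)

/-- Against a zero entry, all `κ` entries of a party with a vote are ahead. Hence a party without
support wins no seat as soon as some other party has support. -/
theorem numAhead_of_unsupported (h0 : ∀ i, 0 < d i) {p ℓ P y : ℕ} (hy : 1 ≤ y) :
    numAhead d κ p ℓ 0 P y = κ := by
  have : ∀ j, ahead d p ℓ 0 P y j = true := by
    intro j
    rw [ahead_iff h0, Nat.cast_zero, zero_div]
    exact Or.inl (div_pos (by exact_mod_cast hy) (h0 _))
  simp [numAhead, this]

/-- The allocation is defined and gives `p` at least `ℓ` seats if and only if `p` is supported and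
at most `κ - ℓ` entries of other parties come before the entry `ℓ - 1` of `p`. -/
theorem exists_seatAllocation_iff (hd : StrictMono d) (h0 : ∀ i, 0 < d i) (E : Election m n)
    (hn : 0 < n) (τ : ℕ) (p : Fin m) {ℓ : ℕ} (h1 : 1 ≤ ℓ) (hℓ : ℓ ≤ κ) :
    (∃ α ∈ seatAllocation d E τ κ, ℓ ≤ α p) ↔ τ ≤ topChoices E p ∧ 1 ≤ topChoices E p ∧
      (∑ P : Fin m, if P = p then 0 else
        numAhead d κ p ℓ (topChoices E p) P (support E τ P)) + ℓ ≤ κ := by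
  have hseats := le_seats_iff hd h0 (support E τ) p h1 hℓ
  rw [card_precedes hd h0 _ p h1 hℓ] at hseats
  constructor
  · rintro ⟨α, hα, hℓα⟩
    unfold seatAllocation at hα
    split_ifs at hα with hdef
    swap
    · simp at hα
    obtain rfl : seats d (support E τ) κ = α := by simpa using hα
    have hcount := hseats.1 hℓα
    -- Some party has positive support: if the one reaching the threshold has no votes, then `τ =
    -- 0`, and the top choice of the first vote will do. If `p` had no support, all `κ` entries of
    -- that party would precede its entry.
    have hsupp : support E τ p ≠ 0 := by
      intro hzero
      have hQ : ∃ Q, 1 ≤ support E τ Q := by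
        obtain ⟨P, hP⟩ := hdef
        rcases Nat.eq_zero_or_pos (topChoices E P) with hP0 | hP0
        · have hm := P.pos
          refine ⟨E ⟨0, hn⟩ ⟨0, hm⟩, ?_⟩
          rw [support, if_pos (by omega), topChoices_eq hm, Nat.succ_le_iff, card_pos]
          exact ⟨⟨0, hn⟩, by simp⟩
        · exact ⟨P, by rwa [support, if_pos hP]⟩
      obtain ⟨Q, hQ⟩ := hQ
      have hQp : Q ≠ p := by rintro rfl; omega
      have hle := single_le_sum (f := fun P : Fin m => if P = p then 0 else
        numAhead d κ p ℓ (support E τ p) P (support E τ P)) (fun _ _ => Nat.zero_le _)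
        (mem_univ Q)
      simp only [hQp, if_false] at hle
      rw [hzero, numAhead_of_unsupported h0 hQ] at hle
      rw [hzero] at hcount
      omega
    have hτ : τ ≤ topChoices E p := by
      by_contra h
      exact hsupp (if_neg h)
    have hσ : support E τ p = topChoices E p := if_pos hτ
    rw [hσ] at hcount hsupp
    exact ⟨hτ, by omega, by omega⟩
  · rintro ⟨hτ, hpos, hsum⟩
    have hσ : support E τ p = topChoices E p := if_pos hτ
    refine ⟨seats d (support E τ) κ, ?_, ?_⟩
    · rw [seatAllocation, if_pos ⟨p, hτ⟩]; rfl
    · rw [hseats, hσ]; omega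

theorem itemCost_self (τ κ p ℓ t : ℕ) (N : ℕ → ℕ) (y : ℕ) : itemCost d τ κ p ℓ t N p y = 0 := by
  simp [itemCost]

theorem itemCost_of_ne {τ κ p ℓ t P : ℕ} (h : P ≠ p) (N : ℕ → ℕ) (y : ℕ) :
    itemCost d τ κ p ℓ t N P y = if τ ≤ N P - y then numAhead d κ p ℓ t P (N P - y) else 0 := by
  have : Nat.beq P p = false := by rwa [Bool.eq_false_iff, ne_eq, Nat.beq_eq]
  rw [itemCost, this]
  by_cases h : τ ≤ N P - y
  · rw [if_pos h, Nat.ble_eq_true_of_le h]; rfl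
  · have : Nat.ble τ (N P - y) = false := by rwa [Bool.eq_false_iff, ne_eq, Nat.ble_eq]
    rw [if_neg h, this]; rfl

/-- A changed vote gives `p` at most one vote and costs its former top choice at most one. Comparing
the changed election with the extreme case, in which `p` has `t` votes and every rival `P` has `N P
- y P`, only lowers the number of entries ahead. -/
theorem Successful.exists_deletion (hd : StrictMono d) (h0 : ∀ i, 0 < d i) (I : Instance)
    {N : ℕ → ℕ} (hN : ∀ P : Fin I.m, N P = topChoices I.E P) {τ t : ℕ}
    (ht : t = min (N I.pstar + I.K) I.n) (hτ : ∀ x ≤ I.n, τ ≤ x ↔ I.τ ≤ x)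
    (h : I.Successful d) : τ ≤ t ∧ 1 ≤ t ∧ ∃ y : ℕ → ℕ, ∑ P ∈ range I.m, y P ≤ I.K ∧
      ∑ P ∈ range I.m, itemCost d τ I.κ I.pstar I.ℓ t N P (y P) + I.ℓ ≤ I.κ := by
  obtain ⟨E', hK, hα⟩ := h
  have hm := I.pstar.pos
  have hn : 0 < I.n := (I.one_le_ℓ.trans I.ℓ_le_κ).trans I.κ_le_n
  obtain ⟨hτ', hpos, hsum⟩ :=
    (exists_seatAllocation_iff hd h0 E' hn I.τ I.pstar I.one_le_ℓ I.ℓ_le_κ).1 hα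
  set D : Finset (Fin I.n) := univ.filter fun v => E' v ≠ I.E v with hD
  have hgain : topChoices E' I.pstar ≤ t := by
    rw [ht, le_min_iff]
    refine ⟨?_, topChoices_le _ _⟩
    rw [hN, topChoices_eq hm, topChoices_eq hm]
    refine (card_le_card (t := univ.filter (fun v => I.E v ⟨0, hm⟩ = I.pstar) ∪ D)
      fun v hv => ?_).trans ((card_union_le _ _).trans (by omega))
    simp only [hD, mem_union, mem_filter, mem_univ, true_and] at hv ⊢
    by_cases hv' : E' v = I.E v
    · exact Or.inl (hv' ▸ hv)
    · exact Or.inr hv'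
  refine ⟨(hτ _ (by omega)).2 (hτ'.trans hgain), hpos.trans hgain,
    -- The changed votes are grouped by their original top choice. The group of `p` itself may be
    -- nonempty, but its item has cost zero.
    fun j => #{v ∈ D | (I.E v ⟨0, hm⟩ : ℕ) = j}, ?_, ?_⟩
  · rw [← card_eq_sum_card_fiberwise (fun v _ => by simp)]
    exact hK
  · refine le_trans (Nat.add_le_add_right ?_ _) hsum
    rw [sum_range]
    refine sum_le_sum fun P _ => ?_
    split_ifs with hP
    · rw [hP, itemCost_self]
    rw [itemCost_of_ne (fun h => hP (Fin.ext h)) N]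
    split_ifs with hle
    swap
    · exact Nat.zero_le _
    have hloss : N P - #{v ∈ D | (I.E v ⟨0, hm⟩ : ℕ) = P} ≤ topChoices E' P := by
      rw [hN, topChoices_eq hm, topChoices_eq hm, Nat.sub_le_iff_le_add]
      refine (card_le_card fun v hv => ?_).trans (card_union_le _ _)
      simp only [hD, mem_union, mem_filter, mem_univ, true_and] at hv ⊢
      by_cases hv' : E' v = I.E v
      · exact Or.inl (hv'.symm ▸ hv)
      · exact Or.inr ⟨hv', by rw [hv]⟩
    have hle' := (hτ _ ((Nat.sub_le _ _).trans ((hN P).trans_le (topChoices_le _ _)))).1 hle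
    rw [support, if_pos (hle'.trans hloss)]
    exact numAhead_mono h0 hgain hloss

/-- A set of votes to be changed in favor of `p`, which contains `y P` votes for every other
party `P`, as long as there are so many. -/
theorem exists_targets (E : Election m n) (p : Fin m) (hm : 0 < m) {y : ℕ → ℕ} {K : ℕ}
    (hy : ∑ P ∈ range m, y P ≤ K) : ∃ C : Finset (Fin n), (∀ v ∈ C, E v ⟨0, hm⟩ ≠ p) ∧
      #C = min K (n - topChoices E p) ∧ ∀ P ≠ p,
        #{v : Fin n | E v ⟨0, hm⟩ = P ∧ v ∉ C} ≤ topChoices E P - y P := by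
  have hS : ∀ P : Fin m, ∃ S ⊆ univ.filter (fun v : Fin n => E v ⟨0, hm⟩ = P),
      #S = min (y P) (topChoices E P) := fun P =>
    exists_subset_card_eq (by rw [topChoices_eq hm]; exact min_le_right _ _)
  choose S hS hcard using hS
  set A : Finset (Fin n) := univ.filter (fun v : Fin n => ¬ E v ⟨0, hm⟩ = p)
  have hA : #A = n - topChoices E p := by
    have := card_filter_add_card_filter_not (s := (univ : Finset (Fin n)))
      (fun v : Fin n => E v ⟨0, hm⟩ = p)
    rw [card_univ, Fintype.card_fin] at this
    rw [topChoices_eq hm, ← Nat.sub_eq_of_eq_add' this.symm]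
  have hBA : (univ.erase p).biUnion S ⊆ A := by
    intro v hv
    obtain ⟨P, hP, hv⟩ := mem_biUnion.1 hv
    have := mem_filter.1 (hS P hv)
    exact mem_filter.2 ⟨mem_univ _, fun h => (mem_erase.1 hP).1 (this.2.symm.trans h)⟩
  have hB : #((univ.erase p).biUnion S) ≤ K := by
    refine card_biUnion_le.trans (le_trans ?_ hy)
    rw [sum_range]
    refine (sum_le_sum fun P _ => ?_).trans (sum_le_sum_of_subset (erase_subset p univ))
    rw [hcard]
    exact min_le_left _ _
  -- The prescribed votes are padded with further votes not for `p` until the budget or the supply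
  -- of such votes is exhausted. Thus `p` gains the maximum possible.
  obtain ⟨C, hBC, hCA, hC⟩ := exists_subsuperset_card_eq hBA
    (n := min K (n - topChoices E p)) (le_min hB (hA ▸ card_le_card hBA))
    (hA ▸ min_le_right _ _)
  refine ⟨C, fun v hv => (mem_filter.1 (hCA hv)).2, hC, fun P hP => ?_⟩
  have hsub : (univ.filter fun v : Fin n => E v ⟨0, hm⟩ = P ∧ v ∉ C) ⊆
      univ.filter (fun v : Fin n => E v ⟨0, hm⟩ = P) \ S P := by
    intro v hv
    obtain ⟨-, hv, hvC⟩ := mem_filter.1 hv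
    exact mem_sdiff.2 ⟨mem_filter.2 ⟨mem_univ _, hv⟩, fun h =>
      hvC (hBC (mem_biUnion.2 ⟨P, mem_erase.2 ⟨hP, mem_univ _⟩, h⟩))⟩
  refine (card_le_card hsub).trans ?_
  rw [card_sdiff_of_subset (hS P), hcard, ← topChoices_eq hm]
  omega

/-- Changing the votes in `C` in favor of `p` gives it exactly `t` votes and leaves each rival with
at most `N P - y P`. Padding can only lower rivals further, which monotonicity allows; a rival
falling below the threshold contributes nothing. -/
theorem Successful.of_deletion (hd : StrictMono d) (h0 : ∀ i, 0 < d i) (I : Instance)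
    {N : ℕ → ℕ} (hN : ∀ P : Fin I.m, N P = topChoices I.E P) {τ t : ℕ}
    (ht : t = min (N I.pstar + I.K) I.n) (hτ : ∀ x ≤ I.n, τ ≤ x ↔ I.τ ≤ x)
    (hτt : τ ≤ t) (hpos : 1 ≤ t) {y : ℕ → ℕ} (hy : ∑ P ∈ range I.m, y P ≤ I.K)
    (hsum : ∑ P ∈ range I.m, itemCost d τ I.κ I.pstar I.ℓ t N P (y P) + I.ℓ ≤ I.κ) :
    I.Successful d := by
  have hm := I.pstar.pos
  have hn : 0 < I.n := (I.one_le_ℓ.trans I.ℓ_le_κ).trans I.κ_le_n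
  obtain ⟨C, hCp, hC, hdel⟩ := exists_targets I.E I.pstar hm hy
  have hNn := topChoices_le I.E I.pstar
  rw [hN] at ht
  -- Swapping `p` with the top choice keeps a changed vote a strict ranking.
  let E' : Election I.m I.n := fun v =>
    if v ∈ C then (I.E v).trans (Equiv.swap (I.E v ⟨0, hm⟩) I.pstar) else I.E v
  have htop : ∀ v, E' v ⟨0, hm⟩ = if v ∈ C then I.pstar else I.E v ⟨0, hm⟩ := by
    intro v
    simp only [E']
    split_ifs <;> simp
  have hgain : topChoices E' I.pstar = t := by
    have : (univ.filter fun v => E' v ⟨0, hm⟩ = I.pstar) =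
        univ.filter (fun v => I.E v ⟨0, hm⟩ = I.pstar) ∪ C := by
      ext v
      simp only [mem_union, mem_filter, mem_univ, true_and, htop]
      by_cases hv : v ∈ C <;> simp [hv]
    rw [topChoices_eq hm, this, card_union_of_disjoint, ← topChoices_eq hm, hC, ht]
    · omega
    · exact disjoint_left.2 fun v hv hvC => hCp v hvC (mem_filter.1 hv).2
  have hloss : ∀ P ≠ I.pstar, topChoices E' P ≤ N P - y P := by
    intro P hP
    rw [hN]
    refine le_trans ?_ (hdel P hP)
    rw [topChoices_eq hm]
    refine card_le_card fun v hv => ?_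
    simp only [mem_filter, mem_univ, true_and, htop] at hv ⊢
    by_cases hvC : v ∈ C
    · rw [if_pos hvC] at hv
      exact absurd hv.symm hP
    · rw [if_neg hvC] at hv
      exact ⟨hv, hvC⟩
  refine ⟨E', ?_, ?_⟩
  · refine (card_le_card fun v hv => ?_).trans (hC.trans_le (min_le_left _ _))
    by_contra hvC
    exact (mem_filter.1 hv).2 (if_neg hvC)
  rw [exists_seatAllocation_iff hd h0 E' hn I.τ I.pstar I.one_le_ℓ I.ℓ_le_κ, hgain]
  refine ⟨(hτ _ (by omega)).1 hτt, hpos, le_trans (Nat.add_le_add_right ?_ _) hsum⟩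
  rw [sum_range]
  refine sum_le_sum fun P _ => ?_
  split_ifs with hP
  · exact Nat.zero_le _
  rw [itemCost_of_ne (fun h => hP (Fin.ext h)) N, support]
  split_ifs with h₁ h₂
  · exact numAhead_mono h0 le_rfl (hloss P hP)
  · exact absurd ((hτ _ ((Nat.sub_le _ _).trans ((hN P).trans_le (topChoices_le _ _)))).2
      (h₁.trans (hloss P hP))) h₂
  all_goals rw [numAhead_zero h0 hpos]
  exact Nat.zero_le _

/-- The least possible number of rival entries ahead must be at most `κ - ℓ`. The threshold `τ` need
only agree with that of `I` on numbers up to `I.n`, which leaves room for the cut-off in the parser.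
-/
theorem successful_iff (hd : StrictMono d) (h0 : ∀ i, 0 < d i) (I : Instance)
    {N : ℕ → ℕ} (hN : ∀ P : Fin I.m, N P = topChoices I.E P) {τ t : ℕ}
    (ht : t = min (N I.pstar + I.K) I.n) (hτ : ∀ x ≤ I.n, τ ≤ x ↔ I.τ ≤ x) :
    I.Successful d ↔ τ ≤ t ∧ 1 ≤ t ∧
      knapsack (itemCost d τ I.κ I.pstar I.ℓ t N) I.m I.K + I.ℓ ≤ I.κ := by
  have hℓ := I.ℓ_le_κ
  have hiff := knapsack_le_iff (itemCost d τ I.κ I.pstar I.ℓ t N) I.m I.K (I.κ - I.ℓ)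
  constructor
  · intro h
    obtain ⟨h₁, h₂, y, hy, hs⟩ := Successful.exists_deletion hd h0 I hN ht hτ h
    have := hiff.2 ⟨y, hy, by omega⟩
    exact ⟨h₁, h₂, by omega⟩
  · rintro ⟨h₁, h₂, h₃⟩
    obtain ⟨y, hy, hs⟩ := hiff.1 (by omega)
    exact Successful.of_deletion hd h0 I hN ht hτ h₁ h₂ hy (by omega)

end StackLang

/-! ### The decision procedure and its running time -/

namespace StackLang

open Apportionment

/-- One step of the parser, which reads a word from right to left. The numbers are cut off
at `cap`. -/
def parseStep (cap : ℕ) : Sym → Bool × List ℕ → Bool × List ℕ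
  | none, s => (s.1, 0 :: s.2)
  | some b, s => (s.1 && (Nat.ble 1 s.2.length && (b || Nat.ble 1 (s.2.headD 0))),
      min (2 * s.2.headD 0 + bif b then 1 else 0) cap :: s.2.tail)

/-- Parses a list of natural numbers in binary; the Boolean tells whether this succeeds. -/
def parse (cap : ℕ) (w : Word) : Bool × List ℕ := w.foldr (parseStep cap) (true, [])

/-- The party at position `r` of the vote `v` in the list of numbers of an instance. -/
def vote (L : List ℕ) (v r : ℕ) : ℕ := L.getD (6 + v * L.getD 0 0 + r) 0

/-- The number of votes in the list of numbers of an instance. -/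
def numVotes (L : List ℕ) : ℕ :=
  ∑ i ∈ Finset.range (L.length - 6), bif Nat.ble ((i + 1) * L.getD 0 0) (L.length - 6) then 1 else 0

/-- Whether a list of numbers describes an instance. -/
def wellFormed (L : List ℕ) : Bool :=
  Nat.ble 6 L.length && Nat.ble (L.getD 3 0 + 1) (L.getD 0 0) &&
  Nat.beq L.length (6 + numVotes L * L.getD 0 0) && Nat.ble 1 (L.getD 4 0) &&
  Nat.ble (L.getD 4 0) (L.getD 2 0) && Nat.ble (L.getD 2 0) (numVotes L) &&
  Nat.ble (L.getD 5 0) (numVotes L) &&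
  (List.range (numVotes L)).all fun v => (List.range (L.getD 0 0)).all fun r =>
    Nat.ble (vote L v r + 1) (L.getD 0 0) &&
    (List.range r).all fun r' => !Nat.beq (vote L v r') (vote L v r)

/-- The number of top choices of `P` in the list of numbers of an instance. -/
def countTop (L : List ℕ) (P : ℕ) : ℕ :=
  ∑ v ∈ Finset.range (numVotes L), bif Nat.beq (vote L v 0) P then 1 else 0

/-- The largest number of top choices that the distinguished party can reach. -/
def target (L : List ℕ) : ℕ := min (countTop L (L.getD 3 0) + L.getD 5 0) (numVotes L)

/-- Whether the instance described by a list of numbers has a successful campaign. -/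
noncomputable def solve (d : ℕ → ℝ) (L : List ℕ) : Bool :=
  Nat.ble (L.getD 1 0) (target L) && Nat.ble 1 (target L) &&
  Nat.ble (knapsack (itemCost d (L.getD 1 0) (L.getD 2 0) (L.getD 3 0) (L.getD 4 0) (target L)
    (countTop L)) (L.getD 0 0) (L.getD 5 0) + L.getD 4 0) (L.getD 2 0)

/-- The decision procedure for apportionment bribery. -/
noncomputable def decideBribery (d : ℕ → ℝ) (w : Word) : Bool :=
  (parse (w.length + 1) w).1 && wellFormed (parse (w.length + 1) w).2 &&
    solve d (parse (w.length + 1) w).2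

theorem parse_bounds (cap : ℕ) (w : Word) :
    (parse cap w).2.length ≤ w.length ∧ ∀ a ∈ (parse cap w).2, a ≤ cap := by
  induction w with
  | nil => simp [parse]
  | cons x w ih =>
    rw [parse, List.foldr_cons, ← parse]
    rcases x with _ | b
    · simp only [parseStep, List.length_cons, List.mem_cons, forall_eq_or_imp]
      exact ⟨by omega, Nat.zero_le _, ih.2⟩
    · simp only [parseStep, List.length_cons, List.mem_cons, forall_eq_or_imp, List.length_tail]
      exact ⟨by omega, min_le_right _ _, fun a ha => ih.2 a (List.mem_of_mem_tail ha)⟩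

namespace PT

open Layout (width rep)

variable {O : Oracle} {α : Type} [Layout α]

theorem parse : PT O fun w : Word => parse (w.length + 1) w := by
  -- One symbol for the flag, and at most `X` numbers of size at most `X + 1`, each with its
  -- separator.
  refine foldr (h := fun (w : Word) => parseStep (w.length + 1)) (by fun_prop) (by fun_prop)
    ?_ (1 + .X * (.X + 2)) ?_
  · rintro (_ | _ | _) <;> simp only [parseStep, cond_true, cond_false] <;> fun_prop
  · intro w u hu
    obtain ⟨h₁, h₂⟩ := parse_bounds (w.length + 1) u
    have h₃ := size_bool_le (StackLang.parse (w.length + 1) u).1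
    have h₄ := size_map_range_le id (StackLang.parse (w.length + 1) u).2 _ h₂
    rw [List.map_id] at h₄
    have h₅ := Nat.mul_le_mul_right (w.length + 1 + 1) (h₁.trans hu.length_le)
    change size (StackLang.parse (w.length + 1) u) ≤ _
    simp only [size_prod, size_word, Polynomial.eval_add, Polynomial.eval_mul, Polynomial.eval_X,
      Polynomial.eval_one, Polynomial.eval_ofNat]
    linarith

/-- Instead of branching recursively, a whole row of values for all capacities up to `x a` is stored
as a list and replaced once per item. The entries are bounded by the cost of spending nothing. -/
theorem knapsack {c : α → ℕ → ℕ → ℕ} {f x : α → ℕ}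
    (hc : PT O fun y : α × ℕ × ℕ => c y.1 y.2.1 y.2.2) (hf : PT O f) (hx : PT O x) :
    PT O fun a => knapsack (c a) (f a) (x a) := by
  let h : α → ℕ → List ℕ → List ℕ := fun a i T => (List.range (x a + 1)).map fun z =>
    StackLang.minUpTo (fun y => T.getD (z - y) 0 + c a i y) z
  have hsum : PT O fun a => ∑ j ∈ Finset.range (f a), c a j 0 := by
    refine sum_range hf ?_
    exact hc.comp (f := fun y : α × ℕ => (y.1, y.2, 0)) (by fun_prop)
  obtain ⟨P, hP⟩ := hsum.exists_bound
  obtain ⟨Q, hQ⟩ := hx.exists_bound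
  have e : ∀ a n, (Nat.rec ((List.range (x a + 1)).map fun _ => 0) (h a) n : List ℕ) =
      (List.range (x a + 1)).map (StackLang.knapsack (c a) n) := by
    intro a n
    induction n with
    | zero => rfl
    | succ n ih =>
      simp only [ih, h]
      refine List.map_congr_left fun z hz => ?_
      rw [StackLang.knapsack]
      congr 1
      funext y
      have hz := List.mem_range.1 hz
      rw [List.getD_eq_getElem _ _ (by simp; omega), List.getElem_map, List.getElem_range]
  have key : PT O fun a =>
      (Nat.rec ((List.range (x a + 1)).map fun _ => 0) (h a) (f a) : List ℕ) := by
    refine natRec hf (map_range (by fun_prop) (by fun_prop)) ?_ ((Q + 1) * (P + 1)) ?_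
    · refine map_range (g := fun (y : α × ℕ × List ℕ) z =>
        StackLang.minUpTo (fun u => y.2.2.getD (z - u) 0 + c y.1 y.2.1 u) z) (by fun_prop) ?_
      refine minUpTo (g := fun (y : (α × ℕ × List ℕ) × ℕ) u =>
        y.1.2.2.getD (y.2 - u) 0 + c y.1.1 y.1.2.1 u) (by fun_prop) ?_
      have := hc.comp (f := fun y : ((α × ℕ × List ℕ) × ℕ) × ℕ => (y.1.1.1, y.1.1.2.1, y.2))
        (by fun_prop)
      fun_prop
    · intro a n hn
      rw [e]
      have h₁ := hP a
      have h₂ := hQ a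
      rw [size_nat] at h₁ h₂
      refine (size_map_range_le _ _ (P.eval (size a)) fun i _ => ?_).trans ?_
      · refine (knapsack_le_sum _ _ _).trans (le_trans ?_ h₁)
        exact Finset.sum_le_sum_of_subset (Finset.range_subset_range.2 hn)
      · simp only [List.length_range, Polynomial.eval_mul, Polynomial.eval_add,
          Polynomial.eval_one]
        exact Nat.mul_le_mul_right _ (by omega)
  simp only [e] at key
  have key' : PT O fun a =>
      ((List.range (x a + 1)).map (StackLang.knapsack (c a) (f a))).getD (x a) 0 := by fun_prop
  have e' : ∀ a, ((List.range (x a + 1)).map (StackLang.knapsack (c a) (f a))).getD (x a) 0 =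
      StackLang.knapsack (c a) (f a) (x a) := by
    intro a
    rw [List.getD_eq_getElem _ _ (by simp), List.getElem_map, List.getElem_range]
  simpa only [e'] using key'

@[fun_prop]
theorem numVotes {f : α → List ℕ} (hf : PT O f) : PT O fun a => numVotes (f a) := by
  refine comp (g := StackLang.numVotes) ?_ hf
  unfold StackLang.numVotes
  exact sum_range (by fun_prop) (by fun_prop)

@[fun_prop]
theorem vote {f : α → List ℕ} {v r : α → ℕ} (hf : PT O f) (hv : PT O v) (hr : PT O r) :
    PT O fun a => vote (f a) (v a) (r a) := by
  unfold StackLang.vote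
  fun_prop

@[fun_prop]
theorem countTop {f : α → List ℕ} {P : α → ℕ} (hf : PT O f) (hP : PT O P) :
    PT O fun a => countTop (f a) (P a) := by
  unfold StackLang.countTop
  exact sum_range (by fun_prop) (by fun_prop)

@[fun_prop]
theorem target {f : α → List ℕ} (hf : PT O f) : PT O fun a => target (f a) := by
  unfold StackLang.target
  fun_prop

theorem wellFormed : PT O wellFormed := by
  have h : PT O fun L : List ℕ => (List.range (StackLang.numVotes L)).all fun v =>
      (List.range (L.getD 0 0)).all fun r => Nat.ble (StackLang.vote L v r + 1) (L.getD 0 0) &&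
        (List.range r).all fun r' => !Nat.beq (StackLang.vote L v r') (StackLang.vote L v r) := by
    refine all_range (by fun_prop) (all_range (by fun_prop) ?_)
    have := all_range (O := O) (f := fun x : (List ℕ × ℕ) × ℕ => x.2) (p := fun x r' =>
      !Nat.beq (StackLang.vote x.1.1 x.1.2 r') (StackLang.vote x.1.1 x.1.2 x.2))
      (by fun_prop) (by fun_prop)
    fun_prop
  unfold StackLang.wellFormed
  fun_prop

theorem solve {d : ℕ → ℝ} (hd : PT O (divisorLe d)) : PT O (solve d) := by
  have hcost : PT O fun y : List ℕ × ℕ × ℕ => itemCost d (y.1.getD 1 0) (y.1.getD 2 0)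
      (y.1.getD 3 0) (y.1.getD 4 0) (StackLang.target y.1) (StackLang.countTop y.1) y.2.1 y.2.2 := by
    unfold itemCost ahead
    have := sum_range (O := O) (f := fun y : List ℕ × ℕ × ℕ => y.1.getD 2 0) (g := fun y j =>
      bif !divisorLe d (y.1.getD 4 0 - 1, j, StackLang.countTop y.1 y.2.1 - y.2.2,
          StackLang.target y.1) ||
        (Nat.ble (y.2.1 + 1) (y.1.getD 3 0) && divisorLe d (j, y.1.getD 4 0 - 1,
          StackLang.target y.1, StackLang.countTop y.1 y.2.1 - y.2.2)) then 1 else 0)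
      (by fun_prop) (by fun_prop)
    fun_prop
  have := knapsack (c := fun L : List ℕ => itemCost d (L.getD 1 0) (L.getD 2 0)
    (L.getD 3 0) (L.getD 4 0) (StackLang.target L) (StackLang.countTop L))
    (f := fun L => L.getD 0 0) (x := fun L => L.getD 5 0) hcost (by fun_prop) (by fun_prop)
  unfold StackLang.solve
  fun_prop

theorem decideBribery {d : ℕ → ℝ} (hd : PT O (divisorLe d)) : PT O (decideBribery d) := by
  have h₁ := parse (O := O)
  have h₂ := wellFormed.comp h₁.snd
  have h₃ := (solve hd).comp h₁.snd
  exact (h₁.fst.and h₂).and h₃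

end PT

end StackLang

/-! ### Correctness of the decision procedure -/

namespace StackLang

open Apportionment

/-- Read from the right, the separator opens a new number and the bits follow from the most
significant one. The flag fails only for a zero bit prepended to zero, which `bits` never produces.
Cutting off commutes with doubling and adding a bit, and `1 ≤ cap` keeps the test for zero intact.
-/
theorem foldr_parseStep_encodeNumber {cap : ℕ} (hcap : 1 ≤ cap) (a : ℕ) (T : List ℕ) :
    (encodeNumber a).foldr (parseStep cap) (true, T) = (true, min a cap :: T) := by
  induction a using Nat.binaryRec' with
  | zero => simp [encodeNumber, parseStep]
  | bit b a hb ih =>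
    unfold encodeNumber at ih ⊢
    rw [Nat.bits_append_bit _ _ hb, List.map_cons, List.cons_append, List.foldr_cons, ih]
    have h : (b || Nat.ble 1 (min a cap)) = true := by
      rcases Nat.eq_zero_or_pos a with h | h
      · simp [hb h]
      · simp only [Bool.or_eq_true, Nat.ble_eq]
        omega
    simp only [parseStep, List.length_cons, List.headD_cons, List.tail_cons, h]
    refine Prod.ext (by simp) ?_
    simp only [Nat.bit_val, List.cons.injEq, and_true]
    cases b <;> simp only [Bool.toNat_true, Bool.toNat_false, cond_true, cond_false] <;> omega

theorem parse_encodeNumbers {cap : ℕ} (hcap : 1 ≤ cap) (l : List ℕ) :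
    parse cap (encodeNumbers l) = (true, l.map (min · cap)) := by
  induction l with
  | nil => rfl
  | cons a l ih =>
    unfold encodeNumbers parse at ih ⊢
    rw [List.flatMap_cons, List.foldr_append, ih, foldr_parseStep_encodeNumber hcap]
    rfl

/-- Each accepted symbol extends an encoding to an encoding: a separator prepends the number `0`,
and a bit extends the first number, where the flag rules out superfluous zeros. -/
theorem exists_of_parse {cap : ℕ} (hcap : 1 ≤ cap) (w : Word) (h : (parse cap w).1 = true) :
    ∃ l, w = encodeNumbers l ∧ (parse cap w).2 = l.map (min · cap) := by
  suffices ∃ l, w = encodeNumbers l by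
    obtain ⟨l, rfl⟩ := this
    exact ⟨l, rfl, by rw [parse_encodeNumbers hcap]⟩
  induction w with
  | nil => exact ⟨[], rfl⟩
  | cons x w ih =>
    rw [parse, List.foldr_cons, ← parse] at h
    rcases x with _ | b
    · obtain ⟨l, rfl⟩ := ih h
      exact ⟨0 :: l, by simp [encodeNumbers, encodeNumber]⟩
    · simp only [parseStep, Bool.and_eq_true, Bool.or_eq_true, Nat.ble_eq] at h
      obtain ⟨l, rfl⟩ := ih h.1
      rw [parse_encodeNumbers hcap] at h
      rcases l with _ | ⟨a, l⟩
      · simp at h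
      · refine ⟨Nat.bit b a :: l, ?_⟩
        have hb : a = 0 → b = true := by
          rintro rfl
          simpa using h.2.2
        simp [encodeNumbers, encodeNumber, Nat.bits_append_bit _ _ hb]

theorem length_le_length_encodeNumbers (l : List ℕ) : l.length ≤ (encodeNumbers l).length := by
  induction l with
  | nil => simp
  | cons a l ih =>
    simp only [encodeNumbers, encodeNumber, List.flatMap_cons, List.length_append,
      List.length_cons, List.length_nil] at ih ⊢
    omega

theorem flatten_ofFn {α : Type*} {m n : ℕ} (g : Fin n → Fin m → α) :
    (List.ofFn fun v => List.ofFn (g v)).flatten =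
      List.ofFn fun k : Fin (n * m) => g k.divNat k.modNat := by
  rw [List.ofFn_mul]
  congr 3
  funext v
  congr 1
  funext r
  have hm := r.pos
  congr 1 <;> ext
  · simp [Nat.add_comm, Nat.add_mul_div_right _ _ hm, Nat.div_eq_of_lt r.2]
  · simp [Nat.add_comm, Nat.add_mul_mod_self_right, Nat.mod_eq_of_lt r.2]

/-- The list of numbers of an instance with the threshold `τ` in place of its own. -/
def numbers (I : Instance) (τ : ℕ) : List ℕ :=
  [I.m, τ, I.κ, (I.pstar : ℕ), I.ℓ, I.K] ++
    (List.ofFn fun v : Fin I.n => List.ofFn fun r : Fin I.m => (I.E v r : ℕ)).flatten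

/-! ### The checks and counts on the list of numbers of an instance. -/

section Numbers

variable (I : Instance) (τ : ℕ)

theorem length_numbers : (numbers I τ).length = 6 + I.n * I.m := by
  simp only [numbers, flatten_ofFn, List.length_append, List.length_cons, List.length_nil,
    List.length_ofFn]

/-- The sum in `numVotes` is a division: it counts the positive multiples of `I.m` up to `I.n *
I.m`. -/
theorem numVotes_numbers : numVotes (numbers I τ) = I.n := by
  have hm := I.pstar.pos
  rw [numVotes, length_numbers, Nat.add_sub_cancel_left]
  change (∑ i ∈ Finset.range (I.n * I.m), bif Nat.ble ((i + 1) * I.m) (I.n * I.m) then 1 else 0) = _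
  have h : ∀ i, (bif Nat.ble ((i + 1) * I.m) (I.n * I.m) then 1 else 0) = if i < I.n then 1 else 0 := by
    intro i
    have : Nat.ble ((i + 1) * I.m) (I.n * I.m) = decide (i < I.n) := by
      rw [Bool.eq_iff_iff, Nat.ble_eq, decide_eq_true_iff, Nat.mul_le_mul_right_iff hm]
      exact Nat.succ_le_iff
    rw [this, Bool.cond_decide]
  have hle : I.n ≤ I.n * I.m := Nat.le_mul_of_pos_right _ hm
  simp only [h]
  rw [← Finset.card_filter, show (Finset.range (I.n * I.m)).filter (· < I.n) = Finset.range I.n by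
    ext i; simp only [Finset.mem_filter, Finset.mem_range]; omega, Finset.card_range]

theorem vote_numbers (v : Fin I.n) (r : Fin I.m) : vote (numbers I τ) v r = I.E v r := by
  have hlt : (v : ℕ) * I.m + r < I.n * I.m := by
    have := Nat.mul_le_mul_right I.m v.2
    have hr := r.2
    rw [Nat.succ_mul] at this
    omega
  change (numbers I τ).getD (6 + v * I.m + r) 0 = _
  rw [numbers, List.getD_append_right _ _ _ _ (by simp; omega), flatten_ofFn,
    List.getD_eq_getElem _ _ (by simp; omega), List.getElem_ofFn]
  have e : 6 + (v : ℕ) * I.m + r - 6 = r + v * I.m := by omega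
  congr 3 <;> ext
  · simp [e, Nat.add_mul_div_right _ _ r.pos, Nat.div_eq_of_lt r.2]
  · simp [e, Nat.add_mul_mod_self_right, Nat.mod_eq_of_lt r.2]

theorem countTop_numbers (P : Fin I.m) : countTop (numbers I τ) P = topChoices I.E P := by
  classical
  rw [countTop, numVotes_numbers, topChoices_eq P.pos, Finset.sum_range, Finset.card_filter]
  refine Finset.sum_congr rfl fun v _ => ?_
  have := vote_numbers I τ v ⟨0, P.pos⟩
  rw [show vote (numbers I τ) v 0 = _ from this]
  have e : Nat.beq (I.E v ⟨0, P.pos⟩) P = decide (I.E v ⟨0, P.pos⟩ = P) := by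
    rw [Bool.eq_iff_iff, Nat.beq_eq, decide_eq_true_iff, Fin.ext_iff]
  rw [e, Bool.cond_decide]

theorem wellFormed_numbers : wellFormed (numbers I τ) = true := by
  simp only [wellFormed, numVotes_numbers, length_numbers, Bool.and_eq_true, Nat.ble_eq,
    Nat.beq_eq, List.all_eq_true, List.mem_range, Bool.not_eq_true', Bool.eq_false_iff, ne_eq]
  refine ⟨⟨⟨⟨⟨⟨⟨by omega, I.pstar.2⟩, rfl⟩, I.one_le_ℓ⟩, I.ℓ_le_κ⟩, I.κ_le_n⟩, I.K_le_n⟩,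
    fun v hv r hr => ?_⟩
  change r < I.m at hr
  rw [vote_numbers I τ ⟨v, hv⟩ ⟨r, hr⟩]
  refine ⟨(I.E _ _).2, fun r' hr' => ?_⟩
  rw [vote_numbers I τ ⟨v, hv⟩ ⟨r', hr'.trans hr⟩, ← Fin.ext_iff, (I.E _).injective.eq_iff,
    Fin.mk.injEq]
  omega

theorem solve_numbers {d : ℕ → ℝ} (hd : StrictMono d) (h0 : ∀ i, 0 < d i)
    (hτ : ∀ x ≤ I.n, τ ≤ x ↔ I.τ ≤ x) : solve d (numbers I τ) = true ↔ I.Successful d := by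
  rw [successful_iff hd h0 I (countTop_numbers I τ) rfl hτ, solve]
  simp only [Bool.and_eq_true, Nat.ble_eq, and_assoc, target, numVotes_numbers]
  rfl

/-- Every number except the threshold is bounded by `I.n` or `I.m`, so only the threshold feels the
cut-off. -/
theorem map_numbers {cap : ℕ} (hn : I.n ≤ cap) (hm : I.m ≤ cap) :
    (numbers I τ).map (min · cap) = numbers I (min τ cap) := by
  have h : ∀ x ∈ (List.ofFn fun v : Fin I.n => List.ofFn fun r : Fin I.m => (I.E v r : ℕ)).flatten,
      min x cap = x := by
    intro x hx
    simp only [List.mem_flatten, List.mem_ofFn] at hx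
    obtain ⟨_, ⟨v, rfl⟩, hx⟩ := hx
    obtain ⟨r, rfl⟩ := List.mem_ofFn.1 hx
    have := (I.E v r).2
    omega
  have h₁ := I.ℓ_le_κ
  have h₂ := I.κ_le_n
  have h₃ := I.K_le_n
  have h₄ := I.pstar.2
  rw [numbers, List.map_append, List.map_congr_left h, List.map_id']
  simp only [List.map_cons, List.map_nil, numbers]
  rw [min_eq_left hm, min_eq_left (h₂.trans hn), min_eq_left (h₄.le.trans hm),
    min_eq_left (h₁.trans (h₂.trans hn)), min_eq_left (h₃.trans hn)]

end Numbers

/-- A list of numbers that passes the check describes an instance. -/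
theorem exists_instance_of_wellFormed {L : List ℕ} (h : wellFormed L = true) :
    ∃ I : Instance, L = numbers I (L.getD 1 0) := by
  simp only [wellFormed, Bool.and_eq_true, Nat.ble_eq, Nat.beq_eq, List.all_eq_true,
    List.mem_range, Bool.not_eq_true', Bool.eq_false_iff, ne_eq] at h
  obtain ⟨⟨⟨⟨⟨⟨⟨h6, hp⟩, hlen⟩, h1⟩, hℓ⟩, hκ⟩, hK⟩, hvote⟩ := h
  have hinj : ∀ v : Fin (numVotes L), Function.Injective fun r : Fin (L.getD 0 0) =>
      (⟨vote L v r, (hvote v v.2 r r.2).1⟩ : Fin (L.getD 0 0)) := by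
    intro v r r' hrr
    have hrr := Fin.mk.inj hrr
    rcases lt_trichotomy r r' with hlt | heq | hlt
    · exact absurd hrr ((hvote v v.2 r' r'.2).2 r hlt)
    · exact heq
    · exact absurd hrr.symm ((hvote v v.2 r r.2).2 r' hlt)
  let I : Instance := ⟨L.getD 0 0, numVotes L, fun v => Equiv.ofBijective _
    (Finite.injective_iff_bijective.1 (hinj v)), L.getD 1 0, L.getD 2 0, ⟨L.getD 3 0, hp⟩,
    L.getD 4 0, L.getD 5 0, h1, hℓ, hκ, hK⟩
  have hm : 0 < L.getD 0 0 := by omega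
  refine ⟨I, List.ext_getElem (hlen.trans (length_numbers I _).symm) fun i hi hi' => ?_⟩
  rw [← List.getD_eq_getElem L 0 hi, ← List.getD_eq_getElem _ 0 hi']
  rcases Nat.lt_or_ge i 6 with h | h
  · interval_cases i <;> rfl
  · obtain ⟨k, rfl⟩ := Nat.exists_eq_add_of_le h
    -- Position `k` of the ballot part is entry `k % m` of vote `k / m`, with `m = L.getD 0 0`.
    have hv : k / L.getD 0 0 < numVotes L := by
      rw [Nat.div_lt_iff_lt_mul hm]
      omega
    have := vote_numbers I (L.getD 1 0) ⟨k / L.getD 0 0, hv⟩ ⟨k % L.getD 0 0, Nat.mod_lt _ hm⟩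
    change (numbers I _).getD (6 + k / L.getD 0 0 * L.getD 0 0 + k % L.getD 0 0) 0 =
      L.getD (6 + k / L.getD 0 0 * L.getD 0 0 + k % L.getD 0 0) 0 at this
    rw [Nat.add_assoc, Nat.div_add_mod'] at this
    exact this.symm

theorem encode_eq (I : Instance) : I.encode = encodeNumbers (numbers I I.τ) := rfl

theorem le_length_numbers (I : Instance) (τ : ℕ) :
    I.n ≤ (numbers I τ).length ∧ I.m ≤ (numbers I τ).length := by
  have hn : 0 < I.n := (I.one_le_ℓ.trans I.ℓ_le_κ).trans I.κ_le_n
  rw [length_numbers]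
  have h₁ := Nat.le_mul_of_pos_right I.n I.pstar.pos
  have h₂ := Nat.le_mul_of_pos_left I.m hn
  omega

theorem decideBribery_encode {d : ℕ → ℝ} (hd : StrictMono d) (h0 : ∀ i, 0 < d i) (I : Instance) :
    decideBribery d I.encode = true ↔ I.Successful d := by
  obtain ⟨hn, hm⟩ := le_length_numbers I I.τ
  have h := length_le_length_encodeNumbers (numbers I I.τ)
  rw [decideBribery, encode_eq, parse_encodeNumbers (by omega),
    map_numbers I _ (by omega) (by omega), wellFormed_numbers, Bool.true_and, Bool.true_and]
  exact solve_numbers I _ hd h0 fun x hx => by omega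

/-- The check has only seen the numbers after the cut-off, so it must be excluded that an oversized
number was cut to an admissible one. Only the threshold may be large, and its true value is put back
into the instance. -/
theorem exists_instance_of_decideBribery {d : ℕ → ℝ} {w : Word} (h : decideBribery d w = true) :
    ∃ I : Instance, I.encode = w := by
  simp only [decideBribery, Bool.and_eq_true] at h
  obtain ⟨⟨hok, hwf⟩, -⟩ := h
  obtain ⟨l, rfl, hl⟩ := exists_of_parse (by omega) w hok
  rw [hl] at hwf
  obtain ⟨I, hI⟩ := exists_instance_of_wellFormed hwf
  have hlen := length_le_length_encodeNumbers l
  generalize (l.map fun x => min x ((encodeNumbers l).length + 1)).getD 1 0 = τ at hI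
  obtain ⟨hn, hm⟩ := le_length_numbers I τ
  rw [← hI, List.length_map] at hn hm
  have hbound := map_numbers I τ (hn.trans hlen) (hm.trans hlen)
  obtain ⟨T, hT⟩ : ∃ T, ∀ τ, numbers I τ = I.m :: τ :: T := ⟨_, fun _ => rfl⟩
  rcases l with _ | ⟨a, _ | ⟨b, l⟩⟩
  · simp [hT] at hI
  · simp [hT] at hI
  generalize (encodeNumbers (a :: b :: l)).length = c at *
  simp only [hT, List.map_cons, List.cons.injEq] at hI hbound
  obtain ⟨ha, -, hl⟩ := hI
  -- The numbers in `T` are unchanged by a cut at `c`, hence at most `c`. They arise by a cut at `c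
  -- + 1`, which therefore changed nothing. This is why the cut-off is one more than the length of
  -- the word.
  have hl' : l = T := by
    rw [← hl]
    refine (List.map_id' l).symm.trans (List.map_congr_left fun x hx => ?_)
    have h₁ : min x (c + 1) ∈ T := hl ▸ List.mem_map_of_mem hx
    rw [← hbound.2.2] at h₁
    obtain ⟨y, -, hy⟩ := List.mem_map.1 h₁
    omega
  have ha' : a = I.m := by
    have := hbound.1
    omega
  refine ⟨⟨I.m, I.n, I.E, b, I.κ, I.pstar, I.ℓ, I.K, I.one_le_ℓ, I.ℓ_le_κ, I.κ_le_n,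
    I.K_le_n⟩, ?_⟩
  rw [ha', hl', ← hT]
  rfl

theorem decideBribery_iff {d : ℕ → ℝ} (hd : StrictMono d) (h0 : ∀ i, 0 < d i) (w : Word) :
    decideBribery d w = true ↔ w ∈ AB d := by
  constructor
  · intro h
    obtain ⟨I, rfl⟩ := exists_instance_of_decideBribery h
    exact ⟨I, rfl, (decideBribery_encode hd h0 I).1 h⟩
  · rintro ⟨I, rfl, hI⟩
    exact (decideBribery_encode hd h0 I).2 hI

end StackLang

/-! ### Apportionment bribery is in P -/

namespace StackLang

open Apportionment Function

/-- A polynomial-time predicate on words is decided by a Turing machine in polynomial time. -/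
theorem PT.tm2ComputableInPolyTime {O : Oracle} {F : Word → Bool} (hF : PT O F) :
    Nonempty (Turing.TM2ComputableInPolyTime (id : List (Option Bool) → List (Option Bool))
      Computability.encodeBool F) := by
  obtain ⟨P, -, hP⟩ := hF
  obtain ⟨p, hp⟩ := hP (fun _ => 0) 1 (fun _ _ => Nat.one_pos)
  -- Programs in `PT` preserve their input, but in the end only the answer may remain, so the input
  -- stack is cleared.
  refine nonempty_tm2ComputableInPolyTime O (p.seq (clear 0)) F (P + 2 * .X + 1) fun w => ?_
  have h₁ := hp (update (fun _ => []) 0 w) w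
    (fun k hk => by
      obtain rfl : k = 0 := by simpa [Layout.width] using hk
      rfl)
    (fun k hk => update_of_ne (by omega) _ _)
  have h₂ := h₁.seq (clear_run 0 _)
  have e : write (update (fun _ => []) 0 w) 1 (Layout.width Bool) (Layout.rep (F w)) =
      update (update (fun _ => []) 0 w) 1 (bif F w then [some true] else []) := write_one _ _ _
  rw [e, update_comm (by omega), update_idem, update_of_ne (by omega), update_self] at h₂
  have e' : update (fun _ => []) 0 [] = (fun _ => [] : Store) := update_eq_self 0 _
  rw [e', size_word] at h₂
  obtain ⟨t, ht, hr⟩ := h₂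
  refine ⟨t, ?_, hr⟩
  simpa [add_assoc] using ht

theorem exists_oracle {d : ℕ → ℝ} (hd : ∀ i, 0 < d i) (h : PolyTimeComputable d) :
    ∃ O, PT O (divisorLe d) :=
  h.elim (exists_oracle_of_rational hd) exists_oracle_of_comparable

end StackLang

theorem mainTheorem1 (d : ℕ → ℝ) (d_strictMono : StrictMono d) (one_le_d : 1 ≤ d 0)
    (d_polyBounded : Apportionment.PolyBounded d)
    (d_polyTime : Apportionment.PolyTimeComputable d) :
    Apportionment.InP (Apportionment.AB d) := by
  have h0 : ∀ i, 0 < d i := fun i =>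
    one_pos.trans_le (one_le_d.trans (d_strictMono.monotone (Nat.zero_le i)))
  obtain ⟨O, hO⟩ := StackLang.exists_oracle h0 d_polyTime
  classical
  have h : (fun w => decide (w ∈ Apportionment.AB d)) = StackLang.decideBribery d := by
    funext w
    rw [Bool.eq_iff_iff, decide_eq_true_iff, StackLang.decideBribery_iff d_strictMono h0]
  unfold Apportionment.InP
  convert (StackLang.PT.decideBribery hO).tm2ComputableInPolyTime using 2
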